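/- Let $q=2^f$ with $f\ge 1$, let $\mathbb F_q$ be the field with $q$ elements, $\phi(x)=e^{2\pi i\,\mathrm{Tr}(x)/2}$ for $x\in\mathbb F_q$ ($\mathrm{Tr}$ the trace to $\mathbb F_2$), and let $U=\mathrm{UF}_4(q)$ be the Sylow $2$-subgroup of the Chevalley group $\mathrm F_4(q)$ generated by the root subgroups $X_i=\{x_i(t)\mid t\in\mathbb F_q\}$ of the positive roots $\alpha_1,\dots,\alpha_{24}$, where $\alpha_1,\alpha_2$ are the long and $\alpha_3,\alpha_4$ the short simple roots and, writing $abcd$ for $a\alpha_1+b\alpha_2+c\alpha_3+d\alpha_4$, $$\alpha_5,\dots,\alpha_{24}=1100,\,0110,\,0011,\,1110,\,0120,\,0111,\,1120,\,1111,\,0121,\,1220,\,1121,\,0122,\,1221,\,1122,\,1231,\,1222,\,1232,\,1242,\,1342,\,2342 .$$ Let $\mathcal A=\{\alpha_1,\alpha_4\}$, $\mathcal P=\Phi^+\setminus\mathcal A$, $\mathcal S=\{\alpha_2,\alpha_3,\alpha_5,\alpha_6,\alpha_7,\alpha_8,\alpha_9,\alpha_{10},\alpha_{12},\alpha_{18}\}$,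 $\mathcal N=\mathcal P\setminus\mathcal S$ and $\mathcal Z=\{\alpha_6,\alpha_8,\alpha_9,\alpha_{10},\alpha_{12},\alpha_{18}\}$. For a set $\mathcal Q$ of positive roots let $X_{\mathcal Q}$ be the group generated by the $X_i$ with $\alpha_i\in\mathcal Q$. Then $X_{\mathcal N}$ is normal in $X_{\mathcal P}$; put $X_{\mathcal S}=X_{\mathcal P}/X_{\mathcal N}$. Exactly four pairs of root subgroups of $X_{\mathcal S}$ do not commute, namely those with indices $(2,3),(2,7),(3,5),(5,7)$ (so $(\mathcal S,\mathcal Z)$ has the form $[6,10,4]$). Let $\mathcal F_{11}=\mathrm{Irr}(X_{\mathcal S})_{\mathcal Z}$ be the (finite) set of irreducible complex characters of $X_{\mathcal S}$ whose restriction to $X_\gamma$ is nontrivial for every $\gamma\in\mathcal Z$. **(1)** The map $\chi\mapsto\mathrm{Ind}_{X_{\mathcal P}}^{U}\mathrm{Inf}\,\chi$ is an injection of $\mathcal F_{11}$ into $\mathrm{Irr}(U)$, and it multiplies degrees by $q^2$. **(2)** For $a=(a_6,a_8,a_9,a_{10},a_{12},a_{18})\in(\mathbb F_q^\times)^6$ let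 $\lambda_a$ be the linear character of $X_{\mathcal Z}$ with $\lambda_a(x_\gamma(t))=\phi(a_\gamma t)$, let $X'_a$ be the group of all $x_2(t_2)x_5(t_5)$ with $$\phi\bigl(s_3(a_9t_2s_3+a_6t_2+a_8t_5)+s_7(a_{18}t_5s_7+a_{12}t_5+a_{10}t_2)\bigr)=1\qquad(\ast)$$ for all $s_3,s_7\in\mathbb F_q$, let $Y'_a$ be the group of all $x_3(s_3)x_7(s_7)$ such that $(\ast)$ holds for all $t_2,t_5\in\mathbb F_q$, and put $H'_a=X'_aX_3X_7X_{\mathcal Z}$. For every $a$ and all linear characters $\mu$ of $X'_a$ and $\nu$ of $Y'_a$ there is exactly one character $\chi$ of $X_{\mathcal S}$ that is induced from a linear character of $H'_a$ extending $\lambda_a$, $\mu$ and $\nu$; it lies in $\mathcal F_{11}$ and satisfies $\chi(x_\gamma(t))=\chi(1)\phi(a_\gamma t)$ for all $\gamma\in\mathcal Z$ and $t\in\mathbb F_q$; and every $\chi\in\mathcal F_{11}$ arises in this way from exactly one triple $(a,\mu,\nu)$. **(3)** Put $b=a_6/a_9$, $c=a_8a_{10}^2/(a_9^2a_{18})$,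 $d=a_6a_{10}a_{12}/(a_9^2a_{18})$, and let $r$ be the number of roots in $\mathbb F_q$ of $X^3+(d/b+b^2)X+(d+c)$. The subfamilies below consist of the $\chi\in\mathcal F_{11}$ whose parameter $a$ satisfies the given condition. If $f$ is even, then $\mathcal F_{11}=\bigsqcup_{i=1}^7\mathcal F_{11}^{f\text{ even},i}$, where * $i=1$ ($d=b^3$, $c=d$): $(q-1)^4$ characters of degree $q^2$; * $i=2$ ($d\ne b^3$, $c=d$): $4(q-1)^4(q-2)$ characters of degree $q^2/2$; * $i=3$ ($d=b^3$, $c\ne d$, $c+b^3$ not a cube in $\mathbb F_q$): $2(q-1)^5/3$ characters of degree $q^2$; * $i=4$ ($d=b^3$, $c\ne d$, $c+b^3$ a cube in $\mathbb F_q$): $16(q-1)^4(q-4)/3$ characters of degree $q^2/4$; * $i=5$ ($d\ne b^3$, $c\ne d$, $r=0$): $(q-1)^5(q-2)/3$ characters of degree $q^2$; * $i=6$ ($d\ne b^3$, $c\ne d$, $r=1$): $2q(q-1)^4(q-3)$ characters of degree $q^2/2$; * $i=7$ ($d\ne b^3$, $c\ne d$, $r=3$): $8(q-1)^4(q-4)(q-5)/3$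 characters of degree $q^2/4$. If $f$ is odd, then $\mathcal F_{11}=\bigsqcup_{j=1}^6\mathcal F_{11}^{f\text{ odd},j}$, where * $j=1$ ($d=b^3$, $c=d$): $(q-1)^4$ characters of degree $q^2$; * $j=2$ ($d\ne b^3$, $c=d$): $4(q-1)^4(q-2)$ characters of degree $q^2/2$; * $j=3$ ($d=b^3$, $c\ne d$): $4(q-1)^4(q-2)$ characters of degree $q^2/2$; * $j=4$ ($d\ne b^3$, $c\ne d$, $r=0$): $(q-1)^4(q-2)(q+1)/3$ characters of degree $q^2$; * $j=5$ ($d\ne b^3$, $c\ne d$, $r=1$): $2(q-1)^4(q-2)(q-3)$ characters of degree $q^2/2$; * $j=6$ ($d\ne b^3$, $c\ne d$, $r=3$): $8(q-1)^4(q-2)(q-5)/3$ characters of degree $q^2/4$. In a subfamily of characters of degree $q^2/k$, with $k\in\{1,2,4\}$, one has $|X'_a|=|Y'_a|=k$ for every parameter $a$ satisfying its condition. -/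

import Mathlib

noncomputable section

/-! ### Complex characters of finite groups -/

/-- The set `Irr(G)` of complex irreducible characters of `G`. -/
def IrrChar (G : Type*) [Group G] : Set (G → ℂ) :=
  {χ | ∃ (n : ℕ) (ρ : Representation ℂ G (Fin n → ℂ)), ρ.IsIrreducible ∧ ρ.character = χ}

open Classical in
/-- The induced class function `Ind_H^G ψ`, for a finite group `G`. -/
def induce {G : Type*} [Group G] (H : Subgroup G) (ψ : H → ℂ) (g : G) : ℂ :=
  (Nat.card H : ℂ)⁻¹ * ∑ᶠ x : G, if h : x⁻¹ * g * x ∈ H then ψ ⟨x⁻¹ * g * x, h⟩ else 0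

/-- The character `φ` of the additive group of a field `K` of characteristic `2`,
`φ(x) = exp(2πi Tr(x) / 2)`, where `Tr` is the trace from `K` to the prime field. -/
def phi {K : Type*} [Field K] [CharP K 2] (x : K) : ℂ :=
  letI := ZMod.algebra K 2
  ZMod.stdAddChar (Algebra.trace (ZMod 2) K x)

namespace UF4

/-! ### The root system of type `F₄` -/

/-- The positive roots `α₁, …, α₂₄` in coordinates with respect to the simple roots
`α₁, α₂` (long), `α₃, α₄` (short). Row number `i` is the root `α_{i+1}`. -/
def posRoot : Fin 24 → Fin 4 → ℤ :=
  ![![1, 0, 0, 0], ![0, 1, 0, 0], ![0, 0, 1, 0], ![0, 0, 0, 1],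
    ![1, 1, 0, 0], ![0, 1, 1, 0], ![0, 0, 1, 1],
    ![1, 1, 1, 0], ![0, 1, 2, 0], ![0, 1, 1, 1],
    ![1, 1, 2, 0], ![1, 1, 1, 1], ![0, 1, 2, 1],
    ![1, 2, 2, 0], ![1, 1, 2, 1], ![0, 1, 2, 2],
    ![1, 2, 2, 1], ![1, 1, 2, 2],
    ![1, 2, 3, 1], ![1, 2, 2, 2],
    ![1, 2, 3, 2], ![1, 2, 4, 2], ![1, 3, 4, 2], ![2, 3, 4, 2]]

/-- `α n` is the index of the positive root `α_n`, for `1 ≤ n ≤ 24`. -/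
def α (n : ℕ) : Fin 24 := Fin.ofNat 24 (n - 1)

/-- The root system: `(true, i)` is a positive root and `(false, i)` is its negative. -/
abbrev Root : Type := Bool × Fin 24

/-- The coordinates of a root. -/
def Root.vec (β : Root) : Fin 4 → ℤ := if β.1 then posRoot β.2 else -posRoot β.2

/-- The Gram matrix of the simple roots, for the invariant form for which the long roots have
square length `4` and the short roots have square length `2`. -/
def gram : Matrix (Fin 4) (Fin 4) ℤ :=
  !![ 4, -2,  0,  0;
     -2,  4, -2,  0;
      0, -2,  2, -1;
      0,  0, -1,  2]

/-- The invariant form on the root lattice. -/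
def form (v w : Fin 4 → ℤ) : ℤ := v ⬝ᵥ gram.mulVec w

/-- The integer `⟨v, α_j^∨⟩ = 2 (v, α_j) / (α_j, α_j)`. -/
def pairing (v : Fin 4 → ℤ) (j : Fin 4) : ℤ := 2 * form v (Pi.single j 1) / gram j j

/-- The coefficient of the simple coroot `α_j^∨` in the coroot `v^∨` of a root `v`. -/
def corootCoeff (v : Fin 4 → ℤ) (j : Fin 4) : ℤ := v j * gram j j / form v v

/-- The largest `r` such that `w - r v` is a root, for roots `v` and `w ≠ ±v`. -/
def stringLength (v w : Fin 4 → ℤ) : ℕ :=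
  Nat.findGreatest (fun r => ∃ γ : Root, γ.vec = w - r • v) 3

/-! ### The group `UF₄(q)`, `q` even, by the adjoint construction of Chevalley -/

/-- The index set of the Chevalley basis `{e_β} ∪ {h_j}` of the simple Lie algebra of type `F₄`. -/
abbrev Idx : Type := Root ⊕ Fin 4

/-- The matrix of the divided power `(ad e_{α_i})^k / k!`, for `k ≤ 2`, in the Chevalley basis,
up to signs of its entries (they play no role in characteristic `2`):
`(ad e_α)^k / k!` maps `e_β`, for `β ≠ -α`, to `± binom(r + k, k) e_{β + kα}` with `r` the largest
integer for which `β - rα` is a root; `ad e_α` maps `e_{-α}` to `h_α` and `h_j` to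
`-⟨α, α_j^∨⟩ e_α`, and `(ad e_α)^2 / 2` maps `e_{-α}` to `-e_α`. -/
def divPow (i : Fin 24) (k : ℕ) : Matrix Idx Idx ℤ
  | .inl γ, .inl β =>
      if γ.vec = β.vec + k • posRoot i then
        ((stringLength (posRoot i) β.vec + k).choose k : ℤ) else 0
  | .inl γ, .inr j => if k = 1 ∧ γ = (true, i) then pairing (posRoot i) j else 0
  | .inr j, .inl β => if k = 1 ∧ β = (false, i) then corootCoeff (posRoot i) j else 0
  | .inr j, .inr l => if k = 0 ∧ j = l then 1 else 0

/-- The matrix of `exp(t ad e_{α_i})` over a field `K` of characteristic `2`. -/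
def rootMatrix {K : Type*} [Field K] (i : Fin 24) (t : K) : Matrix Idx Idx K :=
  ∑ k ∈ Finset.range 3, t ^ k • (divPow i k).map (Int.cast : ℤ → K)

/-- The height of a root vector `v`. -/
def ht (v : Fin 4 → ℤ) : ℤ := v 0 + v 1 + v 2 + v 3

/-- The degree of a basis element for the grading by height. -/
def Idx.deg : Idx → ℤ
  | .inl β => ht β.vec
  | .inr _ => 0

theorem ht_posRoot_pos (i : Fin 24) : 0 < ht (posRoot i) := by
  revert i; decide

theorem vec_injective : Function.Injective Root.vec := by
  have : ∀ β γ : Root, β.vec = γ.vec → β = γ := by decide +kernel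
  exact fun β γ h => this β γ h

theorem divPow_eq_zero (i : Fin 24) (k : ℕ) (p r : Idx)
    (h : Idx.deg p ≠ Idx.deg r + k * ht (posRoot i)) : divPow i k p r = 0 := by
  rcases p with γ | j <;> rcases r with β | l <;> simp only [divPow, ite_eq_right_iff]
  · intro hγ
    refine absurd ?_ h
    simp only [Idx.deg, hγ, ht, Pi.add_apply, Pi.smul_apply]
    simp only [nsmul_eq_mul]
    ring
  · rintro ⟨rfl, rfl⟩
    exact absurd (by simp [Idx.deg, Root.vec]) h
  · rintro ⟨rfl, rfl⟩
    exact absurd (by simp [Idx.deg, Root.vec, ht]; ring) h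
  · rintro ⟨rfl, rfl⟩
    exact absurd (by simp [Idx.deg]) h

theorem divPow_zero (i : Fin 24) : divPow i 0 = 1 := by
  ext p r
  rcases p with γ | j <;> rcases r with β | l <;>
    simp [divPow, Matrix.one_apply, vec_injective.eq_iff]

theorem det_rootMatrix {K : Type*} [Field K] (i : Fin 24) (t : K) :
    (rootMatrix i t).det = 1 := by
  have hpos := ht_posRoot_pos i
  have key : ∀ p r : Idx, Idx.deg p ≤ Idx.deg r →
      rootMatrix i t p r = (1 : Matrix Idx Idx K) p r := by
    intro p r hpr
    have h1 : divPow i 1 p r = 0 := divPow_eq_zero i 1 p r (by push_cast; omega)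
    have h2 : divPow i 2 p r = 0 := divPow_eq_zero i 2 p r (by push_cast; omega)
    simp [rootMatrix, Finset.sum_range_succ, h1, h2, divPow_zero, Matrix.one_apply]
  have hT : (rootMatrix i t).BlockTriangular (fun p => -Idx.deg p) := by
    intro p r h
    have h' : Idx.deg p < Idx.deg r := by simpa using h
    rw [key p r h'.le, Matrix.one_apply_ne]
    rintro rfl
    exact lt_irrefl _ h'
  rw [hT.det]
  refine Finset.prod_eq_one fun a _ => ?_
  have : (rootMatrix i t).toSquareBlock (fun p => -Idx.deg p) a = 1 := by
    ext ⟨p, hp⟩ ⟨r, hr⟩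
    have := key p r (by omega)
    simp [Matrix.toSquareBlock_def, this, Matrix.one_apply]
  rw [this, Matrix.det_one]

/-- `exp(t ad e_{α_i})` as an invertible matrix. -/
def rootGL {K : Type*} [Field K] (i : Fin 24) (t : K) : GL Idx K :=
  Matrix.GeneralLinearGroup.mkOfDetNeZero (rootMatrix i t)
    (by rw [det_rootMatrix]; exact one_ne_zero)

/-- The group `U = UF₄(q)`, where `K` is the field with `q = 2 ^ f` elements: the subgroup of the
Chevalley group `F₄(q)` generated by all root subgroups of positive roots. -/
def U (K : Type*) [Field K] [CharP K 2] : Subgroup (GL Idx K) :=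
  Subgroup.closure {g | ∃ (i : Fin 24) (t : K), g = rootGL i t}

/-- The root element `x_i(t)` of `U`. -/
def x {K : Type*} [Field K] [CharP K 2] (i : Fin 24) (t : K) : U K :=
  ⟨rootGL i t, Subgroup.subset_closure ⟨i, t, rfl⟩⟩

/-! ### Pattern groups and quattern groups -/

/-- The pattern group `X_P`, generated by the root subgroups of the roots in `P`. -/
def X (K : Type*) [Field K] [CharP K 2] (P : Finset (Fin 24)) : Subgroup (U K) :=
  Subgroup.closure {g | ∃ i ∈ P, ∃ t : K, g = x i t}

theorem x_mem {K : Type*} [Field K] [CharP K 2] {P : Finset (Fin 24)} {i : Fin 24} (hi : i ∈ P)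
    (t : K) : x i t ∈ X K P :=
  Subgroup.subset_closure ⟨i, hi, t, rfl⟩

/-- The quattern group `X_P / X_N`. (When `X_N` is a normal subgroup of `X_P`, it is its own
normal closure.) -/
abbrev Quattern (K : Type*) [Field K] [CharP K 2] (P N : Finset (Fin 24)) : Type _ :=
  X K P ⧸ Subgroup.normalClosure (((X K N).subgroupOf (X K P) : Subgroup (X K P)) : Set (X K P))

/-- The image of `x_i(t)` in the quattern group `X_P / X_N`, for `i ∈ P`. -/
def Quattern.x {K : Type*} [Field K] [CharP K 2] (P N : Finset (Fin 24)) (i : Fin 24) (t : K) :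
    Quattern K P N :=
  if hi : i ∈ P then QuotientGroup.mk ⟨UF4.x i t, x_mem hi t⟩ else 1

/-- The set `Irr(X_S)_Z`, `S = P ∖ N`, of the irreducible characters of the quattern group
`X_S = X_P / X_N` whose restriction to each root subgroup `X_γ`, `γ ∈ Z`, is nontrivial. -/
def Quattern.Irr (K : Type*) [Field K] [CharP K 2] (P N Z : Finset (Fin 24)) :
    Set (Quattern K P N → ℂ) :=
  {χ | χ ∈ IrrChar (Quattern K P N) ∧ ∀ γ ∈ Z, ∃ t : K, χ (Quattern.x P N γ t) ≠ χ 1}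

/-- Inflation of a class function from `X_P / X_N` to `X_P`, followed by induction to `U`. -/
def Quattern.toU {K : Type*} [Field K] [CharP K 2] {P N : Finset (Fin 24)}
    (χ : Quattern K P N → ℂ) : U K → ℂ :=
  induce (X K P) fun h => χ (QuotientGroup.mk h)

/-! ### The core of the form `[6, 10, 4]` and the family `F₁₁` -/

/-- The set `S` of the core. -/
def coreS : Finset (Fin 24) := {α 2, α 3, α 5, α 6, α 7, α 8, α 9, α 10, α 12, α 18}

/-- The set `Z` of the core. -/
def coreZ : Finset (Fin 24) := {α 6, α 8, α 9, α 10, α 12, α 18}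

/-- The set `A` (arms) of the core. -/
def coreA : Finset (Fin 24) := {α 1, α 4}

/-- `P = Φ⁺ ∖ A`. -/
def coreP : Finset (Fin 24) := Finset.univ \ coreA

/-- `P ∖ S`; it contains the set `L = {α₁₁, α₁₆}` of legs. -/
def coreN : Finset (Fin 24) := coreP \ coreS

/-- The quattern group `X_S` of the core. -/
abbrev XS (K : Type*) [Field K] [CharP K 2] : Type _ := Quattern K coreP coreN

/-- The element `x_n(t)` of `X_S`, for the root `α_n ∈ S`. -/
def xS {K : Type*} [Field K] [CharP K 2] (n : ℕ) (t : K) : XS K :=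
  Quattern.x coreP coreN (α n) t

/-- The family `F₁₁ = Irr(X_S)_Z`. -/
def F11 (K : Type*) [Field K] [CharP K 2] : Set (XS K → ℂ) := Quattern.Irr K coreP coreN coreZ

/-- The parameters `a_γ ∈ K^×`, `γ ∈ Z`, of a character `λ` of `X_Z` that is nontrivial on all
`X_γ`: `λ(x_γ(t)) = φ(a_γ t)`. -/
@[ext]
structure Param (K : Type*) [Field K] where
  (a6 a8 a9 a10 a12 a18 : Kˣ)

/-- A complex function on `X_S` is `ψ(1) λ` on the root subgroups in `X_Z`, where `λ` is the
linear character of `X_Z` with parameters `a`. -/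
def HasParam {K : Type*} [Field K] [CharP K 2] (ψ : XS K → ℂ) (a : Param K) : Prop :=
  ∀ t : K,
    ψ (xS 6 t) = ψ 1 * phi (a.a6 * t) ∧ ψ (xS 8 t) = ψ 1 * phi (a.a8 * t) ∧
    ψ (xS 9 t) = ψ 1 * phi (a.a9 * t) ∧ ψ (xS 10 t) = ψ 1 * phi (a.a10 * t) ∧
    ψ (xS 12 t) = ψ 1 * phi (a.a12 * t) ∧ ψ (xS 18 t) = ψ 1 * phi (a.a18 * t)

/-- The equation `λ([y, x]) = 1` for `x = x₂(t₂) x₅(t₅)` and `y = x₃(s₃) x₇(s₇)`. -/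
def StabEq {K : Type*} [Field K] [CharP K 2] (a : Param K) (t2 t5 s3 s7 : K) : Prop :=
  phi (s3 * (a.a9 * t2 * s3 + a.a6 * t2 + a.a8 * t5) +
    s7 * (a.a18 * t5 * s7 + a.a12 * t5 + a.a10 * t2)) = 1

/-- The group `X'` of all `x = x₂(t₂) x₅(t₅)` with `λ([y, x]) = 1` for all `y ∈ X₃ X₇`. -/
def X' {K : Type*} [Field K] [CharP K 2] (a : Param K) : Subgroup (XS K) :=
  Subgroup.closure
    {g | ∃ t2 t5 : K, (∀ s3 s7 : K, StabEq a t2 t5 s3 s7) ∧ g = xS 2 t2 * xS 5 t5}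

/-- The group `Y'` of all `y = x₃(s₃) x₇(s₇)` with `λ([y, x]) = 1` for all `x ∈ X₂ X₅`. -/
def Y' {K : Type*} [Field K] [CharP K 2] (a : Param K) : Subgroup (XS K) :=
  Subgroup.closure
    {g | ∃ s3 s7 : K, (∀ t2 t5 : K, StabEq a t2 t5 s3 s7) ∧ g = xS 3 s3 * xS 7 s7}

/-- The group `Y X_Z`, where `Y = X₃ X₇`. -/
def YZ (K : Type*) [Field K] [CharP K 2] : Subgroup (XS K) :=
  Subgroup.closure {g | ∃ n ∈ ({3, 7, 6, 8, 9, 10, 12, 18} : Finset ℕ), ∃ t : K, g = xS n t}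

/-- The stabilizer `H' = X' Y X_Z`. -/
def H' {K : Type*} [Field K] [CharP K 2] (a : Param K) : Subgroup (XS K) := X' a ⊔ YZ K

/-- `χ` carries the label `(a, μ, ν)`: it is induced from a linear character of `H'` which
restricts to `λ` on `X_Z`, to `μ` on `X'` and to `ν` on `Y'`. -/
def HasLabel {K : Type*} [Field K] [CharP K 2] (χ : XS K → ℂ) (a : Param K)
    (μ : X' a →* ℂˣ) (ν : Y' a →* ℂˣ) : Prop :=
  ∃ θ : H' a →* ℂˣ,
    (∀ (h : H' a) (t : K),
      ((h : XS K) = xS 6 t → (θ h : ℂ) = phi (a.a6 * t)) ∧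
      ((h : XS K) = xS 8 t → (θ h : ℂ) = phi (a.a8 * t)) ∧
      ((h : XS K) = xS 9 t → (θ h : ℂ) = phi (a.a9 * t)) ∧
      ((h : XS K) = xS 10 t → (θ h : ℂ) = phi (a.a10 * t)) ∧
      ((h : XS K) = xS 12 t → (θ h : ℂ) = phi (a.a12 * t)) ∧
      ((h : XS K) = xS 18 t → (θ h : ℂ) = phi (a.a18 * t))) ∧
    (∀ (h : H' a) (g : X' a), (h : XS K) = g → θ h = μ g) ∧
    (∀ (h : H' a) (g : Y' a), (h : XS K) = g → θ h = ν g) ∧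
    χ = induce (H' a) fun h => (θ h : ℂ)

/-! ### The subfamilies -/

/-- `b = a₆ / a₉`. -/
def Param.b {K : Type*} [Field K] (a : Param K) : K := a.a6 / a.a9

/-- `c = a₈ a₁₀² / (a₉² a₁₈)`. -/
def Param.c {K : Type*} [Field K] (a : Param K) : K := a.a8 * a.a10 ^ 2 / (a.a9 ^ 2 * a.a18)

/-- `d = a₆ a₁₀ a₁₂ / (a₉² a₁₈)`. -/
def Param.d {K : Type*} [Field K] (a : Param K) : K := a.a6 * a.a10 * a.a12 / (a.a9 ^ 2 * a.a18)

/-- The number of roots in `K` of the cubic `X³ + (d/b + b²) X + (d + c)`. -/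
def Param.numRoots {K : Type*} [Field K] (a : Param K) : ℕ :=
  {z : K | z ^ 3 + (a.d / a.b + a.b ^ 2) * z + (a.d + a.c) = 0}.ncard

/-- The characters in `F₁₁` whose parameter `a` satisfies a given condition. -/
def subfamily {K : Type*} [Field K] [CharP K 2] (C : Param K → Prop) : Set (XS K → ℂ) :=
  {χ | χ ∈ F11 K ∧ ∃ a : Param K, HasParam χ a ∧ C a}

/-- The conditions on `a` that define the seven subfamilies for even `f`. -/
def evenCond {K : Type*} [Field K] : Fin 7 → Param K → Prop :=
  ![fun a => a.d = a.b ^ 3 ∧ a.c = a.d,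
    fun a => a.d ≠ a.b ^ 3 ∧ a.c = a.d,
    fun a => a.d = a.b ^ 3 ∧ a.c ≠ a.d ∧ ¬ ∃ y : K, y ^ 3 = a.c + a.b ^ 3,
    fun a => a.d = a.b ^ 3 ∧ a.c ≠ a.d ∧ ∃ y : K, y ^ 3 = a.c + a.b ^ 3,
    fun a => a.d ≠ a.b ^ 3 ∧ a.c ≠ a.d ∧ a.numRoots = 0,
    fun a => a.d ≠ a.b ^ 3 ∧ a.c ≠ a.d ∧ a.numRoots = 1,
    fun a => a.d ≠ a.b ^ 3 ∧ a.c ≠ a.d ∧ a.numRoots = 3]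

/-- The conditions on `a` that define the six subfamilies for odd `f`. -/
def oddCond {K : Type*} [Field K] : Fin 6 → Param K → Prop :=
  ![fun a => a.d = a.b ^ 3 ∧ a.c = a.d,
    fun a => a.d ≠ a.b ^ 3 ∧ a.c = a.d,
    fun a => a.d = a.b ^ 3 ∧ a.c ≠ a.d,
    fun a => a.d ≠ a.b ^ 3 ∧ a.c ≠ a.d ∧ a.numRoots = 0,
    fun a => a.d ≠ a.b ^ 3 ∧ a.c ≠ a.d ∧ a.numRoots = 1,
    fun a => a.d ≠ a.b ^ 3 ∧ a.c ≠ a.d ∧ a.numRoots = 3]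

/-- The subfamilies `F₁₁^{f even, i}`, `i = 1, …, 7` (here numbered from `0`). -/
def F11even (K : Type*) [Field K] [CharP K 2] (i : Fin 7) : Set (XS K → ℂ) :=
  subfamily (evenCond i)

/-- The subfamilies `F₁₁^{f odd, j}`, `j = 1, …, 6` (here numbered from `0`). -/
def F11odd (K : Type*) [Field K] [CharP K 2] (j : Fin 6) : Set (XS K → ℂ) :=
  subfamily (oddCond j)

end UF4

end

/-!
The group `U` is given by matrices acting on the adjoint module in characteristic `2`. All that is
needed about it is a finite computation. A root is encoded by the decimal number of its
coefficients, so that adding roots is adding numbers, and the columns of `rootMatrix i t` become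
short lists of basis vectors (`rootMatrix_mulVec`). The relation `x_i(s) x_i(t) = x_i(s + t)` and
the commutator formula for each pair of positive roots are identities between formal vectors over
monomials in `s` and `t`, which the kernel checks on every basis vector (`rootMatrix_add`,
`rootMatrix_mul_of_lt`). They show that `X_N` is normal in `X_P` and `X_P` is normal in `U`
(`X_conj_mem`).

Modulo `X_N` the root subgroups of `Z` are central, and the commutators of `x₂ x₅` with `x₃ x₇` lie
in `X_Z`. So every element of `X_S` is a product `x₂(v₁) x₅(v₂) x₃(w₁) x₇(w₂) z` with `z` in `X_Z`.
That the coordinates are unique is seen from the action of `X_P` on the section of the adjoint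
module with basis `h₁`, `e₂`, `e₅` and the `e_γ`, `γ ∈ Z` (`ActsAs`, `HasCoord.unique`). Hence `X_S`
is a group of Heisenberg type (`HeisenbergData`, `dataXS`) with a biadditive `bracket`.

For such a group and a linear character `ψ` of the central part, consider the pairing
`(v, w) ↦ ψ (B v w)` and its left and right radicals. On an irreducible character with central
character `ψ` the radicals act through linear characters `μ` and `ν`, and the character vanishes off
the product of the radicals with the center; conversely each pair `(μ, ν)` arises, by induction from
the stabilizer (`Radicals`, `charFn`, `exists_eq_charFn`, `induce_linear`). The degree is `|V|`
divided by the order of the left radical. For `X_S` and `ψ = λ_a` the radicals are `X'` and `Y'`,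
which have the same order `k`, as follows by summing `ψ (B v w)` in both orders (`card_mul_card`).
So each parameter `a` contributes `k²` characters of degree `q² / k`.

The elements `x₁(a) x₄(b)` represent the cosets of `X_P` in `U`. They conjugate `x₁₁(s)` and
`x₁₆(s)`, which are trivial in `X_S`, into elements with a component in `X₁₈`, on which the
characters of `F₁₁` are not trivial. Thus no element outside `X_P` conjugates an inflated character
of `F₁₁` into an inflated character (`conjFun_infl_ne`), and induction to `U` is injective and
preserves irreducibility (`sum_induce_mul_induce_inv`).

It remains to count parameters by the order of `Y'`. Eliminating the second coordinate identifies
`Y'` with the solutions of `x (x³ + A x + B) = 0`, where `A = d / b³ + 1` and `B = (c + d) / b³`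
(`card_Y'`), and the parameters are four free units together with a pair `(A, B)` such that `A ≠ 1`
and `B ≠ A + 1` (`scaleEquiv`). For `A = 0` the question is how many elements of the field are
cubes. For `A, B ≠ 0` the cubic has `0`, `1` or `3` roots, and the three numbers of cubics are found
from the number of all pairs, the total number of roots and the number of ordered pairs of distinct
roots (`card_generic`, `sum_card_rts`, `sum_card_offDiag_rts`, `numGeneric_equations`). The parity
of `f` matters because the field contains two primitive cube roots of unity if `f` is even, and none
if `f` is odd.
-/

noncomputable section

namespace UF4

/-! ### Numerical codes for roots and basis vectors -/

/-- The positive root `a α₁ + b α₂ + c α₃ + d α₄` written as the decimal number `abcd`, in the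
order of `posRoot`. -/
def posCode : List ℕ :=
  [1000, 100, 10, 1, 1100, 110, 11, 1110, 120, 111, 1120, 1111, 121, 1220, 1121, 122, 1221, 1122,
    1231, 1222, 1232, 1242, 1342, 2342]

/-- The number whose binary digits `1` are at the places `5555 ± c`, for the codes `c` of the
positive roots. -/
def rootMask : ℕ := posCode.foldl (fun m c => m + 2 ^ (5555 + c) + 2 ^ (5555 - c)) 0

/-- The root `±α` has the code `5555 ± c`, where `c` is the decimal code of `α`, so that adding
roots is adding codes, up to the offset. This tests whether a number is the code of a root. -/
def isRoot (c : ℕ) : Bool := Nat.beq (Nat.land (Nat.shiftRight rootMask c) 1) 1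

/-- The coefficient modulo `2` of the `j`-th simple coroot in the coroot of the positive root with
decimal code `a`. A root is long if its last two coefficients are even. -/
def corootBit (a j : ℕ) : ℕ :=
  bif Nat.beq (a % 2 + a / 10 % 2) 0 then
    [a / 1000, a / 100, a / 10 % 10 / 2, a % 10 / 2].getD j 0 % 2
  else [0, 0, a / 10, a].getD j 0 % 2

/-- The pairing modulo `2` of the positive root with decimal code `a` with the `j`-th simple
coroot. -/
def weightBit (a j : ℕ) : ℕ := [a / 100, a / 1000 + a / 10, a, a / 10].getD j 0 % 2

/-- The terms of degree `1` in `exp(t ad e_α)` applied to a basis vector, modulo `2`. Basis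
vectors are given by numbers: the code for a root vector, and `0, 1, 2, 3` for the toral part. -/
def colOne (a p : ℕ) : List ℕ :=
  bif Nat.ble 4 p then
    bif Nat.beq (p + a) 5555 then [0, 1, 2, 3].filter fun j => Nat.beq (corootBit a j) 1
    else bif isRoot (p + a) then (bif isRoot (p - a) then [] else [p + a]) else []
  else bif Nat.beq (weightBit a p) 1 then [5555 + a] else []

/-- The terms of degree `2` in `exp(t ad e_α)` applied to a basis vector, modulo `2`. -/
def colTwo (a p : ℕ) : List ℕ :=
  bif Nat.ble 4 p then (bif isRoot (p + 2 * a) then [p + 2 * a] else []) else []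

/-- The basis vector denoted by a number. -/
def basisOf (p : ℕ) : Idx :=
  if p < 4 then .inr (Fin.ofNat 4 p) else
  if 5555 < p then .inl (true, Fin.ofNat 24 (posCode.idxOf (p - 5555))) else
    .inl (false, Fin.ofNat 24 (posCode.idxOf (5555 - p)))

/-- The decimal code of `posRoot i`. -/
def pc (i : Fin 24) : ℕ := posCode.getD i 0

/-- The code of a root. -/
def rc (β : Root) : ℕ := if β.1 then 5555 + pc β.2 else 5555 - pc β.2

/-- The decimal value of a root vector. -/
def lin (v : Fin 4 → ℤ) : ℤ := 1000 * v 0 + 100 * v 1 + 10 * v 2 + v 3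

/-- The number denoting a basis vector. -/
def num : Idx → ℕ
  | .inl β => rc β
  | .inr j => j

theorem basisOf_num (q : Idx) : basisOf (num q) = q := by
  revert q; decide +kernel

theorem lin_vec (β : Root) : lin β.vec = (rc β : ℤ) - 5555 := by
  revert β; decide +kernel

theorem lin_posRoot (i : Fin 24) : lin (posRoot i) = pc i := by
  revert i; decide +kernel

theorem isRoot_rc (β : Root) : isRoot (rc β) = true := by
  revert β; decide +kernel

theorem rc_of_vec {γ β : Root} {i : Fin 24} {k : ℕ} (h : γ.vec = β.vec + k • posRoot i) :
    rc γ = rc β + k * pc i := by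
  have h1 := lin_vec γ
  have h2 := lin_vec β
  have h3 := lin_posRoot i
  have : lin γ.vec = lin β.vec + k * lin (posRoot i) := by
    rw [h]; simp [lin]; ring
  zify; rw [h1, h2, h3] at this; linarith

theorem rc_of_vec_sub {γ β : Root} {i : Fin 24} {k : ℕ} (h : γ.vec = β.vec - k • posRoot i) :
    isRoot (rc β - k * pc i) = true := by
  have : rc β = rc γ + k * pc i := rc_of_vec (by rw [h]; abel)
  rw [this, Nat.add_sub_cancel]; exact isRoot_rc γ

/-- Addition of roots is addition of codes: if the code of `β + (k + 1) α_i` is the code of a root,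
then that sum is a root. -/
theorem vec_of_isRoot : ∀ (β : Root) (i : Fin 24) (k : Fin 2),
    isRoot (rc β + (k + 1 : ℕ) * pc i) = true →
    ∃ γ ∈ (basisOf (rc β + (k + 1 : ℕ) * pc i)).getLeft?,
      γ.vec = β.vec + (k + 1 : ℕ) • posRoot i := by
  decide +kernel

/-! ### The divided powers of `ad e_α` modulo `2` -/

theorem vec_eq_iff {γ β : Root} {i : Fin 24} {k : ℕ} (hk : k = 1 ∨ k = 2) :
    γ.vec = β.vec + k • posRoot i ↔
      isRoot (rc β + k * pc i) = true ∧ basisOf (rc β + k * pc i) = .inl γ := by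
  constructor
  · intro h
    rw [← rc_of_vec h]
    exact ⟨isRoot_rc γ, basisOf_num (.inl γ)⟩
  · rintro ⟨h1, h2⟩
    have : ∃ k' : Fin 2, k = (k' + 1 : ℕ) := by
      rcases hk with rfl | rfl
      exacts [⟨0, rfl⟩, ⟨1, rfl⟩]
    obtain ⟨k', rfl⟩ := this
    obtain ⟨γ', hγ', h⟩ := vec_of_isRoot β i k' h1
    rw [h2] at hγ'
    simp at hγ'
    rw [hγ', h]

theorem vec_of_isRoot_sub : ∀ (β : Root) (i : Fin 24), isRoot (rc β - pc i) = true →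
    ∃ γ ∈ (basisOf (rc β - pc i)).getLeft?, γ.vec = β.vec - 1 • posRoot i := by
  decide +kernel

/-- Root strings in `F₄` have at most three members, so `β - 2α` is not a root when `β + α` is
one. -/
theorem not_isRoot_sub_of_isRoot_add : ∀ (β : Root) (i : Fin 24),
    isRoot (rc β + pc i) = true →
      isRoot (rc β - 2 * pc i) = false ∧ isRoot (rc β - 3 * pc i) = false := by
  decide +kernel

theorem not_isRoot_sub_of_isRoot_add_two : ∀ (β : Root) (i : Fin 24),
    isRoot (rc β + 2 * pc i) = true → isRoot (rc β - 1 * pc i) = false ∧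
      isRoot (rc β - 2 * pc i) = false ∧ isRoot (rc β - 3 * pc i) = false := by
  decide +kernel

/-- The entry `r + 1` of `ad e_α` at `e_{β + α}` is odd precisely when `β - α` is not a root. -/
theorem stringLength_of_isRoot_add (β : Root) (i : Fin 24) (h : isRoot (rc β + pc i) = true) :
    stringLength (posRoot i) β.vec = if isRoot (rc β - pc i) = true then 1 else 0 := by
  obtain ⟨h2, h3⟩ := not_isRoot_sub_of_isRoot_add β i h
  have key : ∀ r : ℕ, (∃ γ : Root, γ.vec = β.vec - r • posRoot i) →
      isRoot (rc β - r * pc i) = true := fun r ⟨γ, hγ⟩ => rc_of_vec_sub hγ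
  have e2 : ¬ ∃ γ : Root, γ.vec = β.vec - 2 • posRoot i := fun hh => by simp [key 2 hh] at h2
  have e3 : ¬ ∃ γ : Root, γ.vec = β.vec - 3 • posRoot i := fun hh => by simp [key 3 hh] at h3
  have e1 : (∃ γ : Root, γ.vec = β.vec - 1 • posRoot i) ↔ isRoot (rc β - pc i) = true := by
    constructor
    · intro hh; simpa using key 1 hh
    · intro hh
      obtain ⟨γ, -, hγ⟩ := vec_of_isRoot_sub β i hh
      exact ⟨γ, hγ⟩
  unfold stringLength
  simp only [Nat.findGreatest, Nat.reduceAdd, e2, e3, e1, if_false]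

theorem stringLength_of_isRoot_add_two (β : Root) (i : Fin 24)
    (h : isRoot (rc β + 2 * pc i) = true) : stringLength (posRoot i) β.vec = 0 := by
  obtain ⟨h1, h2, h3⟩ := not_isRoot_sub_of_isRoot_add_two β i h
  have key : ∀ r : ℕ, (∃ γ : Root, γ.vec = β.vec - r • posRoot i) →
      isRoot (rc β - r * pc i) = true := fun r ⟨γ, hγ⟩ => rc_of_vec_sub hγ
  rw [one_mul] at h1
  have e1 : ¬ ∃ γ : Root, γ.vec = β.vec - 1 • posRoot i := fun hh => by
    simp [by simpa using key 1 hh] at h1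
  have e2 : ¬ ∃ γ : Root, γ.vec = β.vec - 2 • posRoot i := fun hh => by simp [key 2 hh] at h2
  have e3 : ¬ ∃ γ : Root, γ.vec = β.vec - 3 • posRoot i := fun hh => by simp [key 3 hh] at h3
  unfold stringLength
  simp only [Nat.findGreatest, Nat.reduceAdd, e1, e2, e3, if_false]

/-- The column of `ad e_α` at `e_{-α}`, modulo `2`: the toral part. -/
theorem corootBit_eq : ∀ (i : Fin 24) (j : Fin 4),
    ((corootCoeff (posRoot i) j : ℤ) : ZMod 2) =
      ((colOne (pc i) (5555 - pc i)).map fun y => if basisOf y = .inr j then 1 else 0).sum := by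
  decide +kernel

/-- The column of `ad e_α` at `e_{-α}` has no component along root vectors. -/
theorem colOne_neg_inl : ∀ (i γ : Fin 24) (s : Bool),
    ((colOne (pc i) (5555 - pc i)).map fun y =>
      if basisOf y = .inl (s, γ) then (1 : ZMod 2) else 0).sum = 0 := by
  decide +kernel

theorem weightBit_eq : ∀ (i : Fin 24) (j : Fin 4),
    ((pairing (posRoot i) j : ℤ) : ZMod 2) =
      ((colOne (pc i) j).map fun y => if basisOf y = .inl (true, i) then 1 else 0).sum := by
  decide +kernel

theorem colOne_inr : ∀ (i : Fin 24) (j : Fin 4),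
    colOne (pc i) j = [] ∨
      colOne (pc i) j = [5555 + pc i] ∧ basisOf (5555 + pc i) = .inl (true, i) := by
  decide +kernel

theorem rc_add_ne : ∀ (β : Root) (i : Fin 24), β ≠ (false, i) → rc β + pc i ≠ 5555 := by
  decide +kernel

theorem not_isRoot_toral : isRoot 5555 = false := by decide +kernel

theorem le_rc (β : Root) : 4 ≤ rc β := by revert β; decide +kernel

theorem isRoot_add_basisOf : ∀ (β : Root) (i : Fin 24), isRoot (rc β + pc i) = true →
    (basisOf (rc β + pc i)).isLeft = true := by
  decide +kernel

theorem isRoot_add_two_basisOf : ∀ (β : Root) (i : Fin 24), isRoot (rc β + 2 * pc i) = true →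
    (basisOf (rc β + 2 * pc i)).isLeft = true := by
  decide +kernel

/-- The list `colOne` holds the numbers of the basis vectors with odd coefficient in a column of
`ad e_α`. -/
theorem divPow_one (i : Fin 24) (q r : Idx) :
    ((divPow i 1 q r : ℤ) : ZMod 2) =
      ((colOne (pc i) (num r)).map fun y => if basisOf y = q then 1 else 0).sum := by
  rcases r with β | j
  · by_cases hβ : β = (false, i)
    · subst hβ
      rcases q with ⟨s, γ⟩ | l
      · have hd : divPow i 1 (.inl (s, γ)) (.inl (false, i)) = 0 := by
          simp only [divPow]
          rw [if_neg]
          rw [vec_eq_iff (Or.inl rfl)]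
          rintro ⟨h, -⟩
          have : rc (false, i) + 1 * pc i = 5555 := by revert i; decide +kernel
          rw [this, not_isRoot_toral] at h
          exact absurd h (by simp)
        rw [hd]
        have := colOne_neg_inl i γ s
        simp only [num, rc, Bool.false_eq_true, if_false] at this ⊢
        exact this.symm ▸ by simp
      · simpa [divPow, num, rc] using corootBit_eq i l
    · have hne := rc_add_ne β i hβ
      have hle := le_rc β
      have hcol : colOne (pc i) (num (.inl β)) = bif isRoot (rc β + pc i) then
          (bif isRoot (rc β - pc i) then [] else [rc β + pc i]) else [] := by
        have h1 : Nat.ble 4 (rc β) = true := Nat.ble_eq_true_of_le hle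
        have h2 : Nat.beq (rc β + pc i) 5555 = false := by
          rw [Bool.eq_false_iff, Ne, Nat.beq_eq]; exact hne
        simp [colOne, num, h1, h2]
      rw [hcol]
      have hv : ∀ γ : Root, γ.vec = β.vec + 1 • posRoot i ↔ _ := fun γ =>
        vec_eq_iff (γ := γ) (β := β) (i := i) (k := 1) (Or.inl rfl)
      simp only [one_mul] at hv
      rcases q with γ | l
      · simp only [divPow, hv]
        cases hr : isRoot (rc β + pc i)
        · simp
        · rw [stringLength_of_isRoot_add β i hr]
          cases hs : isRoot (rc β - pc i)
          · simp [apply_ite]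
          · simp only [if_true, true_and, cond_true, List.map_nil, List.sum_nil]
            split_ifs
            · decide
            · simp
      · simp only [divPow, hβ, and_false, if_false]
        cases hr : isRoot (rc β + pc i)
        · simp
        · have := isRoot_add_basisOf β i hr
          cases hs : isRoot (rc β - pc i)
          · have h3 : basisOf (rc β + pc i) ≠ .inr l := by
              intro h; rw [h] at this; simp at this
            simp [h3]
          · simp
  · rcases q with γ | l
    · by_cases hγ : γ = (true, i)
      · subst hγ
        simpa [divPow, num] using weightBit_eq i j
      · rcases colOne_inr i j with h | ⟨h, h'⟩
        · simp [divPow, num, h, hγ]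
        · simp [divPow, num, h, h', hγ, Ne.symm hγ]
    · rcases colOne_inr i j with h | ⟨h, h'⟩
      · simp [divPow, num, h]
      · simp [divPow, num, h, h']

/-- The list `colTwo` holds the numbers of the basis vectors with odd coefficient in a column of
`(ad e_α)² / 2`. -/
theorem divPow_two (i : Fin 24) (q r : Idx) :
    ((divPow i 2 q r : ℤ) : ZMod 2) =
      ((colTwo (pc i) (num r)).map fun y => if basisOf y = q then 1 else 0).sum := by
  rcases r with β | j
  · have hle := le_rc β
    have hcol : colTwo (pc i) (num (.inl β)) = bif isRoot (rc β + 2 * pc i) then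
          [rc β + 2 * pc i] else [] := by
      have h1 : Nat.ble 4 (rc β) = true := Nat.ble_eq_true_of_le hle
      simp [colTwo, num, h1]
    rw [hcol]
    rcases q with γ | l
    · simp only [divPow, vec_eq_iff (γ := γ) (β := β) (i := i) (k := 2) (Or.inr rfl)]
      cases hr : isRoot (rc β + 2 * pc i)
      · simp
      · rw [stringLength_of_isRoot_add_two β i hr]
        simp [apply_ite]
    · cases hr : isRoot (rc β + 2 * pc i)
      · simp [divPow]
      · have := isRoot_add_two_basisOf β i hr
        have h3 : basisOf (rc β + 2 * pc i) ≠ .inr l := by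
          intro h; rw [h] at this; simp at this
        simp [divPow, h3]
  · have : colTwo (pc i) (num (.inr j)) = [] := by
      have h1 : Nat.ble 4 j = false := by
        rw [Bool.eq_false_iff, Ne, Nat.ble_eq]; omega
      simp [colTwo, num, h1]
    rw [this]
    rcases q with γ | l <;> simp [divPow]

/-- A congruence modulo `2` gives an equality in every field of characteristic `2`. -/
theorem intCast_eq_listSum {K : Type*} [Field K] [CharP K 2] {n : ℤ} {l : List ℕ} {q : Idx}
    (h : (n : ZMod 2) = (l.map fun y => if basisOf y = q then 1 else 0).sum) :
    (n : K) = (l.map fun y => if basisOf y = q then 1 else 0).sum := by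
  have h1 : ((n : ZMod 2).cast : K) = (n : K) := ZMod.cast_intCast (dvd_refl 2) n
  have h2 := congrArg (ZMod.castHom (dvd_refl 2) K) h
  rw [map_list_sum, List.map_map] at h2
  rw [← h1]
  simp only [ZMod.castHom_apply] at h2
  rw [h2]
  congr 1
  refine List.map_congr_left fun y _ => ?_
  simp only [Function.comp]
  split_ifs <;> simp

/-- The column of `exp(t ad e_{α_i})` at a basis vector. -/
theorem rootMatrix_mulVec {K : Type*} [Field K] [CharP K 2] (i : Fin 24) (t : K) (r : Idx) :
    (rootMatrix i t).mulVec (Pi.single r 1) = Pi.single r 1 +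
      ((colOne (pc i) (num r)).map fun y => t • (Pi.single (basisOf y) 1 : Idx → K)).sum +
      ((colTwo (pc i) (num r)).map fun y => t ^ 2 • (Pi.single (basisOf y) 1 : Idx → K)).sum := by
  have hsum : ∀ (l : List ℕ) (c : K) (q : Idx),
      (l.map fun y => c • (Pi.single (basisOf y) 1 : Idx → K)).sum q =
        c * (l.map fun y => if basisOf y = q then 1 else 0).sum := by
    intro l c q
    induction l with
    | nil => simp
    | cons a l ih =>
      simp only [List.map_cons, List.sum_cons, Pi.add_apply, ih, mul_add, Pi.smul_apply,
        smul_eq_mul, Pi.single_apply, eq_comm]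
  ext q
  rw [Matrix.mulVec_single_one]
  simp only [Matrix.col_apply, rootMatrix, Finset.sum_range_succ, Finset.range_zero,
    Finset.sum_empty, zero_add, Matrix.add_apply, Matrix.smul_apply, Matrix.map_apply,
    smul_eq_mul, pow_zero, one_mul, pow_one, Pi.add_apply, hsum,
    intCast_eq_listSum (K := K) (divPow_one i q r), intCast_eq_listSum (K := K) (divPow_two i q r),
    divPow_zero]
  congr 2
  by_cases h : q = r <;> simp [Matrix.one_apply, h]

/-! ### Symbolic computation with root elements -/

/-- A list of triples `(m, n, p)` stands for the vector `∑ s ^ m t ^ n e_p`. -/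
def ev {K : Type*} [Field K] (s t : K) (L : List (ℕ × ℕ × ℕ)) : Idx → K :=
  (L.map fun x => (s ^ x.1 * t ^ x.2.1) • (Pi.single (basisOf x.2.2) 1 : Idx → K)).sum

/-- The root element of the root with decimal code `a`, with parameter `s ^ m t ^ n`, applied to a
formal vector. -/
def act (a m n : ℕ) : List (ℕ × ℕ × ℕ) → List (ℕ × ℕ × ℕ)
  | [] => []
  | x :: l => x :: ((colOne a x.2.2).map (fun y => (x.1 + m, x.2.1 + n, y)) ++
      ((colTwo a x.2.2).map (fun y => (x.1 + 2 * m, x.2.1 + 2 * n, y)) ++ act a m n l))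

/-- A word of triples `(a, m, n)`, standing for the product of the root elements with parameters
`s ^ m t ^ n`, applied to a formal vector. -/
def actWord : List (ℕ × ℕ × ℕ) → List (ℕ × ℕ × ℕ) → List (ℕ × ℕ × ℕ)
  | [], L => L
  | x :: w, L => act x.1 x.2.1 x.2.2 (actWord w L)

/-- Adds a term to a formal vector modulo `2`. -/
def toggle (x : ℕ × ℕ × ℕ) : List (ℕ × ℕ × ℕ) → List (ℕ × ℕ × ℕ)
  | [] => [x]
  | y :: l => bif Nat.beq x.2.2 y.2.2 && (Nat.beq x.1 y.1 && Nat.beq x.2.1 y.2.1) then l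
      else y :: toggle x l

/-- Reduces a formal vector modulo `2`. -/
def toggleAll : List (ℕ × ℕ × ℕ) → List (ℕ × ℕ × ℕ) → List (ℕ × ℕ × ℕ)
  | [], l => l
  | x :: l', l => toggleAll l' (toggle x l)

/-- The numbers of the basis vectors. -/
def nums : List ℕ := [0, 1, 2, 3] ++ posCode.map (5555 + ·) ++ posCode.map (5555 - ·)

/-- The index of the positive root with a given decimal code. -/
def rootIdx (a : ℕ) : Fin 24 := Fin.ofNat 24 (posCode.idxOf a)

/-- The product of the root elements in a word. -/
def wordMatrix {K : Type*} [Field K] (s t : K) (w : List (ℕ × ℕ × ℕ)) : Matrix Idx Idx K :=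
  (w.map fun x => rootMatrix (rootIdx x.1) (s ^ x.2.1 * t ^ x.2.2)).prod

theorem num_basisOf : ∀ p ∈ nums, num (basisOf p) = p := by decide +kernel

theorem num_mem (q : Idx) : num q ∈ nums := by revert q; decide +kernel

theorem pc_rootIdx : ∀ a ∈ posCode, pc (rootIdx a) = a := by decide +kernel

theorem rootIdx_pc (i : Fin 24) : rootIdx (pc i) = i := by revert i; decide +kernel

theorem pc_mem (i : Fin 24) : pc i ∈ posCode := by revert i; decide +kernel

theorem col_subset : ∀ a ∈ posCode, ∀ p ∈ nums, (colOne a p ++ colTwo a p) ⊆ nums := by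
  decide +kernel

section ev

variable {K : Type*} [Field K] (s t : K)

theorem ev_cons (x : ℕ × ℕ × ℕ) (L : List (ℕ × ℕ × ℕ)) :
    ev s t (x :: L) = (s ^ x.1 * t ^ x.2.1) • (Pi.single (basisOf x.2.2) 1 : Idx → K) +
      ev s t L := by
  simp [ev]

theorem ev_append (L L' : List (ℕ × ℕ × ℕ)) : ev s t (L ++ L') = ev s t L + ev s t L' := by
  simp [ev]

theorem ev_toggle [CharP K 2] (x : ℕ × ℕ × ℕ) (L : List (ℕ × ℕ × ℕ)) :
    ev s t (toggle x L) = ev s t (x :: L) := by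
  induction L with
  | nil => rfl
  | cons y l ih =>
    unfold toggle
    cases h : Nat.beq x.2.2 y.2.2 && (Nat.beq x.1 y.1 && Nat.beq x.2.1 y.2.1)
    · rw [cond_false, ev_cons, ih, ev_cons, ev_cons s t x (y :: l), ev_cons]
      abel
    · have hxy : x = y := by
        simp only [Bool.and_eq_true, Nat.beq_eq] at h
        exact Prod.ext h.2.1 (Prod.ext h.2.2 h.1)
      subst hxy
      rw [cond_true, ev_cons, ev_cons, ← add_assoc, CharTwo.add_self_eq_zero, zero_add]

theorem ev_toggleAll [CharP K 2] (L L' : List (ℕ × ℕ × ℕ)) :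
    ev s t (toggleAll L L') = ev s t L + ev s t L' := by
  induction L generalizing L' with
  | nil => simp [toggleAll, ev]
  | cons x l ih => rw [toggleAll, ih, ev_toggle, ev_cons, ev_cons]; abel

/-- Two formal vectors have the same value if all terms of their concatenation cancel in pairs. -/
theorem ev_eq_of_toggleAll [CharP K 2] {L L' : List (ℕ × ℕ × ℕ)}
    (h : (toggleAll (L ++ L') []).isEmpty = true) : ev s t L = ev s t L' := by
  have h1 := ev_toggleAll s t (L ++ L') []
  rw [List.isEmpty_iff.1 h, ev_append] at h1
  have h2 : ev s t L + ev s t L' = 0 := by simpa [ev] using h1.symm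
  exact CharTwo.add_eq_zero.1 h2

theorem ev_act [CharP K 2] {a : ℕ} (ha : a ∈ posCode) (m n : ℕ) {L : List (ℕ × ℕ × ℕ)}
    (hL : ∀ x ∈ L, x.2.2 ∈ nums) :
    ev s t (act a m n L) = (rootMatrix (rootIdx a) (s ^ m * t ^ n)).mulVec (ev s t L) ∧
      ∀ x ∈ act a m n L, x.2.2 ∈ nums := by
  induction L with
  | nil => simp [act, ev]
  | cons x l ih =>
    obtain ⟨ih1, ih2⟩ := ih fun y hy => hL y (List.mem_cons_of_mem _ hy)
    have hx := hL x List.mem_cons_self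
    have hsub := col_subset a ha _ hx
    constructor
    · rw [act, ev_cons, ev_append, ev_append, ih1, ev_cons, Matrix.mulVec_add,
        Matrix.mulVec_smul, rootMatrix_mulVec, num_basisOf _ hx, pc_rootIdx a ha, smul_add,
        smul_add, List.smul_sum, List.smul_sum, ← add_assoc, ← add_assoc]
      congr 2
      · congr 1
        simp only [ev, List.map_map]
        congr 1
        refine List.map_congr_left fun y _ => ?_
        simp only [Function.comp, smul_smul, pow_add]
        congr 1; ring
      · simp only [ev, List.map_map]
        congr 1
        refine List.map_congr_left fun y _ => ?_
        simp only [Function.comp, smul_smul, pow_add, pow_mul]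
        congr 1; ring
    · intro z hz
      simp only [act, List.mem_cons, List.mem_append, List.mem_map] at hz
      rcases hz with rfl | ⟨y, hy, rfl⟩ | ⟨y, hy, rfl⟩ | hz
      · exact hx
      · exact hsub (List.mem_append_left _ hy)
      · exact hsub (List.mem_append_right _ hy)
      · exact ih2 z hz

theorem ev_actWord [CharP K 2] {w : List (ℕ × ℕ × ℕ)} (hw : ∀ x ∈ w, x.1 ∈ posCode)
    {L : List (ℕ × ℕ × ℕ)} (hL : ∀ x ∈ L, x.2.2 ∈ nums) :
    ev s t (actWord w L) = (wordMatrix s t w).mulVec (ev s t L) ∧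
      ∀ x ∈ actWord w L, x.2.2 ∈ nums := by
  induction w with
  | nil => simpa [actWord, wordMatrix] using hL
  | cons x w ih =>
    obtain ⟨ih1, ih2⟩ := ih fun y hy => hw y (List.mem_cons_of_mem _ hy)
    obtain ⟨h1, h2⟩ := ev_act s t (hw x List.mem_cons_self) x.2.1 x.2.2 ih2
    refine ⟨?_, h2⟩
    rw [actWord, h1, ih1, Matrix.mulVec_mulVec]
    simp [wordMatrix]

/-- An identity between words follows from the equality, modulo `2`, of the formal columns. -/
theorem wordMatrix_eq [CharP K 2] {w w' : List (ℕ × ℕ × ℕ)} (hw : ∀ x ∈ w, x.1 ∈ posCode)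
    (hw' : ∀ x ∈ w', x.1 ∈ posCode)
    (h : ∀ r ∈ nums,
      (toggleAll (actWord w [(0, 0, r)] ++ actWord w' [(0, 0, r)]) []).isEmpty = true) :
    wordMatrix s t w = wordMatrix s t w' := by
  refine Matrix.ext_of_mulVec_single fun q => ?_
  have hn := num_mem q
  have hL : ∀ x ∈ [((0 : ℕ), (0 : ℕ), num q)], x.2.2 ∈ nums := by simpa using hn
  have he : ev s t [(0, 0, num q)] = Pi.single q 1 := by simp [ev, basisOf_num]
  rw [← he, ← (ev_actWord s t hw hL).1, ← (ev_actWord s t hw' hL).1]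
  exact ev_eq_of_toggleAll s t (h _ hn)

end ev

/-- The factors of the commutator of the root elements of two positive roots `a`, `b` with
parameters `s`, `t`: the triple `(c, m, n)` stands for the root element of `c` with parameter
`s ^ m t ^ n`. -/
def commCode (a b : ℕ) : List (ℕ × ℕ × ℕ) :=
  (bif isRoot (5555 + a + b) && !isRoot (5555 + a - b) then [(a + b, 1, 1)] else []) ++
  (bif isRoot (5555 + a + 2 * b) then [(a + 2 * b, 1, 2)] else []) ++
  (bif isRoot (5555 + 2 * a + b) then [(2 * a + b, 2, 1)] else [])

theorem commCode_mem : ∀ a ∈ posCode, ∀ b ∈ posCode, ∀ x ∈ commCode a b, x.1 ∈ posCode := by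
  decide +kernel

/-- Whether the commutator formula for `a`, `b` holds on all basis vectors. -/
def checkComm (a b : ℕ) : Bool :=
  nums.all fun r => (toggleAll (actWord [(a, 1, 0), (b, 0, 1)] [(0, 0, r)] ++
    actWord ((b, 0, 1) :: (a, 1, 0) :: commCode a b) [(0, 0, r)]) []).isEmpty

/-- The commutator formula, checked on all basis vectors for all pairs of positive roots, with the
parameters as formal variables. -/
theorem checkComm_lt : ∀ j < 24, ∀ i < j,
    checkComm (posCode.getD i 0) (posCode.getD j 0) = true := by
  decide +kernel

/-- Whether the additivity of the root element of `a` holds on all basis vectors. -/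
def checkAdd (a : ℕ) : Bool :=
  nums.all fun r => (toggleAll (actWord [(a, 1, 0), (a, 0, 1)] [(0, 0, r)] ++
    ((0, 0, r) :: ((colOne a r).flatMap (fun y => [(1, 0, y), (0, 1, y)]) ++
      (colTwo a r).flatMap (fun y => [(2, 0, y), (0, 2, y)])))) []).isEmpty

theorem checkAdd_all : ∀ a ∈ posCode, checkAdd a = true := by
  decide +kernel

/-- The root elements of a root form a one-parameter group. -/
theorem rootMatrix_add {K : Type*} [Field K] [CharP K 2] (i : Fin 24) (s t : K) :
    rootMatrix i s * rootMatrix i t = rootMatrix i (s + t) := by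
  refine Matrix.ext_of_mulVec_single fun q => ?_
  have hn := num_mem q
  have ha := pc_mem i
  have hL : ∀ x ∈ [((0 : ℕ), (0 : ℕ), num q)], x.2.2 ∈ nums := by simpa using hn
  have he : ev s t [(0, 0, num q)] = Pi.single q 1 := by simp [ev, basisOf_num]
  have h1 := (ev_actWord s t (w := [(pc i, 1, 0), (pc i, 0, 1)]) (by simpa using ha) hL).1
  have h2 := checkAdd_all _ ha
  unfold checkAdd at h2
  rw [List.all_eq_true] at h2
  rw [ev_eq_of_toggleAll s t (h2 _ hn), he] at h1
  have h3 : wordMatrix s t [(pc i, 1, 0), (pc i, 0, 1)] = rootMatrix i s * rootMatrix i t := by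
    simp [wordMatrix, rootIdx_pc]
  rw [← h3, ← h1, rootMatrix_mulVec, ev_cons, ev_append, add_assoc]
  congr 1
  · simp [basisOf_num]
  congr 1
  · induction colOne (pc i) (num q) with
    | nil => simp [ev]
    | cons y l ih =>
      rw [List.flatMap_cons, ev_append, ih]
      simp [ev, add_smul]
  · induction colTwo (pc i) (num q) with
    | nil => simp [ev]
    | cons y l ih =>
      rw [List.flatMap_cons, ev_append, ih]
      simp [ev, CharTwo.add_sq, add_smul]

/-- The commutator formula for root matrices. -/
theorem rootMatrix_mul_of_lt {K : Type*} [Field K] [CharP K 2] {i j : Fin 24} (hij : i < j)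
    (s t : K) : rootMatrix i s * rootMatrix j t = rootMatrix j t * (rootMatrix i s *
      wordMatrix s t (commCode (pc i) (pc j))) := by
  have h := checkComm_lt j j.2 i hij
  unfold checkComm at h
  rw [List.all_eq_true] at h
  have := wordMatrix_eq s t (w := [(pc i, 1, 0), (pc j, 0, 1)])
    (w' := (pc j, 0, 1) :: (pc i, 1, 0) :: commCode (pc i) (pc j)) ?_ ?_ h
  · simpa [wordMatrix, rootIdx_pc] using this
  · simp [pc_mem]
  · intro x hx
    simp only [List.mem_cons] at hx
    rcases hx with rfl | rfl | hx
    · exact pc_mem j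
    · exact pc_mem i
    · exact commCode_mem _ (pc_mem i) _ (pc_mem j) x hx

/-! ### Relations between root elements -/

section relations

variable {K : Type*} [Field K] [CharP K 2]

theorem U_ext {g h : U K}
    (H : ((g : GL Idx K) : Matrix Idx Idx K) = ((h : GL Idx K) : Matrix Idx Idx K)) : g = h :=
  Subtype.ext (Units.ext H)

theorem x_mul_x (i : Fin 24) (s t : K) : x i s * x i t = x i (s + t) :=
  U_ext (rootMatrix_add i s t)

theorem x_zero (i : Fin 24) : x i (0 : K) = 1 := by
  have := x_mul_x i (0 : K) 0
  rwa [add_zero, mul_eq_left] at this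

theorem x_inv (i : Fin 24) (t : K) : (x i t)⁻¹ = x i t := by
  rw [inv_eq_iff_mul_eq_one, x_mul_x, CharTwo.add_self_eq_zero, x_zero]

/-- The factors of the commutator of `x_i(s)` and `x_j(t)`. -/
def commList (i j : Fin 24) : List (Fin 24 × ℕ × ℕ) :=
  (commCode (pc i) (pc j)).map fun y => (rootIdx y.1, y.2)

/-- The commutator formula. -/
theorem x_mul_of_lt {i j : Fin 24} (hij : i < j) (s t : K) :
    x i s * x j t =
      x j t * (x i s * ((commList i j).map fun y => x y.1 (s ^ y.2.1 * t ^ y.2.2)).prod) := by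
  apply U_ext
  have h := rootMatrix_mul_of_lt hij s t
  have hprod : ∀ l : List (ℕ × ℕ × ℕ),
      (((((l.map fun y => ((rootIdx y.1, y.2) : Fin 24 × ℕ × ℕ)).map
        fun y => x y.1 (s ^ y.2.1 * t ^ y.2.2)).prod : U K) : GL Idx K) : Matrix Idx Idx K) =
      wordMatrix s t l := by
    intro l
    induction l with
    | nil => rfl
    | cons y l ih =>
      rw [List.map_cons, List.map_cons, List.prod_cons, wordMatrix, List.map_cons, List.prod_cons]
      rw [wordMatrix] at ih
      rw [← ih]
      rfl
  have h2 := hprod (commCode (pc i) (pc j))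
  change rootMatrix i s * rootMatrix j t = rootMatrix j t * (rootMatrix i s * _)
  rw [h, ← h2]
  rfl

/-- The roots that occur in the commutators of the root subgroups of two roots. -/
def commRoots (i j : Fin 24) : List (Fin 24) :=
  if i < j then (commList i j).map Prod.fst else if j < i then (commList j i).map Prod.fst else []

/-- A subgroup contains the conjugates of `X_j` by `X_i` if it contains `X_j` and the root subgroups
that occur in the commutator formula for `i` and `j`. -/
theorem conj_x_mem {i j : Fin 24} {H : Subgroup (U K)} (hj : ∀ t : K, x j t ∈ H)
    (h : ∀ k ∈ commRoots i j, ∀ t : K, x k t ∈ H) (s t : K) :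
    x i s * x j t * (x i s)⁻¹ ∈ H := by
  have hw : ∀ (l : List (Fin 24 × ℕ × ℕ)) (u v : K), (∀ k ∈ l.map Prod.fst, ∀ t : K, x k t ∈ H) →
      (l.map fun y => x y.1 (u ^ y.2.1 * v ^ y.2.2)).prod ∈ H := by
    intro l u v hl
    refine Subgroup.list_prod_mem _ fun z hz => ?_
    obtain ⟨y, hy, rfl⟩ := List.mem_map.1 hz
    exact hl _ (List.mem_map_of_mem hy) _
  rcases lt_trichotomy i j with hij | hij | hij
  · rw [commRoots, if_pos hij] at h
    have h1 := x_mul_of_lt hij s t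
    have h2 : x i s * x j t * (x i s)⁻¹ =
        x j t * ((commList i j).map fun y => x y.1 (s ^ y.2.1 * t ^ y.2.2)).prod⁻¹ := by
      set w := ((commList i j).map fun y => x y.1 (s ^ y.2.1 * t ^ y.2.2)).prod
      have h3 : w = (x i s)⁻¹ * (x j t)⁻¹ * (x i s * x j t) := by rw [h1]; group
      rw [h3, x_inv, x_inv]
      simp only [mul_inv_rev, x_inv]
      rw [← mul_assoc, ← mul_assoc, ← mul_assoc, x_mul_x, CharTwo.add_self_eq_zero, x_zero,
        one_mul]
    rw [h2]
    exact mul_mem (hj t) (inv_mem (hw _ _ _ h))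
  · subst hij
    rw [x_inv, x_mul_x, x_mul_x]
    exact hj _
  · rw [commRoots, if_neg hij.not_gt, if_pos hij] at h
    have h1 := x_mul_of_lt hij t s
    have h2 : x i s * x j t * (x i s)⁻¹ =
        x j t * ((commList j i).map fun y => x y.1 (t ^ y.2.1 * s ^ y.2.2)).prod := by
      rw [x_inv, mul_assoc, h1, ← mul_assoc, x_mul_x, CharTwo.add_self_eq_zero, x_zero, one_mul]
    rw [h2]
    exact mul_mem (hj t) (hw _ _ _ h)

/-- If `Q` absorbs the commutators of its roots with the roots in `P`, then `X_P` normalizes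
`X_Q`. -/
theorem X_conj_mem {P Q : Finset (Fin 24)}
    (h : ∀ i ∈ P, ∀ j ∈ Q, ∀ k ∈ commRoots i j, k ∈ Q) {g n : U K} (hg : g ∈ X K P)
    (hn : n ∈ X K Q) : g * n * g⁻¹ ∈ X K Q := by
  have hx : ∀ i ∈ P, ∀ (s : K), ∀ n ∈ X K Q, x i s * n * (x i s)⁻¹ ∈ X K Q := by
    intro i hi s n hn
    induction hn using Subgroup.closure_induction with
    | mem n hn =>
      obtain ⟨j, hj, t, rfl⟩ := hn
      exact conj_x_mem (fun t => x_mem hj t) (fun k hk t => x_mem (h i hi j hj k hk) t) s t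
    | one => simp [one_mem]
    | mul a b _ _ ha hb =>
      have : x i s * (a * b) * (x i s)⁻¹ = (x i s * a * (x i s)⁻¹) * (x i s * b * (x i s)⁻¹) := by
        group
      rw [this]; exact mul_mem ha hb
    | inv a _ ha =>
      have : x i s * a⁻¹ * (x i s)⁻¹ = (x i s * a * (x i s)⁻¹)⁻¹ := by group
      rw [this]; exact inv_mem ha
  -- conjugation by an element and by its inverse are treated together, as `x_i(s)⁻¹ = x_i(s)`
  suffices H : ∀ n ∈ X K Q, g * n * g⁻¹ ∈ X K Q ∧ g⁻¹ * n * g ∈ X K Q from (H n hn).1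
  clear hn n
  induction hg using Subgroup.closure_induction with
  | mem g hg =>
    obtain ⟨i, hi, s, rfl⟩ := hg
    intro n hn
    have := hx i hi s n hn
    refine ⟨this, ?_⟩
    rw [x_inv] at this ⊢
    exact this
  | one => simp
  | mul a b _ _ ha hb =>
    intro n hn
    have h1 : a * b * n * (a * b)⁻¹ = a * (b * n * b⁻¹) * a⁻¹ := by group
    have h2 : (a * b)⁻¹ * n * (a * b) = b⁻¹ * (a⁻¹ * n * a) * b := by group
    rw [h1, h2]
    exact ⟨(ha _ (hb n hn).1).1, (hb _ (ha n hn).2).2⟩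
  | inv a _ ha =>
    intro n hn
    rw [inv_inv]
    exact (ha n hn).symm

end relations

/-! ### The action of `X_P` on a section of the adjoint module -/

section action

variable {K : Type*} [Field K]

/-- The vector `e_α` of the positive root with index `i`. -/
def e (i : Fin 24) : Idx → K := Pi.single (.inl (true, i)) 1

/-- The toral vector `h_1`. -/
def h1 : Idx → K := Pi.single (.inr 0) 1

/-- The submodule spanned by the root vectors of `N`. -/
def Nsub (K : Type*) [Field K] : Submodule K (Idx → K) :=
  Submodule.span K {v | ∃ n ∈ coreN, v = e n}

/-- The roots of `Z`. -/
def zr : Fin 6 → Fin 24 := ![α 6, α 8, α 9, α 10, α 12, α 18]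

/-- The vector with given coordinates at the roots of `Z`. -/
def zvec (u : Fin 6 → K) : Idx → K := ∑ l, u l • e (zr l)

/-- The commutators of `x₃(w.1) x₇(w.2)` with `x₂(1)`. -/
def r2 (w : K × K) : Fin 6 → K := ![w.1, 0, w.1 ^ 2, w.2, 0, 0]

/-- The commutators of `x₃(w.1) x₇(w.2)` with `x₅(1)`. -/
def r5 (w : K × K) : Fin 6 → K := ![0, w.1, 0, 0, w.2, w.2 ^ 2]

/-- The commutator of `x₂(v.1) x₅(v.2)` and `x₃(w.1) x₇(w.2)`, in the coordinates
of `X_Z`. -/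
def bracket (v w : K × K) : Fin 6 → K := v.1 • r2 w + v.2 • r5 w

/-- The matrix `M` acts on the section with basis `h₁`, `e₂`, `e₅`, `e_γ` (`γ ∈ Z`) of the adjoint
module as the element `x₂(v.1) x₅(v.2) x₃(w.1) x₇(w.2) ∏ x_γ(u_γ)` does. -/
structure ActsAs (M : Matrix Idx Idx K) (v w : K × K) (u : Fin 6 → K) : Prop where
  on_h1 : M.mulVec h1 ≡ h1 + v.1 • e (α 2) + v.2 • e (α 5) + zvec u [SMOD Nsub K]
  on_e2 : M.mulVec (e (α 2)) ≡ e (α 2) + zvec (r2 w) [SMOD Nsub K]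
  on_e5 : M.mulVec (e (α 5)) ≡ e (α 5) + zvec (r5 w) [SMOD Nsub K]
  on_z : ∀ l, M.mulVec (e (zr l)) ≡ e (zr l) [SMOD Nsub K]
  on_N : ∀ n ∈ coreN, M.mulVec (e n) ≡ 0 [SMOD Nsub K]

theorem smodEq_of_eq {a b : Idx → K} (h : a = b) : a ≡ b [SMOD Nsub K] := h ▸ SModEq.rfl

theorem zvec_add (u u' : Fin 6 → K) : zvec (u + u') = zvec u + zvec u' := by
  simp [zvec, add_smul, Finset.sum_add_distrib]

theorem zvec_smul (c : K) (u : Fin 6 → K) : zvec (c • u) = c • zvec u := by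
  simp [zvec, mul_smul, Finset.smul_sum]

/-- A matrix that acts as a group element does preserves the span of the root vectors of `N`. -/
theorem ActsAs.smodEq {M : Matrix Idx Idx K} {v w : K × K} {u : Fin 6 → K} (h : ActsAs M v w u)
    {a b : Idx → K} (hab : a ≡ b [SMOD Nsub K]) : M.mulVec a ≡ M.mulVec b [SMOD Nsub K] := by
  have h2 := SModEq.map hab M.mulVecLin
  refine SModEq.mono ?_ h2
  rw [Submodule.map_le_iff_le_comap]
  refine Submodule.span_le.2 ?_
  rintro _ ⟨n, hn, rfl⟩
  have := SModEq.zero.1 (h.on_N n hn)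
  simpa using this

theorem ActsAs.on_zvec {M : Matrix Idx Idx K} {v w : K × K} {u : Fin 6 → K} (h : ActsAs M v w u)
    (u' : Fin 6 → K) : M.mulVec (zvec u') ≡ zvec u' [SMOD Nsub K] := by
  rw [zvec, Matrix.mulVec_sum]
  refine SModEq.sum fun l _ => ?_
  rw [Matrix.mulVec_smul]
  exact (h.on_z l).smul _

theorem apply_eq_of_smodEq {a b : Idx → K} (hab : a ≡ b [SMOD Nsub K]) {p : Idx}
    (hp : ∀ n ∈ coreN, (.inl (true, n) : Idx) ≠ p) : a p = b p := by
  rw [SModEq.sub_mem] at hab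
  suffices H : ∀ v ∈ Nsub K, v p = 0 from sub_eq_zero.1 (H _ hab)
  intro v hv
  induction hv using Submodule.span_induction with
  | mem v hv =>
    obtain ⟨n, hn, rfl⟩ := hv
    exact Pi.single_eq_of_ne (hp n hn).symm _
  | zero => rfl
  | add _ _ _ _ ha hb => rw [Pi.add_apply, ha, hb, add_zero]
  | smul c _ _ ha => rw [Pi.smul_apply, ha, smul_zero]

theorem e_apply (i j : Fin 24) : (e i : Idx → K) (.inl (true, j)) = if j = i then 1 else 0 := by
  simp [e, Pi.single_apply]

theorem h1_apply (j : Fin 24) : (h1 : Idx → K) (.inl (true, j)) = 0 := by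
  simp [h1]

/-- The coordinates can be read off from the action: `v` and `u` from the image of `h₁`, and `w`
from the components at `α₆` and `α₁₀` of the image of `e₂`. -/
theorem ActsAs.unique {M : Matrix Idx Idx K} {v w v' w' : K × K} {u u' : Fin 6 → K}
    (h : ActsAs M v w u) (h' : ActsAs M v' w' u') : v = v' ∧ w = w' ∧ u = u' := by
  have e1 := h.on_h1.symm.trans h'.on_h1
  have e2 := h.on_e2.symm.trans h'.on_e2
  have key : ∀ j, j ∉ coreN → ∀ n ∈ coreN, (.inl (true, n) : Idx) ≠ .inl (true, j) := by
    rintro j hj n hn h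
    simp only [Sum.inl.injEq, Prod.mk.injEq, true_and] at h
    exact hj (h ▸ hn)
  have a2 := apply_eq_of_smodEq e1 (key (α 2) (by decide))
  have a5 := apply_eq_of_smodEq e1 (key (α 5) (by decide))
  have b6 := apply_eq_of_smodEq e2 (key (α 6) (by decide))
  have b10 := apply_eq_of_smodEq e2 (key (α 10) (by decide))
  have az : ∀ l, zr l ∉ coreN := by decide
  have az' := fun l => apply_eq_of_smodEq e1 (key (zr l) (az l))
  have hz : ∀ (u : Fin 6 → K) (l : Fin 6), zvec u (.inl (true, zr l)) = u l := by
    intro u l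
    have hinj : Function.Injective zr := by decide
    simp [zvec, e_apply, hinj.eq_iff]
  have hz2 : ∀ (u : Fin 6 → K) (j : Fin 24), (∀ l, j ≠ zr l) → zvec u (.inl (true, j)) = 0 := by
    intro u j hj
    simp [zvec, e_apply, hj]
  have n1 : ∀ l, α 2 ≠ zr l := by decide
  have n2 : ∀ l, α 5 ≠ zr l := by decide
  have d1 : α 2 ≠ α 5 := by decide
  have d2 : ∀ l, zr l ≠ α 2 := by decide
  have d3 : ∀ l, zr l ≠ α 5 := by decide
  have c6 : zr 0 = α 6 := rfl
  have c10 : zr 3 = α 10 := rfl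
  rw [← c6] at b6
  rw [← c10] at b10
  simp only [Pi.add_apply, Pi.smul_apply, h1_apply, e_apply, hz, hz2 _ _ n1, hz2 _ _ n2, d1,
    d1.symm, d2, d3, smul_eq_mul, if_true, if_false, mul_one, mul_zero, add_zero, zero_add]
    at a2 a5 b6 b10 az'
  exact ⟨Prod.ext a2 a5, Prod.ext (by simpa [r2] using b6) (by simpa [r2] using b10), funext az'⟩

/-- Whether a number denotes a basis vector outside the root vectors of `N`. -/
def notN (y : ℕ) : Bool := decide (∀ n ∈ coreN, 5555 + pc n ≠ y)

theorem basisOf_pos (i : Fin 24) : basisOf (5555 + pc i) = .inl (true, i) :=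
  basisOf_num (.inl (true, i))

/-- Modulo the span of the root vectors of `N`, the terms of a column that lie in `N` can be
dropped. -/
theorem smodEq_filter (l : List ℕ) (c : K) :
    (l.map fun y => c • (Pi.single (basisOf y) 1 : Idx → K)).sum ≡
      ((l.filter notN).map fun y => c • (Pi.single (basisOf y) 1 : Idx → K)).sum
        [SMOD Nsub K] := by
  induction l with
  | nil => rfl
  | cons a l ih =>
    rw [List.map_cons, List.sum_cons, List.filter_cons]
    split_ifs with h
    · rw [List.map_cons, List.sum_cons]
      exact SModEq.rfl.add ih
    · simp only [notN, decide_eq_true_eq, not_forall, not_not] at h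
      obtain ⟨n, hn, rfl⟩ := h
      have : c • (Pi.single (basisOf (5555 + pc n)) 1 : Idx → K) ≡ 0 [SMOD Nsub K] := by
        rw [basisOf_pos, SModEq.zero]
        exact Submodule.smul_mem _ _ (Submodule.subset_span ⟨n, hn, rfl⟩)
      simpa using this.add ih

variable [CharP K 2]

theorem r2_add (w w' : K × K) : r2 (w + w') = r2 w + r2 w' := by
  ext l; fin_cases l <;> simp [r2, CharTwo.add_sq]

theorem r5_add (w w' : K × K) : r5 (w + w') = r5 w + r5 w' := by
  ext l; fin_cases l <;> simp [r5, CharTwo.add_sq]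

/-- The coordinates of a product. Moving `x₂(v'.1) x₅(v'.2)` to the left past `x₃(w.1) x₇(w.2)`
produces the term `bracket v' w`. -/
theorem ActsAs.mul {M M' : Matrix Idx Idx K} {v w v' w' : K × K} {u u' : Fin 6 → K}
    (h : ActsAs M v w u) (h' : ActsAs M' v' w' u') :
    ActsAs (M * M') (v + v') (w + w') (u + u' + bracket v' w) where
  on_h1 := by
    rw [← Matrix.mulVec_mulVec]
    refine (h.smodEq h'.on_h1).trans ?_
    rw [Matrix.mulVec_add, Matrix.mulVec_add, Matrix.mulVec_add, Matrix.mulVec_smul,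
      Matrix.mulVec_smul]
    refine (((h.on_h1.add (h.on_e2.smul v'.1)).add (h.on_e5.smul v'.2)).add
      (h.on_zvec u')).trans ?_
    rw [zvec_add, zvec_add, bracket, zvec_add, zvec_smul, zvec_smul, Prod.fst_add, Prod.snd_add]
    refine smodEq_of_eq ?_
    module
  on_e2 := by
    rw [← Matrix.mulVec_mulVec]
    refine (h.smodEq h'.on_e2).trans ?_
    rw [Matrix.mulVec_add, r2_add, zvec_add, ← add_assoc]
    exact h.on_e2.add (h.on_zvec _)
  on_e5 := by
    rw [← Matrix.mulVec_mulVec]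
    refine (h.smodEq h'.on_e5).trans ?_
    rw [Matrix.mulVec_add, r5_add, zvec_add, ← add_assoc]
    exact h.on_e5.add (h.on_zvec _)
  on_z l := by
    rw [← Matrix.mulVec_mulVec]
    exact (h.smodEq (h'.on_z l)).trans (h.on_z l)
  on_N n hn := by
    rw [← Matrix.mulVec_mulVec]
    refine (h.smodEq (h'.on_N n hn)).trans ?_
    rw [Matrix.mulVec_zero]

theorem rootMatrix_smodEq {i : Fin 24} (t : K) (r : Idx) {l l' : List ℕ}
    (h1 : (colOne (pc i) (num r)).filter notN = l) (h2 : (colTwo (pc i) (num r)).filter notN = l') :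
    (rootMatrix i t).mulVec (Pi.single r 1) ≡ Pi.single r 1 +
      (l.map fun y => t • (Pi.single (basisOf y) 1 : Idx → K)).sum +
      (l'.map fun y => t ^ 2 • (Pi.single (basisOf y) 1 : Idx → K)).sum [SMOD Nsub K] := by
  rw [rootMatrix_mulVec, ← h1, ← h2]
  exact (SModEq.rfl.add (smodEq_filter _ _)).add (smodEq_filter _ _)

/-- The columns of the root matrices of `X_P` at the basis of the section. At `h₁` the coefficient
is the parity of the pairing of the root with the coroot of `α₁`. -/
theorem col_h1 : ∀ i ∈ coreP, (colOne (pc i) (num (.inr 0))).filter notN =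
      (if i ∈ ({α 2, α 5, α 6, α 8, α 9, α 10, α 12, α 18} : Finset (Fin 24)) then [5555 + pc i]
        else []) ∧
    (colTwo (pc i) (num (.inr 0))).filter notN = [] := by
  decide +kernel

theorem col_e2 : ∀ i ∈ coreP, (colOne (pc i) (num (.inl (true, α 2)))).filter notN =
      (if i = α 3 then [5555 + pc (α 6)] else if i = α 7 then [5555 + pc (α 10)] else []) ∧
    (colTwo (pc i) (num (.inl (true, α 2)))).filter notN =
      (if i = α 3 then [5555 + pc (α 9)] else []) := by
  decide +kernel

theorem col_e5 : ∀ i ∈ coreP, (colOne (pc i) (num (.inl (true, α 5)))).filter notN =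
      (if i = α 3 then [5555 + pc (α 8)] else if i = α 7 then [5555 + pc (α 12)] else []) ∧
    (colTwo (pc i) (num (.inl (true, α 5)))).filter notN =
      (if i = α 7 then [5555 + pc (α 18)] else []) := by
  decide +kernel

theorem col_zr : ∀ i ∈ coreP, ∀ l, (colOne (pc i) (num (.inl (true, zr l)))).filter notN = [] ∧
    (colTwo (pc i) (num (.inl (true, zr l)))).filter notN = [] := by
  decide +kernel

theorem col_N : ∀ i ∈ coreP, ∀ n ∈ coreN,
    (colOne (pc i) (num (.inl (true, n)))).filter notN = [] ∧
    (colTwo (pc i) (num (.inl (true, n)))).filter notN = [] := by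
  decide +kernel

theorem actsAs_rootMatrix {i : Fin 24} (hi : i ∈ coreP) (t : K) :
    ActsAs (rootMatrix i t) (if i = α 2 then t else 0, if i = α 5 then t else 0)
      (if i = α 3 then t else 0, if i = α 7 then t else 0)
      (fun l => if i = zr l then t else 0) where
  on_h1 := by
    refine (rootMatrix_smodEq t _ (col_h1 i hi).1 (col_h1 i hi).2).trans (smodEq_of_eq ?_)
    have key : (if i ∈ ({α 2, α 5, α 6, α 8, α 9, α 10, α 12, α 18} : Finset (Fin 24)) then
        t • (e i : Idx → K) else 0) = (if i = α 2 then t else 0) • e (α 2) +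
        (if i = α 5 then t else 0) • e (α 5) + zvec (fun l => if i = zr l then t else 0) := by
      have hdec : ∀ i : Fin 24, i = α 2 ∨ i = α 5 ∨ i = α 6 ∨ i = α 8 ∨ i = α 9 ∨ i = α 10 ∨
          i = α 12 ∨ i = α 18 ∨
          (i ∉ ({α 2, α 5, α 6, α 8, α 9, α 10, α 12, α 18} : Finset (Fin 24)) ∧
            i ≠ α 2 ∧ i ≠ α 5 ∧ ∀ l, i ≠ zr l) := by decide
      rcases hdec i with rfl | rfl | rfl | rfl | rfl | rfl | rfl | rfl | ⟨h1, h2, h3, h4⟩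
      all_goals first
        | simp only [h1, h2, h3, h4, if_false, zvec]; simp
        | simp [zvec, Fin.sum_univ_six, zr, α, Fin.ofNat]
    dsimp only
    rw [add_assoc h1, add_assoc h1, ← key]
    split_ifs with h
    · simp [basisOf_pos, e, h1]
    · simp [h1]
  on_e2 := by
    refine (rootMatrix_smodEq t _ (col_e2 i hi).1 (col_e2 i hi).2).trans (smodEq_of_eq ?_)
    have hdec : α 7 ≠ α 3 := by decide
    by_cases h3 : i = α 3
    · subst h3
      simp [basisOf_pos, zvec, Fin.sum_univ_six, r2, e, hdec.symm, zr, add_assoc]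
    · by_cases h7 : i = α 7
      · subst h7
        simp [basisOf_pos, zvec, Fin.sum_univ_six, r2, e, hdec, zr]
      · simp [h3, h7, zvec, Fin.sum_univ_six, r2, e]
  on_e5 := by
    refine (rootMatrix_smodEq t _ (col_e5 i hi).1 (col_e5 i hi).2).trans (smodEq_of_eq ?_)
    have hdec : α 7 ≠ α 3 := by decide
    by_cases h3 : i = α 3
    · subst h3
      simp [basisOf_pos, zvec, Fin.sum_univ_six, r5, e, hdec.symm, zr]
    · by_cases h7 : i = α 7
      · subst h7
        simp [basisOf_pos, zvec, Fin.sum_univ_six, r5, e, hdec, zr, add_assoc]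
      · simp [h3, h7, zvec, Fin.sum_univ_six, r5, e]
  on_z l := by
    refine (rootMatrix_smodEq t _ (col_zr i hi l).1 (col_zr i hi l).2).trans (smodEq_of_eq ?_)
    simp [e]
  on_N n hn := by
    refine (rootMatrix_smodEq t _ (col_N i hi n hn).1 (col_N i hi n hn).2).trans ?_
    rw [SModEq.zero]
    simp only [List.map_nil, List.sum_nil, add_zero]
    exact Submodule.subset_span ⟨n, hn, rfl⟩

end action

end UF4

/-! ### The structure of the quattern group `X_S` -/

/-- A group of Heisenberg type: every element is uniquely a product `X v * Y w * Z u` with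
additive maps `X`, `Y`, `Z`, where `Z` is central and the commutators of the `X v` and `Y w` lie in
the image of `Z`. -/
structure HeisenbergData (V W U G : Type*) [AddCommGroup V] [AddCommGroup W] [AddCommGroup U]
    [Group G] where
  (X : V → G)
  (Y : W → G)
  (Z : U → G)
  (B : V → W → U)
  X_add : ∀ v v', X (v + v') = X v * X v'
  Y_add : ∀ w w', Y (w + w') = Y w * Y w'
  Z_add : ∀ u u', Z (u + u') = Z u * Z u'
  comm : ∀ v w, Y w * X v = X v * Y w * Z (B v w)
  central : ∀ u g, Z u * g = g * Z u
  inj : ∀ v w u v' w' u', X v * Y w * Z u = X v' * Y w' * Z u' → v = v' ∧ w = w' ∧ u = u'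
  surj : ∀ g, ∃ v w u, g = X v * Y w * Z u

/-- The multiplication law for products of three additive maps, the last of which is central and
contains the commutators of the first two. -/
theorem mul_of_comm_of_central {V W U G : Type*} [Add V] [Add W] [Add U] [Group G]
    {X : V → G} {Y : W → G} {Z : U → G} {B : V → W → U}
    (hX : ∀ v v', X (v + v') = X v * X v') (hY : ∀ w w', Y (w + w') = Y w * Y w')
    (hZ : ∀ u u', Z (u + u') = Z u * Z u') (hB : ∀ v w, Y w * X v = X v * Y w * Z (B v w))
    (hc : ∀ u g, Z u * g = g * Z u) (v : V) (w : W) (u : U) (v' : V) (w' : W) (u' : U) :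
    X v * Y w * Z u * (X v' * Y w' * Z u') =
      X (v + v') * Y (w + w') * Z (u + u' + B v' w) := by
  rw [hX, hY, hZ, hZ]
  calc X v * Y w * Z u * (X v' * Y w' * Z u')
      = X v * Y w * (Z u * (X v' * Y w' * Z u')) := by group
    _ = X v * (Y w * X v') * (Y w' * Z u' * Z u) := by rw [hc]; group
    _ = X v * X v' * Y w * (Z (B v' w) * (Y w' * Z u' * Z u)) := by rw [hB]; group
    _ = X v * X v' * Y w * Y w' * (Z u' * Z u * Z (B v' w)) := by rw [hc]; group
    _ = X v * X v' * (Y w * Y w') * (Z u * Z u' * Z (B v' w)) := by rw [hc u']; group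

namespace UF4

section quattern

/-- The center of a group as a commutative group, extending the group structure that it has as a
subgroup. -/
@[reducible]
def centerCommGroup (G : Type*) [Group G] : CommGroup (Subgroup.center G) :=
  { (inferInstance : Group (Subgroup.center G)) with
    mul_comm := fun a b => Subtype.ext (Subgroup.mem_center_iff.1 b.2 a) }

-- the instance makes products over the roots in `Z` of central root elements available
attribute [local instance] centerCommGroup

variable {K : Type*} [Field K] [CharP K 2]

/-- Together with `X_conj_mem`, this says that `X_N` is normal in `X_P`. -/
theorem commRoots_coreN : ∀ i ∈ coreP, ∀ j ∈ coreN, ∀ k ∈ commRoots i j, k ∈ coreN := by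
  decide +kernel

/-- Together with `X_conj_mem`, this says that `X_P` is normal in `U`. -/
theorem commRoots_coreP : ∀ i, ∀ j ∈ coreP, ∀ k ∈ commRoots i j, k ∈ coreP := by
  decide +kernel

theorem normal_coreN : ((X K coreN).subgroupOf (X K coreP)).Normal := by
  refine ⟨fun n hn g => ?_⟩
  rw [Subgroup.mem_subgroupOf] at hn ⊢
  exact X_conj_mem commRoots_coreN g.2 hn

theorem normal_coreP : (X K coreP).Normal := by
  refine ⟨fun n hn g => ?_⟩
  have hg : g ∈ X K Finset.univ := by
    obtain ⟨g, hg⟩ := g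
    induction hg using Subgroup.closure_induction with
    | mem g hg =>
      obtain ⟨i, t, rfl⟩ := hg
      exact x_mem (Finset.mem_univ i) t
    | one => exact one_mem _
    | mul a b ha hb ha' hb' => exact mul_mem ha' hb'
    | inv a ha ha' => exact inv_mem ha'
  exact X_conj_mem (fun i _ => commRoots_coreP i) hg hn

/-- The projection of `X_P` onto `X_S`. -/
def proj (K : Type*) [Field K] [CharP K 2] : X K coreP →* XS K := QuotientGroup.mk' _

theorem proj_surjective : Function.Surjective (proj K) := QuotientGroup.mk'_surjective _

theorem proj_eq_one_iff (g : X K coreP) : proj K g = 1 ↔ (g : U K) ∈ X K coreN := by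
  have := normal_coreN (K := K)
  rw [← MonoidHom.mem_ker, proj, QuotientGroup.ker_mk', Subgroup.normalClosure_eq_self,
    Subgroup.mem_subgroupOf]

/-- The root elements of `X_S`, indexed by all positive roots. -/
abbrev Qx (i : Fin 24) (t : K) : XS K := Quattern.x coreP coreN i t

theorem Qx_eq {i : Fin 24} (hi : i ∈ coreP) (t : K) : Qx i t = proj K ⟨x i t, x_mem hi t⟩ := by
  simp only [Qx, Quattern.x, hi, dif_pos]; rfl

theorem Qx_of_mem_coreN {i : Fin 24} (hi : i ∈ coreN) (t : K) : Qx i t = 1 := by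
  rw [Qx_eq (Finset.sdiff_subset hi), proj_eq_one_iff]
  exact x_mem hi t

theorem Qx_add {i : Fin 24} (hi : i ∈ coreP) (s t : K) : Qx i (s + t) = Qx i s * Qx i t := by
  rw [Qx_eq hi, Qx_eq hi, Qx_eq hi, ← map_mul]
  congr 1
  exact Subtype.ext (x_mul_x i s t).symm

theorem XS_induction {p : XS K → Prop} (hx : ∀ i ∈ coreP, ∀ t : K, p (Qx i t)) (h1 : p 1)
    (hmul : ∀ a b, p a → p b → p (a * b)) (hinv : ∀ a, p a → p a⁻¹) (g : XS K) : p g := by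
  obtain ⟨⟨g, hg⟩, rfl⟩ := proj_surjective g
  induction hg using Subgroup.closure_induction with
  | mem g hg =>
    obtain ⟨i, hi, t, rfl⟩ := hg
    rw [← Qx_eq hi]; exact hx i hi t
  | one => exact (map_one (proj K)).symm ▸ h1
  | mul a b ha hb ha' hb' => exact (map_mul (proj K) ⟨a, ha⟩ ⟨b, hb⟩).symm ▸ hmul _ _ ha' hb'
  | inv a ha ha' => exact (map_inv (proj K) ⟨a, ha⟩).symm ▸ hinv _ ha'

theorem commList_coreP : ∀ i ∈ coreP, ∀ j ∈ coreP, ∀ k ∈ commList i j, k.1 ∈ coreP := by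
  decide +kernel

theorem Qx_mul_of_lt {i j : Fin 24} (hi : i ∈ coreP) (hj : j ∈ coreP) (hij : i < j) (s t : K) :
    Qx i s * Qx j t = Qx j t * (Qx i s *
      ((commList i j).map fun y => Qx y.1 (s ^ y.2.1 * t ^ y.2.2)).prod) := by
  have hl : ∀ l : List (Fin 24 × ℕ × ℕ), (∀ k ∈ l, k.1 ∈ coreP) → ∃ g : X K coreP,
      (g : U K) = (l.map fun y => x y.1 (s ^ y.2.1 * t ^ y.2.2)).prod ∧
      proj K g = (l.map fun y => Qx y.1 (s ^ y.2.1 * t ^ y.2.2)).prod := by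
    intro l hl
    induction l with
    | nil => exact ⟨1, rfl, map_one _⟩
    | cons y l ih =>
      obtain ⟨g, hg1, hg2⟩ := ih fun k hk => hl k (List.mem_cons_of_mem _ hk)
      have hy := hl y List.mem_cons_self
      refine ⟨⟨x y.1 (s ^ y.2.1 * t ^ y.2.2), x_mem hy _⟩ * g, ?_, ?_⟩
      · rw [List.map_cons, List.prod_cons, ← hg1]; rfl
      · rw [List.map_cons, List.prod_cons, ← hg2, map_mul, Qx_eq hy]
  obtain ⟨g, hg1, hg2⟩ := hl _ (commList_coreP i hi j hj)
  rw [← hg2, Qx_eq hi, Qx_eq hj, ← map_mul, ← map_mul, ← map_mul]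
  congr 1
  apply Subtype.ext
  have := x_mul_of_lt hij s t
  rw [← hg1] at this
  exact this

theorem Qx_prod_eq_one {l : List (Fin 24 × ℕ × ℕ)} (hl : ∀ y ∈ l, y.1 ∈ coreN) (s t : K) :
    (l.map fun y => Qx y.1 (s ^ y.2.1 * t ^ y.2.2)).prod = 1 := by
  refine List.prod_eq_one fun z hz => ?_
  obtain ⟨y, hy, rfl⟩ := List.mem_map.1 hz
  exact Qx_of_mem_coreN (hl y hy) _

/-- Root elements commute in `X_S` if all roots in their commutator formula lie in `N`. -/
theorem Qx_commute {i j : Fin 24} (hi : i ∈ coreP) (hj : j ∈ coreP)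
    (h : ∀ k ∈ commRoots i j, k ∈ coreN) (s t : K) : Qx i s * Qx j t = Qx j t * Qx i s := by
  rcases lt_trichotomy i j with hij | hij | hij
  · rw [commRoots, if_pos hij] at h
    rw [Qx_mul_of_lt hi hj hij, Qx_prod_eq_one fun y hy => h _ (List.mem_map_of_mem hy), mul_one]
  · subst hij
    rw [← Qx_add hi, ← Qx_add hi, add_comm]
  · rw [commRoots, if_neg hij.not_gt, if_pos hij] at h
    rw [Qx_mul_of_lt hj hi hij, Qx_prod_eq_one fun y hy => h _ (List.mem_map_of_mem hy), mul_one]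

/-- The root subgroups of the roots in `Z` are central modulo `X_N`. -/
theorem commRoots_zr : ∀ l, ∀ j ∈ coreP, ∀ k ∈ commRoots (zr l) j, k ∈ coreN := by
  decide +kernel

theorem zr_mem : ∀ l, zr l ∈ coreP := by decide +kernel

theorem Qx_zr_central (l : Fin 6) (t : K) (g : XS K) : Qx (zr l) t * g = g * Qx (zr l) t := by
  induction g using XS_induction with
  | hx i hi s => exact Qx_commute (zr_mem l) hi (commRoots_zr l i hi) t s
  | h1 => rw [mul_one, one_mul]
  | hmul a b ha hb => rw [← mul_assoc, ha, mul_assoc, hb, mul_assoc]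
  | hinv a ha => exact (Commute.inv_right ha : Commute _ _)

/-- The root elements of `X_S` for the roots in `Z`, as elements of the center. -/
def zc (l : Fin 6) (t : K) : Subgroup.center (XS K) :=
  ⟨Qx (zr l) t, Subgroup.mem_center_iff.2 fun g => (Qx_zr_central l t g).symm⟩

theorem zc_add (l : Fin 6) (s t : K) : zc l (s + t) = zc l s * zc l t :=
  Subtype.ext (Qx_add (zr_mem l) s t)

/-- The product of root elements of `X_S` with given coordinates at the roots of `Z`. -/
def ZS (u : Fin 6 → K) : XS K := (∏ l, zc l (u l) : Subgroup.center (XS K))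

/-- The element `x₂(v.1) x₅(v.2)` of `X_S`. -/
def XX (v : K × K) : XS K := xS 2 v.1 * xS 5 v.2

/-- The element `x₃(w.1) x₇(w.2)` of `X_S`. -/
def YY (w : K × K) : XS K := xS 3 w.1 * xS 7 w.2

theorem ZS_add (u u' : Fin 6 → K) : ZS (u + u') = ZS u * ZS u' := by
  simp only [ZS, Pi.add_apply, zc_add, Finset.prod_mul_distrib, Subgroup.coe_mul]

theorem ZS_central (u : Fin 6 → K) (g : XS K) : ZS u * g = g * ZS u :=
  (Subgroup.mem_center_iff.1 (∏ l, zc l (u l) : Subgroup.center (XS K)).2 g).symm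

theorem XX_add (v v' : K × K) : XX (v + v') = XX v * XX v' := by
  have h2 : α 2 ∈ coreP := by decide
  have h5 : α 5 ∈ coreP := by decide
  have h := Qx_commute h2 h5 (by decide +kernel) v'.1 v.2
  simp only [XX, xS, Prod.fst_add, Prod.snd_add, Qx_add h2, Qx_add h5, mul_assoc]
  rw [← mul_assoc (Qx (α 2) v'.1), h, mul_assoc]

theorem YY_add (w w' : K × K) : YY (w + w') = YY w * YY w' := by
  have h2 : α 3 ∈ coreP := by decide
  have h5 : α 7 ∈ coreP := by decide
  have h := Qx_commute h2 h5 (by decide +kernel) w'.1 w.2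
  simp only [YY, xS, Prod.fst_add, Prod.snd_add, Qx_add h2, Qx_add h5, mul_assoc]
  rw [← mul_assoc (Qx (α 3) w'.1), h, mul_assoc]

theorem zc_mul_self (l : Fin 6) (t : K) : zc l t * zc l t = 1 := by
  rw [← zc_add, CharTwo.add_self_eq_zero]
  have := zc_add l (0 : K) 0
  rwa [add_zero, eq_comm, mul_eq_left] at this

theorem xS3_mul_xS2 (s t : K) :
    xS 3 s * xS 2 t = xS 2 t * xS 3 s * (zc 0 (t * s) * zc 2 (t * s ^ 2) : Subgroup.center _) := by
  have h := Qx_mul_of_lt (K := K) (i := α 2) (j := α 3) (by decide) (by decide) (by decide) t s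
  rw [show commList (α 2) (α 3) = [(α 6, 1, 1), (α 9, 1, 2)] by decide +kernel] at h
  have h' : xS 2 t * xS 3 s =
      xS 3 s * xS 2 t * (zc 0 (t * s) * zc 2 (t * s ^ 2) : Subgroup.center _) := by
    simpa [mul_assoc, zc, zr, xS, Qx] using h
  rw [h', mul_assoc _ (_ : XS K) (_ : XS K), ← Subgroup.coe_mul, mul_mul_mul_comm, zc_mul_self,
    zc_mul_self]
  simp

theorem xS7_mul_xS2 (s t : K) : xS 7 s * xS 2 t = xS 2 t * xS 7 s * zc 3 (t * s) := by
  have h := Qx_mul_of_lt (K := K) (i := α 2) (j := α 7) (by decide) (by decide) (by decide) t s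
  rw [show commList (α 2) (α 7) = [(α 10, 1, 1), (α 16, 1, 2)] by decide +kernel] at h
  have h' : xS 2 t * xS 7 s = xS 7 s * xS 2 t * zc 3 (t * s) := by
    have hN : ∀ c : K, Quattern.x coreP coreN (α 16) c = 1 := Qx_of_mem_coreN (by decide)
    simpa [mul_assoc, zc, zr, xS, Qx, hN] using h
  rw [h', mul_assoc _ (_ : XS K) (_ : XS K), ← Subgroup.coe_mul, zc_mul_self]
  simp

theorem xS3_mul_xS5 (s t : K) : xS 3 s * xS 5 t = xS 5 t * xS 3 s * zc 1 (t * s) := by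
  have h := Qx_mul_of_lt (K := K) (i := α 3) (j := α 5) (by decide) (by decide) (by decide) s t
  rw [show commList (α 3) (α 5) = [(α 8, 1, 1), (α 11, 2, 1)] by decide +kernel] at h
  have hN : ∀ c : K, Quattern.x coreP coreN (α 11) c = 1 := Qx_of_mem_coreN (by decide)
  simpa [mul_assoc, zc, zr, xS, Qx, hN, mul_comm t s] using h

theorem xS7_mul_xS5 (s t : K) :
    xS 7 s * xS 5 t = xS 5 t * xS 7 s * (zc 4 (t * s) * zc 5 (t * s ^ 2) : Subgroup.center _) := by
  have h := Qx_mul_of_lt (K := K) (i := α 5) (j := α 7) (by decide) (by decide) (by decide) t s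
  rw [show commList (α 5) (α 7) = [(α 12, 1, 1), (α 18, 1, 2)] by decide +kernel] at h
  have h' : xS 5 t * xS 7 s =
      xS 7 s * xS 5 t * (zc 4 (t * s) * zc 5 (t * s ^ 2) : Subgroup.center _) := by
    simpa [mul_assoc, zc, zr, xS, Qx] using h
  rw [h', mul_assoc _ (_ : XS K) (_ : XS K), ← Subgroup.coe_mul, mul_mul_mul_comm, zc_mul_self,
    zc_mul_self]
  simp

/-- Reordering of a product of four elements that commute up to central elements. -/
theorem reorder_of_commutators {G : Type*} [Group G] {a b c d : G}
    {p q r s : Subgroup.center G} (h1 : c * a = a * c * p) (h2 : d * a = a * d * q)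
    (h3 : c * b = b * c * r) (h4 : d * b = b * d * s) :
    c * d * (a * b) = a * b * (c * d) * (p * q * r * s : Subgroup.center G) := by
  have hc : ∀ (z : Subgroup.center G) (g : G), (z : G) * g = g * z := fun z g =>
    (Subgroup.mem_center_iff.1 z.2 g).symm
  calc c * d * (a * b) = c * (d * a) * b := by group
    _ = c * a * d * (q * b) := by rw [h2]; group
    _ = c * a * (d * b) * q := by rw [hc q b]; group
    _ = a * c * (p * (b * d * s * q)) := by rw [h1, h4]; group
    _ = a * (c * b) * (d * s * q * p) := by rw [hc p]; group
    _ = a * b * c * (r * (d * s * q * p)) := by rw [h3]; group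
    _ = a * b * (c * d) * (s * q * p * r) := by rw [hc r]; group
    _ = a * b * (c * d) * (p * q * r * s : Subgroup.center G) := by
      congr 1
      norm_cast
      ac_rfl

theorem YY_mul_XX (v w : K × K) : YY w * XX v = XX v * YY w * ZS (bracket v w) := by
  rw [YY, XX, reorder_of_commutators (xS3_mul_xS2 w.1 v.1) (xS7_mul_xS2 w.2 v.1)
    (xS3_mul_xS5 w.1 v.2) (xS7_mul_xS5 w.2 v.2), ZS]
  congr 2
  simp only [Fin.prod_univ_six, bracket, r2, r5, Pi.add_apply, Pi.smul_apply, smul_eq_mul]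
  simp
  ac_rfl

omit [CharP K 2] in
theorem ActsAs.one : ActsAs (1 : Matrix Idx Idx K) 0 0 0 := by
  constructor
  · simp [zvec]
  · simp [zvec, r2, Fin.sum_univ_six]
  · simp [zvec, r5, Fin.sum_univ_six]
  · simp
  · intro n hn
    rw [Matrix.one_mulVec, SModEq.zero]
    exact Submodule.subset_span ⟨n, hn, rfl⟩

omit [CharP K 2] in
theorem bracket_zero_left (w : K × K) : bracket 0 w = 0 := by simp [bracket]

omit [CharP K 2] in
theorem bracket_zero_right (v : K × K) : bracket v 0 = 0 := by
  ext l; fin_cases l <;> simp [bracket, r2, r5]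

/-- The elements of `X_N` act trivially on the section, so that the coordinates are well defined on
`X_S`. -/
theorem actsAs_of_mem_coreN {g : U K} (hg : g ∈ X K coreN) :
    ActsAs ((g : GL Idx K) : Matrix Idx Idx K) 0 0 0 := by
  have hx : ∀ i ∈ coreN, ∀ t : K, ActsAs (((x i t : U K) : GL Idx K) : Matrix Idx Idx K) 0 0 0 := by
    intro i hi t
    have h := actsAs_rootMatrix (Finset.sdiff_subset hi) t
    have hdec : ∀ i ∈ coreN, i ≠ α 2 ∧ i ≠ α 5 ∧ i ≠ α 3 ∧ i ≠ α 7 ∧ ∀ l, i ≠ zr l := by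
      decide +kernel
    obtain ⟨h2, h5, h3, h7, hz⟩ := hdec i hi
    simp only [h2, h5, h3, h7, hz, if_false] at h
    exact h
  suffices H : ActsAs ((g : GL Idx K) : Matrix Idx Idx K) 0 0 0 ∧
      ActsAs ((g⁻¹ : U K) : GL Idx K).1 0 0 0 from H.1
  induction hg using Subgroup.closure_induction with
  | mem g hg =>
    obtain ⟨i, hi, t, rfl⟩ := hg
    rw [x_inv]
    exact ⟨hx i hi t, hx i hi t⟩
  | one => rw [inv_one]; exact ⟨ActsAs.one, ActsAs.one⟩
  | mul a b _ _ ha hb =>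
    rw [mul_inv_rev]
    have h1 := ha.1.mul hb.1
    have h2 := hb.2.mul ha.2
    simp only [bracket_zero_left, add_zero] at h1 h2
    exact ⟨h1, h2⟩
  | inv a _ ha => rw [inv_inv]; exact ha.symm

/-- The element of `X_S` has the given coordinates, read off from the action of its
representatives. -/
def HasCoord (g : XS K) (v w : K × K) (u : Fin 6 → K) : Prop :=
  ∃ h : X K coreP, proj K h = g ∧ ActsAs (((h : U K) : GL Idx K) : Matrix Idx Idx K) v w u

theorem HasCoord.unique {g : XS K} {v w v' w' : K × K} {u u' : Fin 6 → K}
    (h : HasCoord g v w u) (h' : HasCoord g v' w' u') : v = v' ∧ w = w' ∧ u = u' := by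
  obtain ⟨a, rfl, ha⟩ := h
  obtain ⟨b, hb', hb⟩ := h'
  have hn : proj K (a⁻¹ * b) = 1 := by rw [map_mul, map_inv, hb', inv_mul_cancel]
  have hN := actsAs_of_mem_coreN ((proj_eq_one_iff _).1 hn)
  have h1 := ha.mul hN
  rw [bracket_zero_left, add_zero, add_zero, add_zero, add_zero] at h1
  refine h1.unique ?_
  convert hb using 1
  have : (a : U K) * ((a⁻¹ * b : X K coreP) : U K) = b := by simp
  conv_rhs => rw [← this]
  rfl

theorem HasCoord.mul {g g' : XS K} {v w v' w' : K × K} {u u' : Fin 6 → K}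
    (h : HasCoord g v w u) (h' : HasCoord g' v' w' u') :
    HasCoord (g * g') (v + v') (w + w') (u + u' + bracket v' w) := by
  obtain ⟨a, rfl, ha⟩ := h
  obtain ⟨b, rfl, hb⟩ := h'
  exact ⟨a * b, map_mul _ _ _, ha.mul hb⟩

theorem hasCoord_Qx {i : Fin 24} (hi : i ∈ coreP) (t : K) :
    HasCoord (Qx i t) (if i = α 2 then t else 0, if i = α 5 then t else 0)
      (if i = α 3 then t else 0, if i = α 7 then t else 0) (fun l => if i = zr l then t else 0) :=
  ⟨_, (Qx_eq hi t).symm, actsAs_rootMatrix hi t⟩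

theorem hasCoord_xS2 (t : K) : HasCoord (xS 2 t) (t, 0) 0 0 := by
  have h := hasCoord_Qx (show α 2 ∈ coreP by decide) t
  simp only [show α 2 ≠ α 5 by decide, show α 2 ≠ α 3 by decide, show α 2 ≠ α 7 by decide,
    show ∀ l, α 2 ≠ zr l by decide, if_true, if_false] at h
  exact h

theorem hasCoord_xS5 (t : K) : HasCoord (xS 5 t) (0, t) 0 0 := by
  have h := hasCoord_Qx (show α 5 ∈ coreP by decide) t
  simp only [show α 5 ≠ α 2 by decide, show α 5 ≠ α 3 by decide, show α 5 ≠ α 7 by decide,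
    show ∀ l, α 5 ≠ zr l by decide, if_true, if_false] at h
  exact h

theorem hasCoord_xS3 (t : K) : HasCoord (xS 3 t) 0 (t, 0) 0 := by
  have h := hasCoord_Qx (show α 3 ∈ coreP by decide) t
  simp only [show α 3 ≠ α 2 by decide, show α 3 ≠ α 5 by decide, show α 3 ≠ α 7 by decide,
    show ∀ l, α 3 ≠ zr l by decide, if_true, if_false] at h
  exact h

theorem hasCoord_xS7 (t : K) : HasCoord (xS 7 t) 0 (0, t) 0 := by
  have h := hasCoord_Qx (show α 7 ∈ coreP by decide) t
  simp only [show α 7 ≠ α 2 by decide, show α 7 ≠ α 5 by decide, show α 7 ≠ α 3 by decide,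
    show ∀ l, α 7 ≠ zr l by decide, if_true, if_false] at h
  exact h

theorem hasCoord_XX (v : K × K) : HasCoord (XX v) v 0 0 := by
  have h := (hasCoord_xS2 v.1).mul (hasCoord_xS5 v.2)
  simp only [bracket_zero_right, add_zero, Prod.mk_add_mk, zero_add, Prod.mk.eta] at h
  exact h

theorem hasCoord_YY (w : K × K) : HasCoord (YY w) 0 w 0 := by
  have h := (hasCoord_xS3 w.1).mul (hasCoord_xS7 w.2)
  simp only [bracket_zero_left, add_zero, Prod.mk_add_mk, zero_add, Prod.mk.eta] at h
  exact h

theorem hasCoord_zc (l : Fin 6) (t : K) : HasCoord (zc l t : XS K) 0 0 (Pi.single l t) := by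
  have h := hasCoord_Qx (zr_mem l) t
  have hinj : Function.Injective zr := by decide
  have hd : ∀ l, zr l ≠ α 2 ∧ zr l ≠ α 5 ∧ zr l ≠ α 3 ∧ zr l ≠ α 7 := by decide
  obtain ⟨h2, h5, h3, h7⟩ := hd l
  simp only [h2, h5, h3, h7, if_false, hinj.eq_iff] at h
  have hs : (Pi.single l t : Fin 6 → K) = fun m => if l = m then t else 0 := by
    ext m
    simp [Pi.single_apply, eq_comm]
  rw [hs]
  exact h

theorem hasCoord_ZS (u : Fin 6 → K) : HasCoord (ZS u) 0 0 u := by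
  have key : ∀ s : Finset (Fin 6), HasCoord ((∏ l ∈ s, zc l (u l) : Subgroup.center (XS K)) : XS K)
      0 0 (∑ l ∈ s, Pi.single l (u l)) := by
    intro s
    induction s using Finset.induction_on with
    | empty => exact ⟨1, map_one _, ActsAs.one⟩
    | insert l s hl ih =>
      rw [Finset.prod_insert hl, Finset.sum_insert hl, Subgroup.coe_mul]
      have := (hasCoord_zc l (u l)).mul ih
      simpa only [bracket_zero_left, add_zero] using this
  have := key Finset.univ
  rwa [Finset.univ_sum_single] at this

theorem XX_zero : XX (0 : K × K) = 1 := by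
  have := XX_add (0 : K × K) 0
  rwa [add_zero, eq_comm, mul_eq_left] at this

theorem YY_zero : YY (0 : K × K) = 1 := by
  have := YY_add (0 : K × K) 0
  rwa [add_zero, eq_comm, mul_eq_left] at this

theorem ZS_zero : ZS (0 : Fin 6 → K) = 1 := by
  have := ZS_add (0 : Fin 6 → K) 0
  rwa [add_zero, eq_comm, mul_eq_left] at this

theorem xS_zero {n : ℕ} (hn : α n ∈ coreP) : xS n (0 : K) = 1 := by
  have := Qx_add hn (0 : K) 0
  rwa [add_zero, eq_comm, mul_eq_left] at this

theorem ZS_single (l : Fin 6) (t : K) : ZS (Pi.single l t) = Qx (zr l) t := by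
  have h0 : ∀ m, zc m (0 : K) = 1 := by
    intro m
    have := zc_add m (0 : K) 0
    rwa [add_zero, eq_comm, mul_eq_left] at this
  rw [ZS, Finset.prod_eq_single l]
  · rw [Pi.single_eq_same]; rfl
  · intro m _ hm
    rw [Pi.single_eq_of_ne hm, h0]
  · simp

/-- Each root element of `X_P` has normal form in `X_S`, since `P` consists of `α₂`, `α₅`, `α₃`,
`α₇` and the roots in `Z` and `N`. -/
theorem Qx_form {i : Fin 24} (hi : i ∈ coreP) (t : K) : ∃ v w u, Qx i t = XX v * YY w * ZS u := by
  have h2 : ∀ t : K, XX (t, 0) = Qx (α 2) t := fun t => by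
    simp only [XX, xS_zero (show α 5 ∈ coreP by decide), mul_one]; rfl
  have h5 : ∀ t : K, XX (0, t) = Qx (α 5) t := fun t => by
    simp only [XX, xS_zero (show α 2 ∈ coreP by decide), one_mul]; rfl
  have h3 : ∀ t : K, YY (t, 0) = Qx (α 3) t := fun t => by
    simp only [YY, xS_zero (show α 7 ∈ coreP by decide), mul_one]; rfl
  have h7 : ∀ t : K, YY (0, t) = Qx (α 7) t := fun t => by
    simp only [YY, xS_zero (show α 3 ∈ coreP by decide), one_mul]; rfl
  have hdec : ∀ i ∈ coreP, i = α 2 ∨ i = α 5 ∨ i = α 3 ∨ i = α 7 ∨ (∃ l, i = zr l) ∨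
      i ∈ coreN := by decide +kernel
  rcases hdec i hi with rfl | rfl | rfl | rfl | ⟨l, rfl⟩ | hN
  · exact ⟨(t, 0), 0, 0, by rw [h2, YY_zero, ZS_zero, mul_one, mul_one]⟩
  · exact ⟨(0, t), 0, 0, by rw [h5, YY_zero, ZS_zero, mul_one, mul_one]⟩
  · exact ⟨0, (t, 0), 0, by rw [h3, XX_zero, ZS_zero, one_mul, mul_one]⟩
  · exact ⟨0, (0, t), 0, by rw [h7, XX_zero, ZS_zero, one_mul, mul_one]⟩
  · exact ⟨0, 0, Pi.single l t, by rw [ZS_single, XX_zero, YY_zero, one_mul, one_mul]⟩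
  · exact ⟨0, 0, 0, by rw [Qx_of_mem_coreN hN, XX_zero, YY_zero, ZS_zero, one_mul, one_mul]⟩

theorem XX_YY_ZS_mul (v w : K × K) (u : Fin 6 → K) (v' w' : K × K) (u' : Fin 6 → K) :
    XX v * YY w * ZS u * (XX v' * YY w' * ZS u') =
      XX (v + v') * YY (w + w') * ZS (u + u' + bracket v' w) :=
  mul_of_comm_of_central XX_add YY_add ZS_add YY_mul_XX ZS_central v w u v' w' u'

/-- The quattern group `X_S` is a group of Heisenberg type: the products `x₂ x₅` and `x₃ x₇` play
the roles of `X` and `Y`, and `X_Z` is the central part. -/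
def dataXS :
    HeisenbergData (K × K) (K × K) (Fin 6 → K) (XS K) where
  X := XX
  Y := YY
  Z := ZS
  B := bracket
  X_add := XX_add
  Y_add := YY_add
  Z_add := ZS_add
  comm := YY_mul_XX
  central := ZS_central
  inj v w u v' w' u' h := by
    have key : ∀ (v w : K × K) (u : Fin 6 → K), HasCoord (XX v * YY w * ZS u) v w u := by
      intro v w u
      have := ((hasCoord_XX v).mul (hasCoord_YY w)).mul (hasCoord_ZS u)
      simpa only [bracket_zero_left, add_zero, zero_add] using this
    exact (key v w u).unique (h ▸ key v' w' u')
  surj g := by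
    induction g using XS_induction with
    | hx i hi t => exact Qx_form hi t
    | h1 => exact ⟨0, 0, 0, by rw [XX_zero, YY_zero, ZS_zero, one_mul, one_mul]⟩
    | hmul a b ha hb =>
      obtain ⟨v, w, u, rfl⟩ := ha
      obtain ⟨v', w', u', rfl⟩ := hb
      exact ⟨_, _, _, XX_YY_ZS_mul v w u v' w' u'⟩
    | hinv a ha =>
      obtain ⟨v, w, u, rfl⟩ := ha
      refine ⟨-v, -w, -u - bracket (-v) w, inv_eq_of_mul_eq_one_right ?_⟩
      rw [XX_YY_ZS_mul, add_neg_cancel, add_neg_cancel, XX_zero, YY_zero]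
      have : u + (-u - bracket (-v) w) + bracket (-v) w = 0 := by abel
      rw [this, ZS_zero, one_mul, one_mul]

end quattern

end UF4

/-! ### Irreducible characters of finite groups -/

namespace Representation

variable {G V : Type*} [Group G] [AddCommGroup V] [Module ℂ V]

/-- Irreducibility in terms of invariant subspaces. -/
theorem isIrreducible_iff_forall_submodule (ρ : Representation ℂ G V) :
    ρ.IsIrreducible ↔ Nontrivial V ∧
      ∀ p : Submodule ℂ V, (∀ g, ∀ v ∈ p, ρ g v ∈ p) → p = ⊥ ∨ p = ⊤ := by
  constructor
  · intro h
    constructor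
    · by_contra hV
      rw [not_nontrivial_iff_subsingleton] at hV
      refine bot_ne_top (α := Subrepresentation ρ) ?_
      exact Subrepresentation.toSubmodule_injective (Subsingleton.elim _ _)
    · intro p hp
      rcases eq_bot_or_eq_top (⟨p, hp⟩ : Subrepresentation ρ) with h | h
      · exact Or.inl (congrArg Subrepresentation.toSubmodule h)
      · exact Or.inr (congrArg Subrepresentation.toSubmodule h)
  · rintro ⟨hV, h⟩
    refine { exists_pair_ne := ⟨⊥, ⊤, fun h0 => ?_⟩, eq_bot_or_eq_top := fun p => ?_ }
    · exact bot_ne_top (α := Submodule ℂ V) (congrArg Subrepresentation.toSubmodule h0)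
    · rcases h p.toSubmodule p.apply_mem_toSubmodule with h | h
      · exact Or.inl (Subrepresentation.toSubmodule_injective h)
      · exact Or.inr (Subrepresentation.toSubmodule_injective h)

/-- Schur's lemma. -/
theorem IsIrreducible.exists_eq_smul_id [FiniteDimensional ℂ V] {ρ : Representation ℂ G V}
    (h : ρ.IsIrreducible) {f : V →ₗ[ℂ] V} (hf : ∀ g v, f (ρ g v) = ρ g (f v)) :
    ∃ c : ℂ, f = c • LinearMap.id := by
  obtain ⟨hV, h⟩ := (isIrreducible_iff_forall_submodule ρ).1 h
  obtain ⟨c, hc⟩ := Module.End.exists_eigenvalue f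
  refine ⟨c, ?_⟩
  rcases h (Module.End.eigenspace f c) fun g v hv => by
    rw [Module.End.mem_eigenspace_iff] at hv ⊢
    rw [hf, hv, map_smul] with h | h
  · exact absurd h hc
  · ext v
    have : v ∈ Module.End.eigenspace f c := h ▸ Submodule.mem_top
    rw [Module.End.mem_eigenspace_iff] at this
    simpa using this

theorem isIrreducible_conj {W : Type*} [AddCommGroup W] [Module ℂ W] {ρ : Representation ℂ G V}
    (h : ρ.IsIrreducible) (φ : V ≃ₗ[ℂ] W) {σ : Representation ℂ G W}
    (hσ : ∀ g v, σ g (φ v) = φ (ρ g v)) : σ.IsIrreducible := by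
  rw [isIrreducible_iff_forall_submodule] at h ⊢
  obtain ⟨hV, h⟩ := h
  refine ⟨φ.symm.toEquiv.nontrivial, fun p hp => ?_⟩
  have := h (p.comap φ.toLinearMap) fun g v hv => by
    rw [Submodule.mem_comap] at hv ⊢
    have := hp g _ hv
    simpa [hσ] using this
  rcases this with h | h
  · left
    rw [eq_bot_iff]
    intro w hw
    have : φ.symm w ∈ p.comap φ.toLinearMap := by simpa using hw
    rw [h, Submodule.mem_bot] at this
    simpa using this
  · right
    rw [eq_top_iff]
    intro w _
    have : φ.symm w ∈ p.comap φ.toLinearMap := h ▸ Submodule.mem_top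
    simpa using this

theorem IsIrreducible.comp_surjective {H : Type*} [Group H] {ρ : Representation ℂ G V}
    (h : ρ.IsIrreducible) {π : H →* G} (hπ : Function.Surjective π) :
    (show Representation ℂ H V from MonoidHom.comp ρ π).IsIrreducible := by
  rw [isIrreducible_iff_forall_submodule] at h ⊢
  refine ⟨h.1, fun p hp => h.2 p fun g v hv => ?_⟩
  obtain ⟨x, rfl⟩ := hπ g
  exact hp x v hv

/-- A representation whose character has norm `1` is irreducible. -/
theorem isIrreducible_of_sum_eq_card [Fintype G] [FiniteDimensional ℂ V] [Nontrivial V]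
    (ρ : Representation ℂ G V)
    (h : ∑ g, ρ.character g * ρ.character g⁻¹ = Nat.card G) : ρ.IsIrreducible := by
  have hG : (Nat.card G : ℂ) ≠ 0 := Nat.cast_ne_zero.2 Nat.card_pos.ne'
  letI : Invertible (Nat.card G : ℂ) := invertibleOfNonzero hG
  haveI : NeZero (Nat.card G : ℂ) := ⟨hG⟩
  have h1 := card_inv_mul_sum_char_mul_char_eq_finrank ρ ρ
  rw [h, inv_mul_cancel₀ hG] at h1
  have h2 : Module.finrank ℂ (IntertwiningMap ρ ρ) = 1 := by exact_mod_cast h1.symm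
  let one : IntertwiningMap ρ ρ := ⟨LinearMap.id, fun g => rfl⟩
  have hone : one ≠ 0 := by
    intro h0
    obtain ⟨v, hv⟩ := exists_ne (0 : V)
    exact hv (congrArg (fun f : IntertwiningMap ρ ρ => f v) h0)
  rw [isIrreducible_iff_forall_submodule]
  refine ⟨inferInstance, fun p hp => ?_⟩
  obtain ⟨q, hq⟩ := exists_isCompl (⟨p, hp⟩ : Subrepresentation ρ)
  have hpq : IsCompl p q.toSubmodule := by
    constructor
    · rw [disjoint_iff]
      exact congrArg Subrepresentation.toSubmodule hq.inf_eq_bot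
    · rw [codisjoint_iff]
      exact congrArg Subrepresentation.toSubmodule hq.sup_eq_top
  -- the projection onto `p` along an invariant complement is an intertwiner, hence a scalar
  let π : V →ₗ[ℂ] V := p.subtype ∘ₗ p.projectionOnto q.toSubmodule hpq
  have hπp : ∀ v ∈ p, π v = v := fun v hv => by
    have := Submodule.projectionOnto_apply_left hpq ⟨v, hv⟩
    simp only [π, LinearMap.comp_apply]
    rw [this]; rfl
  have hπq : ∀ v ∈ q.toSubmodule, π v = 0 := fun v hv => by
    have := (Submodule.projectionOnto_apply_eq_zero_iff hpq (x := v)).2 hv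
    simp only [π, LinearMap.comp_apply]
    rw [this]; rfl
  have hcomm : ∀ g v, π (ρ g v) = ρ g (π v) := by
    intro g v
    obtain ⟨a, ha, b, hb, rfl⟩ := Submodule.mem_sup.1
      ((hpq.sup_eq_top ▸ Submodule.mem_top : v ∈ p ⊔ q.toSubmodule))
    rw [map_add, map_add, map_add, hπp a ha, hπq b hb, hπp _ (hp g a ha),
      hπq _ (q.apply_mem_toSubmodule g hb), add_zero, add_zero]
  obtain ⟨c, hc⟩ := (finrank_eq_one_iff_of_nonzero' one hone).1 h2 ⟨π, fun g => by
    ext v; exact hcomm g v⟩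
  have hc' : ∀ v, c • v = π v := fun v => congrArg (fun f : IntertwiningMap ρ ρ => f v) hc
  by_cases h0 : c = 0
  · left
    rw [eq_bot_iff]
    intro v hv
    rw [Submodule.mem_bot, ← hπp v hv, ← hc', h0, zero_smul]
  · right
    rw [eq_top_iff]
    intro v _
    have : c⁻¹ • π v ∈ p := p.smul_mem _ (p.projectionOnto q.toSubmodule hpq v).2
    rwa [← hc', smul_smul, inv_mul_cancel₀ h0, one_smul] at this

theorem character_mem_irrChar [FiniteDimensional ℂ V] {ρ : Representation ℂ G V}
    (h : ρ.IsIrreducible) : ρ.character ∈ IrrChar G := by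
  let φ : V ≃ₗ[ℂ] (Fin (Module.finrank ℂ V) → ℂ) := (Module.finBasis ℂ V).equivFun
  let σ : Representation ℂ G (Fin (Module.finrank ℂ V) → ℂ) :=
    { toFun := fun g => φ.conj (ρ g)
      map_one' := by rw [map_one]; exact φ.conj_id
      map_mul' := fun g h => by rw [map_mul]; exact φ.conj_comp _ _ }
  have hσ : ∀ g v, σ g (φ v) = φ (ρ g v) := fun g v => by
    simp [σ, LinearEquiv.conj_apply]
  refine ⟨_, σ, isIrreducible_conj h φ hσ, ?_⟩
  funext g
  exact LinearMap.trace_conj' (ρ g) φ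

end Representation

open Representation

variable {G : Type*} [Group G]

theorem IrrChar.comp_surjective {H : Type*} [Group H] {χ : G → ℂ} (h : χ ∈ IrrChar G)
    {π : H →* G} (hπ : Function.Surjective π) : χ ∘ π ∈ IrrChar H := by
  obtain ⟨n, ρ, hρ, rfl⟩ := h
  exact ⟨n, _, hρ.comp_surjective hπ, rfl⟩

theorem IrrChar.conj {χ : G → ℂ} (h : χ ∈ IrrChar G) (g x : G) : χ (x⁻¹ * g * x) = χ g := by
  obtain ⟨n, ρ, hρ, rfl⟩ := h
  simpa using ρ.char_conj g x⁻¹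

theorem IrrChar.one_ne_zero {χ : G → ℂ} (h : χ ∈ IrrChar G) : χ 1 ≠ 0 := by
  obtain ⟨n, ρ, hρ, rfl⟩ := h
  rw [ρ.char_one]
  have := ((isIrreducible_iff_forall_submodule ρ).1 hρ).1
  exact Nat.cast_ne_zero.2 (Module.finrank_pos).ne'

open Classical in
/-- Orthogonality of irreducible characters. -/
theorem IrrChar.sum_mul_inv [Fintype G] {χ ψ : G → ℂ} (hχ : χ ∈ IrrChar G) (hψ : ψ ∈ IrrChar G) :
    ∑ g, χ g * ψ g⁻¹ = if χ = ψ then (Nat.card G : ℂ) else 0 := by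
  obtain ⟨n, ρ, hρ, rfl⟩ := hχ
  obtain ⟨m, σ, hσ, rfl⟩ := hψ
  have hG : (Nat.card G : ℂ) ≠ 0 := Nat.cast_ne_zero.2 Nat.card_pos.ne'
  letI : Invertible (Nat.card G : ℂ) := invertibleOfNonzero hG
  have key : ∀ {n m : ℕ} (ρ : Representation ℂ G (Fin n → ℂ)) (σ : Representation ℂ G (Fin m → ℂ)),
      ρ.IsIrreducible → σ.IsIrreducible → ∑ g, ρ.character g * σ.character g⁻¹ =
        if Nonempty (Equiv σ ρ) then (Nat.card G : ℂ) else 0 := by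
    intro n m ρ σ hρ hσ
    have := char_orthonormal ρ σ
    rw [inv_mul_eq_iff_eq_mul₀ hG] at this
    rw [this]
    split_ifs <;> simp
  rw [key ρ σ hρ hσ]
  by_cases hE : Nonempty (Equiv σ ρ)
  · rw [if_pos hE, if_pos]
    exact (char_iso hE.some).symm
  · rw [if_neg hE, if_neg]
    intro heq
    have h1 := key ρ σ hρ hσ
    have h2 := key ρ ρ hρ hρ
    rw [if_neg hE, ← heq] at h1
    rw [if_pos ⟨Representation.Equiv.refl ρ⟩, h1] at h2
    exact hG h2.symm

/-- A linear character is irreducible. -/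
theorem irrChar_of_monoidHom (θ : G →* ℂˣ) : (fun g => (θ g : ℂ)) ∈ IrrChar G := by
  let ρ : Representation ℂ G ℂ :=
    { toFun := fun g => (θ g : ℂ) • LinearMap.id
      map_one' := by rw [map_one, Units.val_one, one_smul]; rfl
      map_mul' := fun g h => by
        ext
        simp [mul_comm] }
  have h : ρ.IsIrreducible := by
    rw [isIrreducible_iff_forall_submodule]
    exact ⟨inferInstance, fun p _ => eq_bot_or_eq_top p⟩
  have h2 := character_mem_irrChar h
  convert h2 using 1
  funext g
  simp [Representation.character, ρ]

/-- A subgroup that acts by operators commuting with an irreducible representation acts by a linear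
character. -/
theorem Representation.IsIrreducible.exists_scalar {V : Type*} [AddCommGroup V] [Module ℂ V]
    [FiniteDimensional ℂ V] {ρ : Representation ℂ G V} (h : ρ.IsIrreducible) (S : Subgroup G)
    (hS : ∀ s ∈ S, ∀ g, ρ (s * g) = ρ (g * s)) :
    ∃ μ : S →* ℂˣ, ∀ s : S, ρ s = (μ s : ℂ) • LinearMap.id := by
  have hV := ((isIrreducible_iff_forall_submodule ρ).1 h).1
  have h1 : ∀ s : S, ∃ c : ℂ, ρ s = c • LinearMap.id := fun s =>
    h.exists_eq_smul_id fun g v => by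
      have := LinearMap.congr_fun (hS s s.2 g) v
      simpa using this
  choose c hc using h1
  have hinj : ∀ a b : ℂ, a • (LinearMap.id : V →ₗ[ℂ] V) = b • LinearMap.id → a = b := by
    intro a b hab
    obtain ⟨v, hv⟩ := exists_ne (0 : V)
    have := LinearMap.congr_fun hab v
    exact smul_left_injective ℂ hv (by simpa using this)
  let f : S →* ℂ :=
    { toFun := c
      map_one' := hinj _ _ (by rw [← hc, one_smul, Subgroup.coe_one, map_one]; rfl)
      map_mul' := fun a b => hinj _ _ (by
        rw [← hc, Subgroup.coe_mul, map_mul, hc, hc]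
        rw [mul_smul, ← Module.End.one_eq_id, smul_mul_smul_comm, one_mul, mul_smul]) }
  exact ⟨f.toHomUnits, fun s => hc s⟩

/-- The central character of an irreducible character. -/
theorem IrrChar.exists_central {χ : G → ℂ} (h : χ ∈ IrrChar G) :
    ∃ c : Subgroup.center G →* ℂˣ, ∀ z : Subgroup.center G, χ z = χ 1 * c z := by
  obtain ⟨n, ρ, hρ, rfl⟩ := h
  obtain ⟨c, hc⟩ := Representation.IsIrreducible.exists_scalar hρ (Subgroup.center G)
    fun s hs g => by rw [Subgroup.mem_center_iff.1 hs g]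
  refine ⟨c, fun z => ?_⟩
  rw [Representation.character, hc, map_smul, LinearMap.trace_id, Representation.char_one,
    smul_eq_mul, mul_comm]

/-! ### Induced characters -/

open Representation

section induced

variable {G : Type*} [Group G]

open Classical in
theorem induce_eq_sum [Fintype G] (H : Subgroup G) (ψ : H → ℂ) (g : G) :
    induce H ψ g = (Nat.card H : ℂ)⁻¹ *
      ∑ x : G, if h : x⁻¹ * g * x ∈ H then ψ ⟨x⁻¹ * g * x, h⟩ else 0 := by
  rw [induce, finsum_eq_sum_of_fintype]

/-- The trace of an endomorphism of a space of functions is the sum of the traces of its diagonal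
blocks. -/
theorem trace_pi_eq_sum {ι V : Type*} [Fintype ι] [DecidableEq ι] [AddCommGroup V] [Module ℂ V]
    [FiniteDimensional ℂ V] (f : (ι → V) →ₗ[ℂ] (ι → V)) :
    LinearMap.trace ℂ (ι → V) f =
      ∑ i, LinearMap.trace ℂ V (LinearMap.proj i ∘ₗ f ∘ₗ LinearMap.single ℂ (fun _ => V) i) := by
  have h : f = ∑ i, (f ∘ₗ LinearMap.single ℂ (fun _ => V) i) ∘ₗ LinearMap.proj i := by
    refine LinearMap.ext fun x => ?_
    simp only [LinearMap.sum_apply, LinearMap.comp_apply, LinearMap.proj_apply,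
      LinearMap.coe_single]
    rw [← map_sum, Finset.univ_sum_single]
  conv_lhs => rw [h]
  rw [map_sum]
  refine Finset.sum_congr rfl fun i _ => ?_
  exact LinearMap.trace_comp_comm' _ _

/-- The trace of the restriction of `T` to an invariant subspace, by means of a projection onto the
subspace. -/
theorem trace_restrict_eq_trace_comp {M : Type*} [AddCommGroup M] [Module ℂ M]
    [FiniteDimensional ℂ M] {p : Submodule ℂ M} (P : M →ₗ[ℂ] p) (hP : ∀ v : p, P v = v)
    (T : M →ₗ[ℂ] M) (hT : ∀ v ∈ p, T v ∈ p) :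
    LinearMap.trace ℂ p (T.restrict hT) = LinearMap.trace ℂ M (T ∘ₗ p.subtype ∘ₗ P) := by
  have h1 : T.restrict hT = P ∘ₗ (T ∘ₗ p.subtype) := by
    refine LinearMap.ext fun v => ?_
    have := hP ⟨T v, hT v v.2⟩
    exact this.symm
  rw [h1, LinearMap.trace_comp_comm', LinearMap.comp_assoc]

open Classical in
/-- The projection onto the space of the coinduced representation, by averaging. -/
def coindProj [Fintype G] {N : Subgroup G} {V : Type*} [AddCommGroup V] [Module ℂ V]
    (ρ : Representation ℂ N V) : (G → V) →ₗ[ℂ] coindV N.subtype ρ where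
  toFun f := ⟨fun h => (Nat.card N : ℂ)⁻¹ • ∑ n : N, ρ n⁻¹ (f (n * h)), by
    intro m h
    simp only [Subgroup.coe_subtype, map_smul, map_sum]
    congr 1
    refine Fintype.sum_equiv (Equiv.mulRight m) _ _ fun n => ?_
    rw [← Module.End.mul_apply, ← map_mul]
    simp [mul_assoc]⟩
  map_add' f f' := by
    ext h
    simp [Finset.sum_add_distrib]
  map_smul' c f := by
    ext h
    simp only [Pi.smul_apply, map_smul, ← Finset.smul_sum, RingHom.id_apply, Submodule.coe_smul]
    rw [smul_comm]

theorem coindProj_apply_coe [Fintype G] {N : Subgroup G} {V : Type*} [AddCommGroup V] [Module ℂ V]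
    (ρ : Representation ℂ N V) (f : coindV N.subtype ρ) : coindProj ρ f = f := by
  classical
  ext h
  have hN : (Nat.card N : ℂ) ≠ 0 := Nat.cast_ne_zero.2 Nat.card_pos.ne'
  have hf : ∀ n : N, ρ n⁻¹ ((f : G → V) (n * h)) = (f : G → V) h := by
    intro n
    have := f.2 n h
    simp only [Subgroup.coe_subtype] at this
    rw [this, ← Module.End.mul_apply, ← map_mul]
    simp
  simp only [coindProj, LinearMap.coe_mk, AddHom.coe_mk, hf]
  rw [Finset.sum_const, Finset.card_univ, ← Nat.cast_smul_eq_nsmul ℂ, smul_smul,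
    ← Nat.card_eq_fintype_card, inv_mul_cancel₀ hN, one_smul]

/-- The character of an induced representation. -/
theorem character_coind [Finite G] {N : Subgroup G} {V : Type*} [AddCommGroup V] [Module ℂ V]
    [FiniteDimensional ℂ V] (ρ : Representation ℂ N V) :
    (coind N.subtype ρ).character = induce N ρ.character := by
  classical
  have := Fintype.ofFinite G
  funext g
  rw [induce_eq_sum]
  let T : (G → V) →ₗ[ℂ] (G → V) := LinearMap.funLeft ℂ V (· * g)
  have hT : ∀ f ∈ coindV N.subtype ρ, T f ∈ coindV N.subtype ρ := fun f hf =>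
    ((coind N.subtype ρ) g ⟨f, hf⟩).2
  have h1 : (coind N.subtype ρ).character g = LinearMap.trace ℂ _ (T.restrict hT) := rfl
  rw [h1, trace_restrict_eq_trace_comp (coindProj ρ) (coindProj_apply_coe ρ), trace_pi_eq_sum,
    Finset.mul_sum]
  refine Fintype.sum_equiv (Equiv.inv G) _ _ fun x => ?_
  have h2 : LinearMap.proj x ∘ₗ (T ∘ₗ (coindV N.subtype ρ).subtype ∘ₗ coindProj ρ) ∘ₗ
      LinearMap.single ℂ (fun _ => V) x =
      (Nat.card N : ℂ)⁻¹ • if h : x * g * x⁻¹ ∈ N then ρ ⟨x * g * x⁻¹, h⟩ else 0 := by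
    refine LinearMap.ext fun v => ?_
    simp only [T, coindProj, LinearMap.comp_apply, LinearMap.proj_apply, LinearMap.coe_single,
      LinearMap.coe_mk, AddHom.coe_mk, Submodule.subtype_apply, LinearMap.funLeft_apply,
      LinearMap.smul_apply]
    congr 1
    -- only `n = x g⁻¹ x⁻¹` contributes to the diagonal block at `x`
    have h3 : ∀ n : N, (n : G) * (x * g) = x ↔ ((n⁻¹ : N) : G) = x * g * x⁻¹ := by
      intro n
      rw [Subgroup.coe_inv, inv_eq_iff_mul_eq_one, ← mul_inv_eq_one (b := x)]
      simp only [mul_assoc]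
    by_cases h : x * g * x⁻¹ ∈ N
    · rw [dif_pos h, Finset.sum_eq_single (⟨x * g * x⁻¹, h⟩⁻¹ : N)]
      · rw [(h3 _).2 (by rw [inv_inv]), Pi.single_eq_same, inv_inv]
      · intro n _ hn
        rw [Pi.single_eq_of_ne, map_zero]
        intro h4
        refine hn (inv_injective ?_)
        rw [inv_inv]
        exact Subtype.ext ((h3 n).1 h4)
      · simp
    · rw [dif_neg h]
      refine Finset.sum_eq_zero fun n _ => ?_
      rw [Pi.single_eq_of_ne, map_zero]
      intro h4
      exact h ((h3 n).1 h4 ▸ (n⁻¹).2)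
  rw [h2, map_smul, smul_eq_mul]
  congr 1
  simp only [Equiv.inv_apply, inv_inv]
  split_ifs
  · rfl
  · exact map_zero _

variable {N : Subgroup G}

/-- The conjugate of a function on a normal subgroup. -/
def conjFun (hN : N.Normal) (χ : N → ℂ) (g : G) (n : N) : ℂ :=
  χ ⟨g⁻¹ * n * g, by simpa using hN.conj_mem n n.2 g⁻¹⟩

theorem conjFun_mem_irrChar (hN : N.Normal) {χ : N → ℂ} (h : χ ∈ IrrChar N) (g : G) :
    conjFun hN χ g ∈ IrrChar N :=
  IrrChar.comp_surjective h (π := (MulAut.conjNormal g⁻¹ : MulAut N).toMonoidHom) (by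
    exact (MulAut.conjNormal g⁻¹ : MulAut N).surjective) |> fun h => by
    convert h using 1
    funext n
    simp only [conjFun, Function.comp_apply]
    congr 1
    apply Subtype.ext
    simp

open Classical in
theorem induce_of_normal [Fintype G] (hN : N.Normal) (χ : N → ℂ) (n : N) :
    induce N χ n = (Nat.card N : ℂ)⁻¹ * ∑ x : G, conjFun hN χ x n := by
  rw [induce_eq_sum]
  congr 1
  refine Finset.sum_congr rfl fun x _ => ?_
  rw [dif_pos (by simpa using hN.conj_mem n n.2 x⁻¹)]
  rfl

theorem induce_of_notMem [Finite G] (hN : N.Normal) (χ : N → ℂ) {g : G} (hg : g ∉ N) :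
    induce N χ g = 0 := by
  classical
  have := Fintype.ofFinite G
  rw [induce_eq_sum, Finset.sum_eq_zero, mul_zero]
  intro x _
  rw [dif_neg]
  intro h
  refine hg ?_
  have := hN.conj_mem _ h x
  simpa [mul_assoc] using this

theorem conjFun_conjFun (hN : N.Normal) (χ : N → ℂ) (y z : G) :
    conjFun hN (conjFun hN χ z) y = conjFun hN χ (y * z) := by
  funext n
  simp only [conjFun, mul_inv_rev, mul_assoc]

theorem conjFun_one (hN : N.Normal) (χ : N → ℂ) : conjFun hN χ 1 = χ := by
  funext n
  simp [conjFun]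

theorem conjFun_of_mem (hN : N.Normal) {χ : N → ℂ} (h : χ ∈ IrrChar N) {g : G} (hg : g ∈ N) :
    conjFun hN χ g = χ := by
  funext n
  exact IrrChar.conj h n ⟨g, hg⟩

/-- Conjugates of `χ` and `ψ` coincide only for elements of the same coset, if no element outside
the normal subgroup conjugates `χ` into `ψ`. -/
theorem conjFun_eq_iff (hN : N.Normal) {χ ψ : N → ℂ} (hχ : χ ∈ IrrChar N)
    (h : ∀ g ∉ N, conjFun hN χ g ≠ ψ) (x y : G) :
    conjFun hN χ x = conjFun hN ψ y ↔ y⁻¹ * x ∈ N ∧ χ = ψ := by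
  constructor
  · intro heq
    have h1 : conjFun hN χ (y⁻¹ * x) = ψ := by
      rw [← conjFun_conjFun, heq, conjFun_conjFun, inv_mul_cancel, conjFun_one]
    have h2 : y⁻¹ * x ∈ N := by
      by_contra h2
      exact h _ h2 h1
    exact ⟨h2, by rw [← h1, conjFun_of_mem hN hχ h2]⟩
  · rintro ⟨h1, rfl⟩
    have := conjFun_conjFun hN χ y (y⁻¹ * x)
    rw [conjFun_of_mem hN hχ h1, mul_inv_cancel_left] at this
    exact this.symm

open Classical in
/-- The inner product of two characters induced from a normal subgroup, when no conjugate of the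
one by an element outside the subgroup equals the other. -/
theorem sum_induce_mul_induce_inv [Fintype G] (hN : N.Normal) {χ ψ : N → ℂ} (hχ : χ ∈ IrrChar N)
    (hψ : ψ ∈ IrrChar N) (h : ∀ g ∉ N, conjFun hN χ g ≠ ψ) :
    ∑ g, induce N χ g * induce N ψ g⁻¹ = if χ = ψ then (Nat.card G : ℂ) else 0 := by
  have hc : (Nat.card N : ℂ) ≠ 0 := Nat.cast_ne_zero.2 Nat.card_pos.ne'
  have h1 : ∑ g, induce N χ g * induce N ψ g⁻¹ =
      ∑ n : N, induce N χ n * induce N ψ (n⁻¹ : N) := by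
    rw [← Finset.sum_filter_of_ne (p := (· ∈ N)), Finset.sum_subtype _ (p := (· ∈ N)) (by simp)]
    · rfl
    · intro g _ hg
      by_contra hgN
      rw [induce_of_notMem hN χ hgN, zero_mul] at hg
      exact hg rfl
  have h2 : ∀ x y : G, ∑ n : N, conjFun hN χ x n * conjFun hN ψ y n⁻¹ =
      if y⁻¹ * x ∈ N then (if χ = ψ then (Nat.card N : ℂ) else 0) else 0 := by
    intro x y
    rw [IrrChar.sum_mul_inv (conjFun_mem_irrChar hN hχ x) (conjFun_mem_irrChar hN hψ y)]
    simp only [conjFun_eq_iff hN hχ h, ite_and]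
  have h3 : ∀ y : G, ∑ x : G, (if y⁻¹ * x ∈ N then (if χ = ψ then (Nat.card N : ℂ) else 0) else 0) =
      Nat.card N * if χ = ψ then (Nat.card N : ℂ) else 0 := by
    intro y
    rw [← Equiv.sum_comp (Equiv.mulLeft y)]
    simp only [Equiv.coe_mulLeft, inv_mul_cancel_left]
    rw [← Finset.sum_filter, Finset.sum_const, nsmul_eq_mul, Nat.card_eq_fintype_card,
      Fintype.card_subtype]
  rw [h1]
  calc ∑ n : N, induce N χ n * induce N ψ (n⁻¹ : N)
      = ∑ n : N, ((Nat.card N : ℂ)⁻¹ * (Nat.card N : ℂ)⁻¹) *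
          ∑ y : G, ∑ x : G, conjFun hN χ x n * conjFun hN ψ y n⁻¹ := by
        refine Finset.sum_congr rfl fun n _ => ?_
        rw [induce_of_normal hN, induce_of_normal hN, mul_mul_mul_comm, Finset.sum_mul_sum,
          Finset.sum_comm]
    _ = ((Nat.card N : ℂ)⁻¹ * (Nat.card N : ℂ)⁻¹) *
          ∑ y : G, ∑ x : G, ∑ n : N, conjFun hN χ x n * conjFun hN ψ y n⁻¹ := by
        rw [← Finset.mul_sum, Finset.sum_comm]
        congr 1
        exact Finset.sum_congr rfl fun y _ => Finset.sum_comm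
    _ = if χ = ψ then (Nat.card G : ℂ) else 0 := by
        simp only [h2, h3, Finset.sum_const, Finset.card_univ, nsmul_eq_mul,
          ← Nat.card_eq_fintype_card]
        split_ifs
        · field_simp
        · simp

theorem induce_one_of_normal [Finite G] (hN : N.Normal) (χ : N → ℂ) :
    induce N χ 1 = N.index * χ 1 := by
  classical
  have := Fintype.ofFinite G
  have hc : (Nat.card N : ℂ) ≠ 0 := Nat.cast_ne_zero.2 Nat.card_pos.ne'
  have h := induce_of_normal hN χ 1
  rw [Subgroup.coe_one] at h
  have h1 : ∀ x, conjFun hN χ x 1 = χ 1 := by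
    intro x
    simp only [conjFun]
    congr 1
    exact Subtype.ext (by simp)
  simp only [h1, Finset.sum_const, Finset.card_univ, nsmul_eq_mul, ← Nat.card_eq_fintype_card] at h
  rw [h, ← N.card_mul_index]
  push_cast
  field_simp

/-- An irreducible character of a normal subgroup that is fixed by no element outside the subgroup
induces to an irreducible character. -/
theorem induce_mem_irrChar [Finite G] (hN : N.Normal) {χ : N → ℂ} (hχ : χ ∈ IrrChar N)
    (h : ∀ g ∉ N, conjFun hN χ g ≠ χ) : induce N χ ∈ IrrChar G := by
  classical
  have := Fintype.ofFinite G
  have h1 := sum_induce_mul_induce_inv hN hχ hχ h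
  have h2 := induce_one_of_normal hN χ
  have h3 := IrrChar.one_ne_zero hχ
  obtain ⟨n, ρ, hρ, rfl⟩ := hχ
  rw [← character_coind] at h1 h2 ⊢
  have : Nontrivial (coindV N.subtype ρ) := by
    rw [← Module.finrank_pos_iff (R := ℂ), Nat.pos_iff_ne_zero]
    intro h0
    rw [char_one, h0, Nat.cast_zero, eq_comm, mul_eq_zero] at h2
    rcases h2 with h2 | h2
    · exact Subgroup.index_ne_zero_of_finite (by exact_mod_cast h2)
    · exact h3 h2
  refine character_mem_irrChar (isIrreducible_of_sum_eq_card _ ?_)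
  rw [h1, if_pos rfl]

/-- Characters with the same induced character are equal, if they are not conjugate under an element
outside the normal subgroup. -/
theorem induce_injective [Finite G] (hN : N.Normal) {χ ψ : N → ℂ} (hχ : χ ∈ IrrChar N)
    (hψ : ψ ∈ IrrChar N) (h : ∀ g ∉ N, conjFun hN χ g ≠ ψ) (h' : ∀ g ∉ N, conjFun hN ψ g ≠ ψ)
    (heq : induce N χ = induce N ψ) : χ = ψ := by
  classical
  have := Fintype.ofFinite G
  by_contra hne
  have h1 := sum_induce_mul_induce_inv hN hχ hψ h
  have h2 := sum_induce_mul_induce_inv hN hψ hψ h'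
  rw [if_neg hne, heq] at h1
  rw [if_pos rfl, h1] at h2
  exact Nat.cast_ne_zero.2 Nat.card_pos.ne' h2.symm

end induced

/-! ### Characters of groups of Heisenberg type -/

open Representation

namespace HeisenbergData

variable {V W U G : Type*} [AddCommGroup V] [AddCommGroup W] [AddCommGroup U] [Group G]
  (D : HeisenbergData V W U G)

theorem X_zero : D.X 0 = 1 := by
  have := D.X_add 0 0
  rwa [add_zero, eq_comm, mul_eq_left] at this

theorem Y_zero : D.Y 0 = 1 := by
  have := D.Y_add 0 0
  rwa [add_zero, eq_comm, mul_eq_left] at this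

theorem Z_zero : D.Z 0 = 1 := by
  have := D.Z_add 0 0
  rwa [add_zero, eq_comm, mul_eq_left] at this

theorem mul_form (v w u v' w' u') :
    D.X v * D.Y w * D.Z u * (D.X v' * D.Y w' * D.Z u') =
      D.X (v + v') * D.Y (w + w') * D.Z (u + u' + D.B v' w) :=
  mul_of_comm_of_central D.X_add D.Y_add D.Z_add D.comm D.central v w u v' w' u'

/-- Conjugation by `X v₂` multiplies by the central element `Z (B v₂ w)`. -/
theorem X_conj (v₂ v w u) : (D.X v₂)⁻¹ * (D.X v * D.Y w * D.Z u) * D.X v₂ =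
    D.X v * D.Y w * D.Z u * D.Z (D.B v₂ w) := by
  rw [mul_assoc, inv_mul_eq_iff_eq_mul]
  calc D.X v * D.Y w * D.Z u * D.X v₂ = D.X v * (D.Y w * D.X v₂) * D.Z u := by
        rw [mul_assoc, D.central]; group
    _ = (D.X v * D.X v₂) * D.Y w * (D.Z (D.B v₂ w) * D.Z u) := by rw [D.comm]; group
    _ = (D.X v₂ * D.X v) * D.Y w * (D.Z u * D.Z (D.B v₂ w)) := by
        rw [D.central, ← D.X_add, ← D.X_add, add_comm]
    _ = D.X v₂ * (D.X v * D.Y w * D.Z u * D.Z (D.B v₂ w)) := by group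

/-- Conjugation by `Y w₂` multiplies by the central element `Z (B v w₂)`. -/
theorem Y_conj (w₂ v w u) : D.Y w₂ * (D.X v * D.Y w * D.Z u) * (D.Y w₂)⁻¹ =
    D.X v * D.Y w * D.Z u * D.Z (D.B v w₂) := by
  rw [mul_inv_eq_iff_eq_mul]
  calc D.Y w₂ * (D.X v * D.Y w * D.Z u) = (D.Y w₂ * D.X v) * D.Y w * D.Z u := by group
    _ = D.X v * D.Y w₂ * (D.Z (D.B v w₂) * (D.Y w * D.Z u)) := by rw [D.comm]; group
    _ = D.X v * (D.Y w₂ * D.Y w) * (D.Z u * D.Z (D.B v w₂)) := by rw [D.central]; group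
    _ = D.X v * (D.Y w * D.Y w₂) * (D.Z u * D.Z (D.B v w₂)) := by
        rw [← D.Y_add, ← D.Y_add, add_comm]
    _ = D.X v * D.Y w * (D.Y w₂ * (D.Z u * D.Z (D.B v w₂))) := by group
    _ = D.X v * D.Y w * D.Z u * D.Z (D.B v w₂) * D.Y w₂ := by
        rw [← D.Z_add, ← D.central, D.Z_add]; group

theorem X_eq (v : V) : D.X v = D.X v * D.Y 0 * D.Z 0 := by
  rw [D.Y_zero, D.Z_zero, mul_one, mul_one]

theorem Y_eq (w : W) : D.Y w = D.X 0 * D.Y w * D.Z 0 := by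
  rw [D.X_zero, D.Z_zero, one_mul, mul_one]

theorem Z_eq (u : U) : D.Z u = D.X 0 * D.Y 0 * D.Z u := by
  rw [D.X_zero, D.Y_zero, one_mul, one_mul]

theorem one_eq : (1 : G) = D.X 0 * D.Y 0 * D.Z 0 := by
  rw [D.X_zero, D.Y_zero, D.Z_zero, one_mul, one_mul]

/-- The pairing `B` is additive, because it is determined by the commutators. -/
theorem B_add_left (v v' w) : D.B (v + v') w = D.B v w + D.B v' w := by
  have h1 : D.Y w * D.X (v + v') = D.X (v + v') * D.Y w * D.Z (D.B v w + D.B v' w) := by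
    rw [D.X_add, D.Z_add, ← mul_assoc, D.comm, mul_assoc (D.X v * D.Y w), D.central,
      ← mul_assoc, mul_assoc (D.X v), D.comm, D.central (D.B v w)]
    group
  rw [D.comm] at h1
  exact (D.inj _ _ _ _ _ _ h1).2.2

theorem B_add_right (v w w') : D.B v (w + w') = D.B v w + D.B v w' := by
  have h1 : D.Y (w + w') * D.X v = D.X v * D.Y (w + w') * D.Z (D.B v w + D.B v w') := by
    rw [D.Y_add, D.Z_add, mul_assoc (D.Y w), D.comm, ← mul_assoc, ← mul_assoc, D.comm,
      mul_assoc (D.X v * D.Y w), D.central]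
    group
  rw [D.comm] at h1
  exact (D.inj _ _ _ _ _ _ h1).2.2

/-- The coordinates on a group of Heisenberg type. -/
def coordEquiv : V × W × U ≃ G :=
  Equiv.ofBijective (fun p => D.X p.1 * D.Y p.2.1 * D.Z p.2.2)
    ⟨fun p p' h => by
      obtain ⟨h1, h2, h3⟩ := D.inj _ _ _ _ _ _ h
      exact Prod.ext h1 (Prod.ext h2 h3), fun g => by
      obtain ⟨v, w, u, rfl⟩ := D.surj g
      exact ⟨(v, w, u), rfl⟩⟩

theorem coordEquiv_apply (v : V) (w : W) (u : U) :
    D.coordEquiv (v, w, u) = D.X v * D.Y w * D.Z u := rfl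

theorem coordEquiv_symm (v : V) (w : W) (u : U) :
    D.coordEquiv.symm (D.X v * D.Y w * D.Z u) = (v, w, u) :=
  D.coordEquiv.symm_apply_apply (v, w, u)

theorem card_eq (D : HeisenbergData V W U G) :
    Nat.card G = Nat.card V * Nat.card W * Nat.card U := by
  rw [← Nat.card_congr D.coordEquiv, Nat.card_prod, Nat.card_prod, mul_assoc]

/-- The homomorphism `Y`, in multiplicative notation. -/
def YHom : Multiplicative W →* G where
  toFun w := D.Y w.toAdd
  map_one' := D.Y_zero
  map_mul' _ _ := D.Y_add _ _

theorem X_injective : Function.Injective D.X := fun v v' h => by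
  rw [D.X_eq v, D.X_eq v'] at h
  exact (D.inj _ _ _ _ _ _ h).1

theorem Y_injective : Function.Injective D.Y := fun v v' h => by
  rw [D.Y_eq v, D.Y_eq v'] at h
  exact (D.inj _ _ _ _ _ _ h).2.1

/-- The homomorphism from `U` to the center. -/
def ZHom : Multiplicative U →* Subgroup.center G where
  toFun u := ⟨D.Z u.toAdd, Subgroup.mem_center_iff.2 fun g => (D.central _ g).symm⟩
  map_one' := Subtype.ext D.Z_zero
  map_mul' _ _ := Subtype.ext (D.Z_add _ _)

/-- The central character of an irreducible character, as a character of `U`. -/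
theorem exists_centralChar {χ : G → ℂ} (hχ : χ ∈ IrrChar G) :
    ∃ c : AddChar U ℂ, ∀ u, χ (D.Z u) = χ 1 * c u := by
  obtain ⟨c, hc⟩ := IrrChar.exists_central hχ
  refine ⟨AddChar.toMonoidHomEquiv.symm ((Units.coeHom ℂ).comp (c.comp D.ZHom)), fun u => ?_⟩
  exact hc (D.ZHom (Multiplicative.ofAdd u))

/-- The additive character `v ↦ ψ (B v w)`. -/
def leftChar (ψ : AddChar U ℂ) (w : W) : AddChar V ℂ where
  toFun v := ψ (D.B v w)
  map_zero_eq_one' := by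
    have h := D.B_add_left 0 0 w
    rw [add_zero, eq_comm, add_eq_left] at h
    rw [h, AddChar.map_zero_eq_one]
  map_add_eq_mul' v v' := by rw [B_add_left, AddChar.map_add_eq_mul]

/-- The additive character `w ↦ ψ (B v w)`. -/
def rightChar (ψ : AddChar U ℂ) (v : V) : AddChar W ℂ where
  toFun w := ψ (D.B v w)
  map_zero_eq_one' := by
    have h := D.B_add_right v 0 0
    rw [add_zero, eq_comm, add_eq_left] at h
    rw [h, AddChar.map_zero_eq_one]
  map_add_eq_mul' v v' := by rw [B_add_right, AddChar.map_add_eq_mul]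

theorem leftChar_apply (ψ : AddChar U ℂ) (v : V) (w : W) : D.leftChar ψ w v = ψ (D.B v w) := rfl

theorem rightChar_apply (ψ : AddChar U ℂ) (v : V) (w : W) : D.rightChar ψ v w = ψ (D.B v w) := rfl

/-- For a character `ψ` of the central subgroup, the left radical `X1` and the right radical `Y1`
of the pairing `(v, w) ↦ ψ (B v w)`, and the stabilizer `H`, the product of `X1` with the
images of `Y` and `Z`. -/
structure Radicals (ψ : AddChar U ℂ) where
  (X1 Y1 H : Subgroup G)
  X_mem : ∀ v, D.X v ∈ X1 ↔ ∀ w, ψ (D.B v w) = 1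
  Y_mem : ∀ w, D.Y w ∈ Y1 ↔ ∀ v, ψ (D.B v w) = 1
  exists_X : ∀ g ∈ X1, ∃ v, g = D.X v
  exists_Y : ∀ g ∈ Y1, ∃ w, g = D.Y w
  mem_H : ∀ v w u, D.X v * D.Y w * D.Z u ∈ H ↔ ∀ w', ψ (D.B v w') = 1

namespace Radicals

variable {D} {ψ : AddChar U ℂ} (R : D.Radicals ψ)

theorem mem_H_iff (v w u) : D.X v * D.Y w * D.Z u ∈ R.H ↔ D.X v ∈ R.X1 := by
  rw [R.mem_H, R.X_mem]

theorem X_mem_H {v : V} (hv : D.X v ∈ R.X1) : D.X v ∈ R.H := by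
  rw [D.X_eq, R.mem_H_iff]; exact hv

theorem Y_mem_H (w : W) : D.Y w ∈ R.H := by
  rw [D.Y_eq, R.mem_H_iff, D.X_zero]; exact one_mem _

theorem Z_mem_H (u : U) : D.Z u ∈ R.H := by
  rw [D.Z_eq, R.mem_H_iff, D.X_zero]; exact one_mem _

theorem X_add_mem {v v' : V} (hv : D.X v ∈ R.X1) (hv' : D.X v' ∈ R.X1) : D.X (v + v') ∈ R.X1 := by
  rw [D.X_add]; exact mul_mem hv hv'

/-- The subgroup `X1` in the coordinates of `V`. -/
def xEquiv : {v // D.X v ∈ R.X1} ≃ R.X1 :=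
  Equiv.ofBijective (fun v => ⟨D.X v, v.2⟩) ⟨fun v v' h => Subtype.ext (D.X_injective (by
    exact congrArg Subtype.val h)), fun g => by
    obtain ⟨v, hv⟩ := R.exists_X g g.2
    exact ⟨⟨v, hv ▸ g.2⟩, Subtype.ext hv.symm⟩⟩

/-- The subgroup `Y1` in the coordinates of `W`. -/
def yEquiv : {w // D.Y w ∈ R.Y1} ≃ R.Y1 :=
  Equiv.ofBijective (fun v => ⟨D.Y v, v.2⟩) ⟨fun v v' h => Subtype.ext (D.Y_injective (by
    exact congrArg Subtype.val h)), fun g => by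
    obtain ⟨v, hv⟩ := R.exists_Y g g.2
    exact ⟨⟨v, hv ▸ g.2⟩, Subtype.ext hv.symm⟩⟩

/-- The subgroup `H` in coordinates. -/
def hEquiv : {v // D.X v ∈ R.X1} × W × U ≃ R.H :=
  Equiv.ofBijective (fun p => ⟨D.X p.1 * D.Y p.2.1 * D.Z p.2.2, (R.mem_H_iff _ _ _).2 p.1.2⟩)
    ⟨fun p p' h => by
      obtain ⟨h1, h2, h3⟩ := D.inj _ _ _ _ _ _ (congrArg Subtype.val h)
      exact Prod.ext (Subtype.ext h1) (Prod.ext h2 h3), fun g => by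
      obtain ⟨v, w, u, h⟩ := D.surj g
      exact ⟨(⟨v, (R.mem_H_iff _ _ _).1 (h ▸ g.2)⟩, w, u), Subtype.ext h.symm⟩⟩

theorem card_H [Finite V] [Finite W] [Finite U] :
    Nat.card R.H = Nat.card R.X1 * Nat.card W * Nat.card U := by
  rw [← Nat.card_congr R.hEquiv, Nat.card_prod, Nat.card_prod, Nat.card_congr R.xEquiv, mul_assoc]

theorem normal_H : R.H.Normal := by
  refine ⟨fun h hh g => ?_⟩
  obtain ⟨v, w, u, rfl⟩ := D.surj h
  obtain ⟨a, b, c, rfl⟩ := D.surj g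
  -- conjugation does not change the first coordinate
  obtain ⟨a', b', c', hk⟩ := D.surj (D.X a * D.Y b * D.Z c * (D.X v * D.Y w * D.Z u) *
    (D.X a * D.Y b * D.Z c)⁻¹)
  rw [hk, R.mem_H_iff]
  rw [mul_inv_eq_iff_eq_mul, D.mul_form, D.mul_form] at hk
  have h1 := (D.inj _ _ _ _ _ _ hk).1
  rw [add_comm, add_left_inj] at h1
  rwa [← h1, ← R.mem_H_iff v w u]

/-- The radicals on the two sides have the same index. -/
theorem card_mul_card [Finite V] [Finite W] :
    Nat.card R.X1 * Nat.card W = Nat.card V * Nat.card R.Y1 := by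
  classical
  have := Fintype.ofFinite V
  have := Fintype.ofFinite W
  -- evaluate the double sum of `ψ (B v w)` in both orders
  have h1 : ∑ v, ∑ w, ψ (D.B v w) = Nat.card R.X1 * Nat.card W := by
    have : ∀ v, ∑ w, ψ (D.B v w) = if D.X v ∈ R.X1 then (Nat.card W : ℂ) else 0 := by
      intro v
      have h := AddChar.sum_eq_ite (D.rightChar ψ v)
      simp only [D.rightChar_apply, AddChar.eq_zero_iff, ← R.X_mem] at h
      rw [h, Nat.card_eq_fintype_card]
    simp only [this]
    rw [← Finset.sum_filter, Finset.sum_const, nsmul_eq_mul, ← Fintype.card_subtype,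
      ← Nat.card_eq_fintype_card, Nat.card_congr R.xEquiv]
  have h2 : ∑ w, ∑ v, ψ (D.B v w) = Nat.card R.Y1 * Nat.card V := by
    have : ∀ w, ∑ v, ψ (D.B v w) = if D.Y w ∈ R.Y1 then (Nat.card V : ℂ) else 0 := by
      intro w
      have h := AddChar.sum_eq_ite (D.leftChar ψ w)
      simp only [D.leftChar_apply, AddChar.eq_zero_iff, ← R.Y_mem] at h
      rw [h, Nat.card_eq_fintype_card]
    simp only [this]
    rw [← Finset.sum_filter, Finset.sum_const, nsmul_eq_mul, ← Fintype.card_subtype,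
      ← Nat.card_eq_fintype_card, Nat.card_congr R.yEquiv]
  rw [Finset.sum_comm, h2, mul_comm] at h1
  exact_mod_cast h1.symm

open Classical in
/-- The irreducible character with label `(ψ, μ, ν)`, written down by its values. It is supported on
the product of `X1`, `Y1` and the image of `Z`, where it is a multiple of `μ ν ψ`. -/
def charFn (μ : R.X1 →* ℂˣ) (ν : R.Y1 →* ℂˣ) (g : G) : ℂ :=
  if h : D.X (D.coordEquiv.symm g).1 ∈ R.X1 ∧ D.Y (D.coordEquiv.symm g).2.1 ∈ R.Y1 then
    (Nat.card V / Nat.card R.X1 : ℂ) *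
      (μ ⟨_, h.1⟩ * ν ⟨_, h.2⟩ * ψ (D.coordEquiv.symm g).2.2)
  else 0

theorem charFn_of_mem (μ : R.X1 →* ℂˣ) (ν : R.Y1 →* ℂˣ) {v : V} {w : W} (hv : D.X v ∈ R.X1)
    (hw : D.Y w ∈ R.Y1) (u : U) : R.charFn μ ν (D.X v * D.Y w * D.Z u) =
      (Nat.card V / Nat.card R.X1 : ℂ) * (μ ⟨_, hv⟩ * ν ⟨_, hw⟩ * ψ u) := by
  have h := D.coordEquiv_symm v w u
  rw [charFn, dif_pos (by rw [h]; exact ⟨hv, hw⟩)]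
  simp only [h]

theorem charFn_of_not (μ : R.X1 →* ℂˣ) (ν : R.Y1 →* ℂˣ) {v : V} {w : W}
    (h : ¬ (D.X v ∈ R.X1 ∧ D.Y w ∈ R.Y1)) (u : U) :
    R.charFn μ ν (D.X v * D.Y w * D.Z u) = 0 := by
  rw [charFn, dif_neg (by rw [D.coordEquiv_symm]; exact h)]

theorem charFn_X (μ : R.X1 →* ℂˣ) (ν : R.Y1 →* ℂˣ) {v : V} (hv : D.X v ∈ R.X1) :
    R.charFn μ ν (D.X v) = (Nat.card V / Nat.card R.X1 : ℂ) * μ ⟨_, hv⟩ := by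
  have h0 : D.Y 0 ∈ R.Y1 := D.Y_zero ▸ one_mem _
  have h1 := R.charFn_of_mem μ ν hv h0 0
  have h2 : (⟨D.Y 0, h0⟩ : R.Y1) = 1 := Subtype.ext D.Y_zero
  rwa [h2, ← D.X_eq, map_one, AddChar.map_zero_eq_one, Units.val_one, mul_one, mul_one] at h1

theorem charFn_Y (μ : R.X1 →* ℂˣ) (ν : R.Y1 →* ℂˣ) {w : W} (hw : D.Y w ∈ R.Y1) :
    R.charFn μ ν (D.Y w) = (Nat.card V / Nat.card R.X1 : ℂ) * ν ⟨_, hw⟩ := by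
  have h0 : D.X 0 ∈ R.X1 := D.X_zero ▸ one_mem _
  have h1 := R.charFn_of_mem μ ν h0 hw 0
  have h2 : (⟨D.X 0, h0⟩ : R.X1) = 1 := Subtype.ext D.X_zero
  rwa [h2, ← D.Y_eq, map_one, AddChar.map_zero_eq_one, Units.val_one, mul_one, one_mul] at h1

theorem charFn_Z (μ : R.X1 →* ℂˣ) (ν : R.Y1 →* ℂˣ) (u : U) :
    R.charFn μ ν (D.Z u) = (Nat.card V / Nat.card R.X1 : ℂ) * ψ u := by
  have h0 : D.X 0 ∈ R.X1 := D.X_zero ▸ one_mem _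
  have h0' : D.Y 0 ∈ R.Y1 := D.Y_zero ▸ one_mem _
  have h1 := R.charFn_of_mem μ ν h0 h0' u
  have h2 : (⟨D.X 0, h0⟩ : R.X1) = 1 := Subtype.ext D.X_zero
  have h3 : (⟨D.Y 0, h0'⟩ : R.Y1) = 1 := Subtype.ext D.Y_zero
  rwa [h2, h3, ← D.Z_eq, map_one, map_one, Units.val_one, mul_one, one_mul] at h1

theorem charFn_one (μ : R.X1 →* ℂˣ) (ν : R.Y1 →* ℂˣ) :
    R.charFn μ ν 1 = (Nat.card V / Nat.card R.X1 : ℂ) := by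
  rw [← D.Z_zero, charFn_Z, AddChar.map_zero_eq_one, mul_one]

variable [Finite V]

theorem card_div_ne_zero : (Nat.card V / Nat.card R.X1 : ℂ) ≠ 0 := by
  have : Finite R.X1 := Finite.of_equiv _ R.xEquiv
  exact div_ne_zero (Nat.cast_ne_zero.2 Nat.card_pos.ne') (Nat.cast_ne_zero.2 Nat.card_pos.ne')

/-- The label `(μ, ν)` can be read off from the character. -/
theorem charFn_injective {μ μ' : R.X1 →* ℂˣ} {ν ν' : R.Y1 →* ℂˣ}
    (h : R.charFn μ ν = R.charFn μ' ν') : μ = μ' ∧ ν = ν' := by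
  have hc := R.card_div_ne_zero
  constructor
  · refine MonoidHom.ext fun g => Units.ext ?_
    obtain ⟨⟨v, hv⟩, rfl⟩ := R.xEquiv.surjective g
    have h1 := congrFun h (D.X v)
    rw [R.charFn_X _ _ hv, R.charFn_X _ _ hv] at h1
    exact mul_left_cancel₀ hc h1
  · refine MonoidHom.ext fun g => Units.ext ?_
    obtain ⟨⟨v, hv⟩, rfl⟩ := R.yEquiv.surjective g
    have h1 := congrFun h (D.Y v)
    rw [R.charFn_Y _ _ hv, R.charFn_Y _ _ hv] at h1
    exact mul_left_cancel₀ hc h1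

variable [Finite W] [Finite U]

theorem finite_group (D : HeisenbergData V W U G) : Finite G := Finite.of_equiv _ D.coordEquiv

/-- Existence of a linear character of the stabilizer with a given label `(ψ, μ, ν)`. It is
`μ N ψ`, where `N` extends `ν` from the right radical to all of `W`. -/
theorem exists_linear (μ : R.X1 →* ℂˣ) (ν : R.Y1 →* ℂˣ) :
    ∃ θ : R.H →* ℂˣ, (∀ (h : R.H) u, (h : G) = D.Z u → (θ h : ℂ) = ψ u) ∧
      (∀ (h : R.H) (g : R.X1), (h : G) = g → θ h = μ g) ∧
      (∀ (h : R.H) (g : R.Y1), (h : G) = g → θ h = ν g) := by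
  -- extend `ν` to all of `W`
  let S : Subgroup (Multiplicative W) := R.Y1.comap D.YHom
  let ν₀ : S →* ℂˣ := ν.comp ((D.YHom.comp S.subtype).codRestrict R.Y1 fun w => w.2)
  obtain ⟨N, hN⟩ := MonoidHom.domRestrict_surjective ℂ S ν₀
  have hN' : ∀ w (hw : D.Y w ∈ R.Y1), N (Multiplicative.ofAdd w) = ν ⟨D.Y w, hw⟩ := fun w hw =>
    DFunLike.congr_fun hN ⟨Multiplicative.ofAdd w, hw⟩
  let F : {v // D.X v ∈ R.X1} × W × U → ℂˣ := fun p =>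
    μ ⟨D.X p.1, p.1.2⟩ * N (Multiplicative.ofAdd p.2.1) * (ψ.val_isUnit p.2.2).unit
  have hF : ∀ v hv w u (hh : D.X v * D.Y w * D.Z u ∈ R.H),
      F (R.hEquiv.symm ⟨D.X v * D.Y w * D.Z u, hh⟩) = F (⟨v, hv⟩, w, u) := by
    intro v hv w u hh
    congr 1
    exact R.hEquiv.symm_apply_apply (⟨v, hv⟩, w, u)
  let θ : R.H →* ℂˣ := MonoidHom.mk' (fun h => F (R.hEquiv.symm h)) (by
    intro a b
    obtain ⟨⟨⟨v, hv⟩, w, u⟩, rfl⟩ := R.hEquiv.surjective a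
    obtain ⟨⟨⟨v', hv'⟩, w', u'⟩, rfl⟩ := R.hEquiv.surjective b
    have h1 : R.hEquiv (⟨v, hv⟩, w, u) * R.hEquiv (⟨v', hv'⟩, w', u') =
        R.hEquiv (⟨v + v', R.X_add_mem hv hv'⟩, w + w', u + u' + D.B v' w) :=
      Subtype.ext (D.mul_form v w u v' w' u')
    rw [h1, Equiv.symm_apply_apply, Equiv.symm_apply_apply, Equiv.symm_apply_apply]
    have h2 : (⟨D.X (v + v'), R.X_add_mem hv hv'⟩ : R.X1) = ⟨D.X v, hv⟩ * ⟨D.X v', hv'⟩ :=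
      Subtype.ext (D.X_add v v')
    ext
    simp only [F, h2, map_mul, ofAdd_add, Units.val_mul, IsUnit.unit_spec,
      AddChar.map_add_eq_mul, (R.X_mem v').1 hv' w, mul_one]
    ring)
  have h0 : D.X 0 ∈ R.X1 := D.X_zero ▸ one_mem _
  have h0' : D.Y 0 ∈ R.Y1 := D.Y_zero ▸ one_mem _
  have hx : (⟨D.X 0, h0⟩ : R.X1) = 1 := Subtype.ext D.X_zero
  have hy : N (Multiplicative.ofAdd 0) = 1 := map_one N
  have hz : (ψ.val_isUnit 0).unit = 1 := Units.ext (AddChar.map_zero_eq_one ψ)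
  refine ⟨θ, ?_, ?_, ?_⟩
  · rintro ⟨_, hh⟩ u rfl
    have h := congrArg Units.val (hF 0 h0 0 u (D.Z_eq u ▸ hh))
    simp only [F, hx, hy, map_one, one_mul, ← D.Z_eq] at h
    exact h
  · rintro ⟨k, hh⟩ ⟨g, hg⟩ hk
    obtain ⟨v, rfl⟩ := R.exists_X g hg
    obtain rfl : k = D.X v := hk
    have h := hF v hg 0 0 (D.X_eq v ▸ hh)
    simp only [F, hy, hz, mul_one, ← D.X_eq] at h
    exact h
  · rintro ⟨k, hh⟩ ⟨g, hg⟩ hk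
    obtain ⟨w, rfl⟩ := R.exists_Y g hg
    obtain rfl : k = D.Y w := hk
    have h := hF 0 h0 w 0 (D.Y_eq w ▸ hh)
    simp only [F, hx, hz, map_one, one_mul, mul_one, ← D.Y_eq, hN' w hg] at h
    exact h

section linear

variable {R} {μ : R.X1 →* ℂˣ} {ν : R.Y1 →* ℂˣ} {θ : R.H →* ℂˣ}

omit [Finite V] [Finite W] [Finite U] in
/-- The conjugate of a linear character `θ` of the stabilizer by an element with first coordinate
`v₂` is `θ` times the character `ψ (B v₂ ·)`. -/
theorem conj_linear (hZ : ∀ (h : R.H) u, (h : G) = D.Z u → (θ h : ℂ) = ψ u) (v₂ : V) (w₂ : W)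
    (u₂ : U) {v : V} {w : W} {u : U} (hh : D.X v * D.Y w * D.Z u ∈ R.H) :
    conjFun R.normal_H (fun h => (θ h : ℂ)) (D.X v₂ * D.Y w₂ * D.Z u₂)
      ⟨D.X v * D.Y w * D.Z u, hh⟩ = θ ⟨D.X v * D.Y w * D.Z u, hh⟩ * ψ (D.B v₂ w) := by
  have hk : D.Y w₂ * D.Z u₂ ∈ R.H := mul_mem (R.Y_mem_H _) (R.Z_mem_H _)
  have h2 : (D.X v₂ * D.Y w₂ * D.Z u₂)⁻¹ * (D.X v * D.Y w * D.Z u) * (D.X v₂ * D.Y w₂ * D.Z u₂) =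
      (D.Y w₂ * D.Z u₂)⁻¹ * (D.X v * D.Y w * D.Z u * D.Z (D.B v₂ w)) * (D.Y w₂ * D.Z u₂) := by
    rw [← D.X_conj]; group
  have h3 : conjFun R.normal_H (fun h => (θ h : ℂ)) (D.X v₂ * D.Y w₂ * D.Z u₂)
      ⟨D.X v * D.Y w * D.Z u, hh⟩ = θ ((⟨_, hk⟩ : R.H)⁻¹ *
        (⟨_, hh⟩ * ⟨_, R.Z_mem_H (D.B v₂ w)⟩) * ⟨_, hk⟩) := by
    simp only [conjFun]
    congr 2
    exact Subtype.ext h2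
  rw [h3, map_mul, map_mul, map_inv, mul_comm, mul_inv_cancel_left, map_mul, Units.val_mul,
    hZ ⟨_, R.Z_mem_H (D.B v₂ w)⟩ _ rfl]

/-- Inducing a linear character of the stabilizer gives the character with the same label: the sum
over the conjugates of `θ` vanishes outside the right radical, so that only `ν` matters, and not its
extension to `W`. -/
theorem induce_linear (hZ : ∀ (h : R.H) u, (h : G) = D.Z u → (θ h : ℂ) = ψ u)
    (hX : ∀ (h : R.H) (g : R.X1), (h : G) = g → θ h = μ g)
    (hY : ∀ (h : R.H) (g : R.Y1), (h : G) = g → θ h = ν g) :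
    induce R.H (fun h => (θ h : ℂ)) = R.charFn μ ν := by
  classical
  have := Fintype.ofFinite V
  have := Fintype.ofFinite W
  have := Fintype.ofFinite U
  have := finite_group D
  have := Fintype.ofFinite G
  funext g
  obtain ⟨v, w, u, rfl⟩ := D.surj g
  by_cases hv : D.X v ∈ R.X1
  · have hh : D.X v * D.Y w * D.Z u ∈ R.H := (R.mem_H_iff _ _ _).2 hv
    have h1 := induce_of_normal R.normal_H (fun h => (θ h : ℂ)) ⟨_, hh⟩
    simp only at h1
    have h2 : ∑ x : G, conjFun R.normal_H (fun h => (θ h : ℂ)) x ⟨D.X v * D.Y w * D.Z u, hh⟩ =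
        Nat.card W * Nat.card U * θ ⟨_, hh⟩ * ∑ v₂, ψ (D.B v₂ w) := by
      rw [← Equiv.sum_comp D.coordEquiv, Fintype.sum_prod_type]
      simp only [Fintype.sum_prod_type, D.coordEquiv_apply, conj_linear hZ]
      simp only [Finset.sum_const, Finset.card_univ, nsmul_eq_mul, ← Nat.card_eq_fintype_card]
      rw [Finset.mul_sum]
      exact Finset.sum_congr rfl fun _ _ => by ring
    have h3 := AddChar.sum_eq_ite (D.leftChar ψ w)
    simp only [D.leftChar_apply, AddChar.eq_zero_iff, ← R.Y_mem, ← Nat.card_eq_fintype_card] at h3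
    rw [h1, h2, h3, R.card_H]
    by_cases hw : D.Y w ∈ R.Y1
    · rw [if_pos hw, R.charFn_of_mem _ _ hv hw, ← hX ⟨_, R.X_mem_H hv⟩ ⟨_, hv⟩ rfl,
        ← hY ⟨_, R.Y_mem_H w⟩ ⟨_, hw⟩ rfl, ← hZ ⟨_, R.Z_mem_H u⟩ u rfl, ← Units.val_mul,
        ← Units.val_mul, ← map_mul, ← map_mul]
      have hW : (Nat.card W : ℂ) ≠ 0 := Nat.cast_ne_zero.2 Nat.card_pos.ne'
      have hU : (Nat.card U : ℂ) ≠ 0 := Nat.cast_ne_zero.2 Nat.card_pos.ne'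
      have hX1 : (Nat.card R.X1 : ℂ) ≠ 0 := Nat.cast_ne_zero.2 Nat.card_pos.ne'
      simp only [MulMemClass.mk_mul_mk]
      push_cast
      field_simp
    · rw [if_neg hw, R.charFn_of_not _ _ (fun h => hw h.2), mul_zero, mul_zero]
  · rw [R.charFn_of_not _ _ (fun h => hv h.1),
      induce_of_notMem R.normal_H _ (fun h => hv ((R.mem_H_iff _ _ _).1 h))]

end linear

/-- The character with label `(ψ, μ, ν)` is irreducible. -/
theorem charFn_mem_irrChar (μ : R.X1 →* ℂˣ) (ν : R.Y1 →* ℂˣ) : R.charFn μ ν ∈ IrrChar G := by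
  have := finite_group D
  obtain ⟨θ, hZ, hX, hY⟩ := R.exists_linear μ ν
  rw [← induce_linear hZ hX hY]
  refine induce_mem_irrChar R.normal_H (irrChar_of_monoidHom θ) fun g hg heq => hg ?_
  obtain ⟨v, w, u, rfl⟩ := D.surj g
  rw [R.mem_H]
  intro w'
  have hh : D.X 0 * D.Y w' * D.Z 0 ∈ R.H := by
    rw [R.mem_H_iff, D.X_zero]; exact one_mem _
  have h := congrFun heq ⟨_, hh⟩
  rw [conj_linear hZ] at h
  exact (mul_eq_left₀ (Units.ne_zero _)).1 h

/-- Every irreducible character on which the image of `Z` acts through `ψ` has a label. The radicals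
act by scalars, by Schur's lemma; the character vanishes outside the product of the radicals with
the image of `Z`; and its degree follows from the orthogonality relations. -/
theorem exists_eq_charFn {χ : G → ℂ} (hχ : χ ∈ IrrChar G)
    (hψ : ∀ u, χ (D.Z u) = χ 1 * ψ u) : ∃ μ ν, χ = R.charFn μ ν := by
  classical
  have := Fintype.ofFinite V
  have := Fintype.ofFinite W
  have := Fintype.ofFinite U
  have := finite_group D
  have := Fintype.ofFinite G
  have h1 := IrrChar.one_ne_zero hχ
  have hconj := IrrChar.conj hχ
  have hnorm := IrrChar.sum_mul_inv hχ hχ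
  rw [if_pos rfl] at hnorm
  obtain ⟨n, ρ, hρ, rfl⟩ := hχ
  -- the image of `Z` acts by the scalars `ψ u`
  have hZ : ∀ u, ρ (D.Z u) = ψ u • LinearMap.id := by
    intro u
    obtain ⟨c, hc⟩ := Representation.IsIrreducible.exists_scalar hρ (Subgroup.center G)
      fun s hs g => by rw [Subgroup.mem_center_iff.1 hs g]
    have hu : D.Z u ∈ Subgroup.center G := Subgroup.mem_center_iff.2 fun g => (D.central u g).symm
    have h2 := hc ⟨_, hu⟩
    have h3 := hψ u
    rw [h2]
    congr 1
    simp only at h2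
    rw [char_one] at h1
    rw [Representation.character, h2, map_smul, LinearMap.trace_id, smul_eq_mul, char_one,
      mul_comm] at h3
    exact mul_left_cancel₀ h1 h3
  have hχZ : ∀ g u, ρ.character (g * D.Z u) = ρ.character g * ψ u := by
    intro g u
    simp only [Representation.character, map_mul, hZ, mul_comm _ (ψ u)]
    rw [← smul_eq_mul (ψ u), ← map_smul, ← Module.End.one_eq_id, mul_smul_one]
  -- by Schur's lemma the radicals act by scalars
  obtain ⟨μ, hμ⟩ := Representation.IsIrreducible.exists_scalar hρ R.X1 (by
    intro s hs g
    obtain ⟨v, rfl⟩ := R.exists_X s hs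
    obtain ⟨a, b, c, rfl⟩ := D.surj g
    have h2 : D.X a * D.Y b * D.Z c * D.X v =
        D.X v * (D.X a * D.Y b * D.Z c) * D.Z (D.B v b) := by
      rw [mul_assoc _ (D.Z c), D.central, ← mul_assoc, mul_assoc (D.X a), D.comm]
      have h3 : D.X a * D.X v = D.X v * D.X a := by rw [← D.X_add, ← D.X_add, add_comm]
      calc D.X a * (D.X v * D.Y b * D.Z (D.B v b)) * D.Z c
          = (D.X a * D.X v) * D.Y b * (D.Z (D.B v b) * D.Z c) := by group
        _ = D.X v * (D.X a * D.Y b * D.Z c) * D.Z (D.B v b) := by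
          rw [h3, D.central (D.B v b)]; group
    rw [h2, map_mul _ _ (D.Z _), hZ, (R.X_mem v).1 hs b, one_smul]
    rfl)
  obtain ⟨ν, hν⟩ := Representation.IsIrreducible.exists_scalar hρ R.Y1 (by
    intro s hs g
    obtain ⟨w, rfl⟩ := R.exists_Y s hs
    obtain ⟨a, b, c, rfl⟩ := D.surj g
    have h2 : D.Y w * (D.X a * D.Y b * D.Z c) =
        D.X a * D.Y b * D.Z c * D.Y w * D.Z (D.B a w) := by
      have h3 : D.Y w * D.Y b = D.Y b * D.Y w := by rw [← D.Y_add, ← D.Y_add, add_comm]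
      calc D.Y w * (D.X a * D.Y b * D.Z c)
          = (D.Y w * D.X a) * D.Y b * D.Z c := by group
        _ = D.X a * D.Y w * (D.Z (D.B a w) * (D.Y b * D.Z c)) := by rw [D.comm]; group
        _ = D.X a * (D.Y w * D.Y b) * (D.Z c * D.Z (D.B a w)) := by rw [D.central]; group
        _ = D.X a * D.Y b * (D.Y w * D.Z c) * D.Z (D.B a w) := by rw [h3]; group
        _ = D.X a * D.Y b * D.Z c * D.Y w * D.Z (D.B a w) := by rw [← D.central c]; group
    rw [h2, map_mul _ _ (D.Z _), hZ, (R.Y_mem w).1 hs a, one_smul]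
    rfl)
  have hscal : ∀ v w u (hv : D.X v ∈ R.X1) (hw : D.Y w ∈ R.Y1),
      ρ (D.X v * D.Y w * D.Z u) =
        ((μ ⟨_, hv⟩ : ℂ) * ν ⟨_, hw⟩ * ψ u) • (1 : Module.End ℂ (Fin n → ℂ)) := by
    intro v w u hv hw
    have h2 := hμ ⟨_, hv⟩
    have h3 := hν ⟨_, hw⟩
    simp only at h2 h3
    rw [map_mul, map_mul, h2, h3, hZ, ← Module.End.one_eq_id, smul_mul_smul_comm,
      smul_mul_smul_comm, one_mul, one_mul]
  have hzero : ∀ v w u, ¬ (D.X v ∈ R.X1 ∧ D.Y w ∈ R.Y1) →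
      ρ.character (D.X v * D.Y w * D.Z u) = 0 := by
    -- conjugation by a suitable element multiplies the value by a number different from `1`
    intro v w u h
    have key : ∀ c : ℂ, c ≠ 1 → ρ.character (D.X v * D.Y w * D.Z u) =
        ρ.character (D.X v * D.Y w * D.Z u) * c → ρ.character (D.X v * D.Y w * D.Z u) = 0 := by
      intro c hc h
      by_contra h0
      exact hc (by simpa [h0] using h)
    rcases not_and_or.1 h with hv | hw
    · rw [R.X_mem, not_forall] at hv
      obtain ⟨w₂, hw₂⟩ := hv
      refine key _ hw₂ ?_
      rw [← hχZ, ← D.Y_conj, ← hconj _ (D.Y w₂)⁻¹, inv_inv]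
    · rw [R.Y_mem, not_forall] at hw
      obtain ⟨v₂, hv₂⟩ := hw
      refine key _ hv₂ ?_
      rw [← hχZ, ← D.X_conj, hconj]
  -- the character has absolute value `n` on its support, and its norm is `1`
  have hn : (n : ℂ) = Nat.card V / Nat.card R.X1 := by
    let a : V → ℂ := fun v => if D.X v ∈ R.X1 then 1 else 0
    let b : W → ℂ := fun w => if D.Y w ∈ R.Y1 then 1 else 0
    have ha : ∑ v, a v = Nat.card R.X1 := by
      rw [Finset.sum_boole, ← Fintype.card_subtype, ← Nat.card_eq_fintype_card,
        Nat.card_congr R.xEquiv]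
    have hb : ∑ w, b w = Nat.card R.Y1 := by
      rw [Finset.sum_boole, ← Fintype.card_subtype, ← Nat.card_eq_fintype_card,
        Nat.card_congr R.yEquiv]
    have hterm : ∀ v w u, ρ.character (D.X v * D.Y w * D.Z u) *
        ρ.character (D.X v * D.Y w * D.Z u)⁻¹ =
        (n : ℂ) ^ 2 * b w * a v := by
      intro v w u
      simp only [a, b]
      by_cases h : D.X v ∈ R.X1 ∧ D.Y w ∈ R.Y1
      · rw [if_pos h.1, if_pos h.2, mul_one, mul_one]
        have h2 := hscal v w u h.1 h.2
        have h3 : (n : ℂ) = LinearMap.trace ℂ (Fin n → ℂ) (ρ (D.X v * D.Y w * D.Z u *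
            (D.X v * D.Y w * D.Z u)⁻¹)) := by
          rw [mul_inv_cancel, map_one, LinearMap.trace_one, Module.finrank_fin_fun]
        rw [map_mul, h2, smul_one_mul, map_smul, smul_eq_mul] at h3
        rw [Representation.character, Representation.character, h2, map_smul, smul_eq_mul,
          mul_right_comm, ← h3]
        simp [sq]
      · rw [hzero v w u h, zero_mul]
        rcases not_and_or.1 h with h | h <;> simp [h]
    rw [← Equiv.sum_comp D.coordEquiv, Fintype.sum_prod_type] at hnorm
    simp only [Fintype.sum_prod_type, D.coordEquiv_apply, hterm, Finset.sum_const,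
      Finset.card_univ, nsmul_eq_mul, ← Finset.mul_sum, ← Finset.sum_mul, ha, hb,
      ← Nat.card_eq_fintype_card, D.card_eq] at hnorm
    have hU : (Nat.card U : ℂ) ≠ 0 := Nat.cast_ne_zero.2 Nat.card_pos.ne'
    have hW : (Nat.card W : ℂ) ≠ 0 := Nat.cast_ne_zero.2 Nat.card_pos.ne'
    have hX1 : (Nat.card R.X1 : ℂ) ≠ 0 := Nat.cast_ne_zero.2 Nat.card_pos.ne'
    have hcard : (Nat.card R.X1 * Nat.card W : ℂ) = Nat.card V * Nat.card R.Y1 := by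
      exact_mod_cast R.card_mul_card
    push_cast at hnorm
    have h2 : ((n * Nat.card R.X1 : ℕ) : ℂ) ^ 2 = ((Nat.card V : ℕ) : ℂ) ^ 2 := by
      push_cast
      refine mul_right_cancel₀ hW (mul_right_cancel₀ hU ?_)
      linear_combination (Nat.card V : ℂ) * hnorm + (n : ℂ) ^ 2 * Nat.card R.X1 * Nat.card U * hcard
    have h3 : n * Nat.card R.X1 = Nat.card V := by
      have : (n * Nat.card R.X1) ^ 2 = Nat.card V ^ 2 := by exact_mod_cast h2
      exact Nat.pow_left_injective two_ne_zero this
    rw [eq_div_iff hX1]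
    exact_mod_cast h3
  refine ⟨μ, ν, funext fun g => ?_⟩
  obtain ⟨v, w, u, rfl⟩ := D.surj g
  by_cases h : D.X v ∈ R.X1 ∧ D.Y w ∈ R.Y1
  · rw [Representation.character, hscal v w u h.1 h.2, R.charFn_of_mem _ _ h.1 h.2, map_smul,
      ← hn]
    simp [mul_comm]
  · rw [hzero v w u h, R.charFn_of_not _ _ h]

end Radicals

end HeisenbergData

namespace UF4

/-! ### Additive characters of the ground field -/

section phi

variable {K : Type*} [Field K] [CharP K 2]

theorem phi_add (s t : K) : phi (s + t) = phi s * phi t := by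
  simp only [phi, map_add, AddChar.map_add_eq_mul]

theorem phi_zero : phi (0 : K) = 1 := by
  simp only [phi, map_zero, AddChar.map_zero_eq_one]

/-- The character `phi` as an additive character. -/
def phiChar (K : Type*) [Field K] [CharP K 2] : AddChar K ℂ where
  toFun := phi
  map_zero_eq_one' := phi_zero
  map_add_eq_mul' := phi_add

variable [Finite K]

theorem phiChar_isPrimitive : (phiChar K).IsPrimitive := by
  refine AddChar.IsPrimitive.of_ne_one ?_
  letI := ZMod.algebra K 2
  have h : Algebra.trace (ZMod 2) K ≠ 0 := Algebra.trace_ne_zero _ _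
  obtain ⟨t, ht⟩ := DFunLike.ne_iff.1 h
  refine AddChar.ne_one_iff.2 ⟨t, fun h1 => ht ?_⟩
  refine ZMod.injective_stdAddChar ?_
  rw [LinearMap.zero_apply, AddChar.map_zero_eq_one]
  exact h1

theorem phi_mul_injective {a b : K} (h : ∀ t, phi (a * t) = phi (b * t)) : a = b :=
  AddChar.to_mulShift_inj_of_isPrimitive phiChar_isPrimitive (AddChar.ext _ _ h)

theorem eq_zero_of_phi {a : K} (h : ∀ t, phi (a * t) = 1) : a = 0 :=
  phi_mul_injective fun t => by rw [h, zero_mul, phi_zero]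

/-- Every additive character of `K` is of the form `t ↦ phi (a * t)`. -/
theorem exists_eq_phi_mul (ψ : AddChar K ℂ) : ∃ a : K, ∀ t, ψ t = phi (a * t) := by
  have := Fintype.ofFinite K
  have hb := (Fintype.bijective_iff_injective_and_card
    (AddChar.mulShift (phiChar K))).2 ⟨AddChar.to_mulShift_inj_of_isPrimitive phiChar_isPrimitive,
      AddChar.card_eq.symm⟩
  obtain ⟨a, rfl⟩ := hb.2 ψ
  exact ⟨a, fun t => rfl⟩

end phi

/-! ### Labels of the characters in `F₁₁` -/

section labels

variable {K : Type*} [Field K]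

/-- The parameters as a vector indexed by the roots in `Z`. -/
def Param.vec (a : Param K) : Fin 6 → Kˣ := ![a.a6, a.a8, a.a9, a.a10, a.a12, a.a18]

/-- Parameters are vectors of units. -/
def paramEquiv : Param K ≃ (Fin 6 → Kˣ) where
  toFun := Param.vec
  invFun c := ⟨c 0, c 1, c 2, c 3, c 4, c 5⟩
  left_inv a := rfl
  right_inv c := by ext l; fin_cases l <;> rfl

instance [Finite K] : Finite (Param K) := Finite.of_equiv _ paramEquiv.symm

variable [CharP K 2]

/-- The linear character `λ_a` of `X_Z`. -/
def lam (a : Param K) : AddChar (Fin 6 → K) ℂ where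
  toFun u := phi (∑ l, a.vec l * u l)
  map_zero_eq_one' := by simp [phi_zero]
  map_add_eq_mul' u u' := by
    rw [← phi_add, ← Finset.sum_add_distrib]
    simp only [Pi.add_apply, mul_add]

theorem lam_apply (a : Param K) (u : Fin 6 → K) : lam a u = phi (∑ l, a.vec l * u l) := rfl

theorem lam_single (a : Param K) (l : Fin 6) (t : K) :
    lam a (Pi.single l t) = phi (a.vec l * t) := by
  rw [lam_apply, Finset.sum_eq_single l]
  · rw [Pi.single_eq_same]
  · intro m _ hm
    rw [Pi.single_eq_of_ne hm, mul_zero]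
  · simp

/-- The equation that defines `X'` and `Y'` says that `λ_a` is trivial on the commutator of
`x₂ x₅` and `x₃ x₇`. -/
theorem stabEq_iff (a : Param K) (v w : K × K) :
    StabEq a v.1 v.2 w.1 w.2 ↔ lam a (bracket v w) = 1 := by
  rw [StabEq, lam_apply]
  have h : w.1 * (a.a9 * v.1 * w.1 + a.a6 * v.1 + a.a8 * v.2) +
      w.2 * (a.a18 * v.2 * w.2 + a.a12 * v.2 + a.a10 * v.1) =
      ∑ l, (a.vec l : K) * bracket v w l := by
    simp [Fin.sum_univ_six, Param.vec, bracket, r2, r5]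
    ring
  rw [h]

/-- The numbers of the roots in `Z`. -/
def zn : Fin 6 → ℕ := ![6, 8, 9, 10, 12, 18]

theorem ZS_single_eq_xS (l : Fin 6) (t : K) : ZS (Pi.single l t) = xS (zn l) t := by
  rw [ZS_single]
  fin_cases l <;> rfl

theorem hasParam_iff (χ : XS K → ℂ) (a : Param K) :
    HasParam χ a ↔ ∀ l t, χ (ZS (Pi.single l t)) = χ 1 * phi (a.vec l * t) := by
  simp only [ZS_single_eq_xS]
  constructor
  · intro h l t
    obtain ⟨h6, h8, h9, h10, h12, h18⟩ := h t
    fin_cases l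
    exacts [h6, h8, h9, h10, h12, h18]
  · intro h t
    exact ⟨h 0 t, h 1 t, h 2 t, h 3 t, h 4 t, h 5 t⟩

theorem mem_X' (a : Param K) (g : XS K) :
    g ∈ X' a ↔ ∃ v, (∀ w, lam a (bracket v w) = 1) ∧ g = XX v := by
  have hadd := (dataXS (K := K)).B_add_left
  constructor
  · intro hg
    induction hg using Subgroup.closure_induction with
    | mem g hg =>
      obtain ⟨t2, t5, h, rfl⟩ := hg
      exact ⟨(t2, t5), fun w => (stabEq_iff a (t2, t5) w).1 (h w.1 w.2), rfl⟩
    | one => exact ⟨0, fun w => by rw [bracket_zero_left, AddChar.map_zero_eq_one], XX_zero.symm⟩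
    | mul x y _ _ hx hy =>
      obtain ⟨v, hv, rfl⟩ := hx
      obtain ⟨v', hv', rfl⟩ := hy
      refine ⟨v + v', fun w => ?_, (XX_add v v').symm⟩
      have h : bracket (v + v') w = bracket v w + bracket v' w := hadd v v' w
      rw [h, AddChar.map_add_eq_mul, hv, hv', one_mul]
    | inv x _ hx =>
      obtain ⟨v, hv, rfl⟩ := hx
      refine ⟨v, hv, inv_eq_of_mul_eq_one_right ?_⟩
      rw [← XX_add, CharTwo.add_self_eq_zero, XX_zero]
  · rintro ⟨v, hv, rfl⟩
    exact Subgroup.subset_closure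
      ⟨v.1, v.2, fun s3 s7 => (stabEq_iff a v (s3, s7)).2 (hv _), rfl⟩

theorem mem_Y' (a : Param K) (g : XS K) :
    g ∈ Y' a ↔ ∃ w, (∀ v, lam a (bracket v w) = 1) ∧ g = YY w := by
  have hadd := (dataXS (K := K)).B_add_right
  constructor
  · intro hg
    induction hg using Subgroup.closure_induction with
    | mem g hg =>
      obtain ⟨s3, s7, h, rfl⟩ := hg
      exact ⟨(s3, s7), fun v => (stabEq_iff a v (s3, s7)).1 (h v.1 v.2), rfl⟩
    | one => exact ⟨0, fun w => by rw [bracket_zero_right, AddChar.map_zero_eq_one], YY_zero.symm⟩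
    | mul x y _ _ hx hy =>
      obtain ⟨w, hw, rfl⟩ := hx
      obtain ⟨w', hw', rfl⟩ := hy
      refine ⟨w + w', fun v => ?_, (YY_add w w').symm⟩
      have h : bracket v (w + w') = bracket v w + bracket v w' := hadd v w w'
      rw [h, AddChar.map_add_eq_mul, hw, hw', one_mul]
    | inv x _ hx =>
      obtain ⟨w, hw, rfl⟩ := hx
      refine ⟨w, hw, inv_eq_of_mul_eq_one_right ?_⟩
      rw [← YY_add, CharTwo.add_self_eq_zero, YY_zero]
  · rintro ⟨w, hw, rfl⟩
    exact Subgroup.subset_closure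
      ⟨w.1, w.2, fun t2 t5 => (stabEq_iff a (t2, t5) w).2 (hw _), rfl⟩

theorem YY_mem_YZ (w : K × K) : YY w ∈ YZ K :=
  mul_mem (Subgroup.subset_closure ⟨3, by simp, w.1, rfl⟩)
    (Subgroup.subset_closure ⟨7, by simp, w.2, rfl⟩)

/-- A property of the elements of `X_Z` that holds for the root elements and is preserved by
products holds for all elements. -/
theorem ZS_induction {p : (Fin 6 → K) → Prop} (h0 : p 0) (hadd : ∀ u u', p u → p u' → p (u + u'))
    (h1 : ∀ l t, p (Pi.single l t)) (u : Fin 6 → K) : p u := by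
  rw [← Finset.univ_sum_single u]
  exact Finset.sum_induction _ p hadd h0 fun l _ => h1 l _

theorem ZS_mem_YZ (u : Fin 6 → K) : ZS u ∈ YZ K := by
  induction u using ZS_induction with
  | h0 => rw [ZS_zero]; exact one_mem _
  | hadd u u' hu hu' => rw [ZS_add]; exact mul_mem hu hu'
  | h1 l t =>
    rw [ZS_single_eq_xS]
    refine Subgroup.subset_closure ⟨zn l, ?_, t, rfl⟩
    fin_cases l <;> simp [zn]

/-- An element in normal form lies in `H'` if and only if its first factor lies in `X'`. -/
theorem mem_H' (a : Param K) (v w : K × K) (u : Fin 6 → K) :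
    XX v * YY w * ZS u ∈ H' a ↔ ∀ w', lam a (bracket v w') = 1 := by
  constructor
  · let S : Subgroup (XS K) :=
      { carrier := {g | ∃ v w u, XX v ∈ X' a ∧ g = XX v * YY w * ZS u}
        one_mem' := ⟨0, 0, 0, by rw [XX_zero]; exact one_mem _, dataXS.one_eq⟩
        mul_mem' := by
          rintro _ _ ⟨v, w, u, hv, rfl⟩ ⟨v', w', u', hv', rfl⟩
          exact ⟨_, _, _, by rw [XX_add]; exact mul_mem hv hv', XX_YY_ZS_mul v w u v' w' u'⟩
        inv_mem' := by
          rintro _ ⟨v, w, u, hv, rfl⟩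
          refine ⟨-v, -w, -u - bracket (-v) w, ?_, inv_eq_of_mul_eq_one_right ?_⟩
          · have h : XX (-v) = (XX v)⁻¹ :=
              eq_inv_of_mul_eq_one_right (by rw [← XX_add, add_neg_cancel, XX_zero])
            rw [h]
            exact inv_mem hv
          · rw [XX_YY_ZS_mul, add_neg_cancel, add_neg_cancel, XX_zero, YY_zero]
            have : u + (-u - bracket (-v) w) + bracket (-v) w = 0 := by abel
            rw [this, ZS_zero, one_mul, one_mul] }
    have hS : H' a ≤ S := by
      refine sup_le (fun g hg => ?_) ((Subgroup.closure_le _).2 ?_)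
      · obtain ⟨v, hv, rfl⟩ := (mem_X' a g).1 hg
        exact ⟨v, 0, 0, hg, dataXS.X_eq v⟩
      · rintro _ ⟨n, hn, t, rfl⟩
        have h0 : XX (0 : K × K) ∈ X' a := by rw [XX_zero]; exact one_mem _
        have h7 : α 7 ∈ coreP := by decide
        have h3 : α 3 ∈ coreP := by decide
        have hz : ∀ l, xS (zn l) t ∈ S := fun l =>
          ⟨0, 0, Pi.single l t, h0, by rw [← ZS_single_eq_xS]; exact dataXS.Z_eq _⟩
        simp only [Finset.mem_insert, Finset.mem_singleton] at hn
        rcases hn with rfl | rfl | rfl | rfl | rfl | rfl | rfl | rfl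
        · refine ⟨0, (t, 0), 0, h0, (dataXS.Y_eq (t, 0)).symm.trans ?_ |>.symm⟩
          simp only [dataXS, YY, xS_zero h7, mul_one]
        · refine ⟨0, (0, t), 0, h0, (dataXS.Y_eq (0, t)).symm.trans ?_ |>.symm⟩
          simp only [dataXS, YY, xS_zero h3, one_mul]
        exacts [hz 0, hz 1, hz 2, hz 3, hz 4, hz 5]
    intro h
    obtain ⟨v', w', u', hv', h'⟩ := hS h
    obtain ⟨rfl, -, -⟩ := dataXS.inj _ _ _ _ _ _ h'
    obtain ⟨v'', hv'', h''⟩ := (mem_X' a _).1 hv'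
    rwa [dataXS.X_injective h'']
  · intro h
    exact mul_mem (mul_mem (Subgroup.mem_sup_left ((mem_X' a _).2 ⟨v, h, rfl⟩))
      (Subgroup.mem_sup_right (YY_mem_YZ w))) (Subgroup.mem_sup_right (ZS_mem_YZ u))

/-- The groups `X'`, `Y'` and `H'` are the radicals of the pairing defined by `λ_a` and its
stabilizer. -/
def rad (a : Param K) : (dataXS (K := K)).Radicals (lam a) where
  X1 := X' a
  Y1 := Y' a
  H := H' a
  X_mem v := by
    rw [mem_X']
    exact ⟨fun ⟨v', hv', h⟩ => dataXS.X_injective h ▸ hv', fun h => ⟨v, h, rfl⟩⟩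
  Y_mem v := by
    rw [mem_Y']
    exact ⟨fun ⟨v', hv', h⟩ => dataXS.Y_injective h ▸ hv', fun h => ⟨v, h, rfl⟩⟩
  exists_X g hg := by
    obtain ⟨v, -, h⟩ := (mem_X' a g).1 hg
    exact ⟨v, h⟩
  exists_Y g hg := by
    obtain ⟨v, -, h⟩ := (mem_Y' a g).1 hg
    exact ⟨v, h⟩
  mem_H := mem_H' a

variable [Finite K]

instance : Finite (XS K) := HeisenbergData.Radicals.finite_group dataXS

/-- A label determines the character, with explicit values. -/
theorem hasLabel_iff (χ : XS K → ℂ) (a : Param K) (μ : X' a →* ℂˣ) (ν : Y' a →* ℂˣ) :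
    HasLabel χ a μ ν ↔ χ = (rad a).charFn μ ν := by
  constructor
  · rintro ⟨θ, hZ, hX, hY, rfl⟩
    refine HeisenbergData.Radicals.induce_linear (R := rad a) (θ := θ) ?_ hX hY
    have key : ∀ u, (θ ⟨ZS u, (rad a).Z_mem_H u⟩ : ℂ) = lam a u := by
      intro u
      induction u using ZS_induction with
      | h0 =>
        have : (⟨ZS 0, (rad a).Z_mem_H 0⟩ : H' a) = 1 := Subtype.ext ZS_zero
        rw [this, map_one, AddChar.map_zero_eq_one, Units.val_one]
      | hadd u u' hu hu' =>
        have : (⟨ZS (u + u'), (rad a).Z_mem_H (u + u')⟩ : H' a) =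
            ⟨ZS u, (rad a).Z_mem_H u⟩ * ⟨ZS u', (rad a).Z_mem_H u'⟩ := Subtype.ext (ZS_add u u')
        rw [this, map_mul, AddChar.map_add_eq_mul, Units.val_mul, hu, hu']
      | h1 l t =>
        obtain ⟨h6, h8, h9, h10, h12, h18⟩ := hZ ⟨ZS (Pi.single l t), (rad a).Z_mem_H _⟩ t
        rw [lam_single]
        have hl := ZS_single_eq_xS l t
        fin_cases l
        exacts [h6 hl, h8 hl, h9 hl, h10 hl, h12 hl, h18 hl]
    rintro ⟨_, hh⟩ u rfl
    exact key u
  · rintro rfl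
    obtain ⟨θ, hZ, hX, hY⟩ := (rad a).exists_linear μ ν
    have key : ∀ (h : H' a) l t, (h : XS K) = xS (zn l) t → (θ h : ℂ) = phi (a.vec l * t) := by
      intro h l t hh
      rw [hZ h (Pi.single l t) (hh.trans (ZS_single_eq_xS l t).symm), lam_single]
    exact ⟨θ, fun h t => ⟨key h 0 t, key h 1 t, key h 2 t, key h 3 t, key h 4 t, key h 5 t⟩, hX, hY,
      (HeisenbergData.Radicals.induce_linear (R := rad a) hZ hX hY).symm⟩

theorem hasParam_charFn (a : Param K) (μ : X' a →* ℂˣ) (ν : Y' a →* ℂˣ) :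
    HasParam ((rad a).charFn μ ν) a := by
  rw [hasParam_iff]
  intro l t
  have h := (rad a).charFn_Z μ ν (Pi.single l t)
  rw [← (rad a).charFn_one μ ν, lam_single] at h
  exact h

theorem mem_coreZ_iff (γ : Fin 24) : γ ∈ coreZ ↔ ∃ l, γ = zr l := by
  revert γ; decide

theorem mem_F11_iff (χ : XS K → ℂ) :
    χ ∈ F11 K ↔ χ ∈ IrrChar (XS K) ∧ ∀ l, ∃ t : K, χ (ZS (Pi.single l t)) ≠ χ 1 := by
  simp only [F11, Quattern.Irr, Set.mem_setOf_eq, mem_coreZ_iff, ZS_single]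
  refine and_congr_right fun _ => ⟨fun h l => h _ ⟨l, rfl⟩, ?_⟩
  rintro h _ ⟨l, rfl⟩
  exact h l

theorem charFn_mem_F11 (a : Param K) (μ : X' a →* ℂˣ) (ν : Y' a →* ℂˣ) :
    (rad a).charFn μ ν ∈ F11 K := by
  refine (mem_F11_iff _).2 ⟨(rad a).charFn_mem_irrChar μ ν, fun l => ?_⟩
  have h := (hasParam_iff _ _).1 (hasParam_charFn a μ ν) l
  by_contra hcon
  push Not at hcon
  refine (a.vec l).ne_zero (eq_zero_of_phi fun t => ?_)
  have h2 := h t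
  rw [hcon t] at h2
  have h3 := IrrChar.one_ne_zero ((rad a).charFn_mem_irrChar μ ν)
  exact mul_left_cancel₀ h3 (by rw [mul_one]; exact h2.symm)

/-- By Schur's lemma the central subgroup `X_Z` acts through a linear character, which is nontrivial
on each root subgroup. -/
theorem exists_hasParam {χ : XS K → ℂ} (hχ : χ ∈ F11 K) : ∃ a, HasParam χ a := by
  obtain ⟨hirr, hnt⟩ := (mem_F11_iff χ).1 hχ
  obtain ⟨c, hc⟩ : ∃ c : AddChar (Fin 6 → K) ℂ, ∀ u, χ (ZS u) = χ 1 * c u :=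
    dataXS.exists_centralChar hirr
  have key : ∀ l, ∃ a : Kˣ, ∀ t, χ (ZS (Pi.single l t)) = χ 1 * phi (a * t) := by
    intro l
    obtain ⟨a, ha⟩ := exists_eq_phi_mul
      (c.compAddMonoidHom (AddMonoidHom.single (fun _ : Fin 6 => K) l))
    have hval : ∀ t, χ (ZS (Pi.single l t)) = χ 1 * phi (a * t) := fun t => by
      rw [← ha]; exact hc _
    have ha0 : a ≠ 0 := by
      rintro rfl
      obtain ⟨t, ht⟩ := hnt l
      rw [hval, zero_mul, phi_zero, mul_one] at ht
      exact ht rfl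
    exact ⟨Units.mk0 a ha0, hval⟩
  choose a ha using key
  refine ⟨paramEquiv.symm a, (hasParam_iff _ _).2 fun l t => ?_⟩
  have : (paramEquiv.symm a).vec = a := paramEquiv.apply_symm_apply a
  rw [this, ha]

theorem hasParam_unique {χ : XS K → ℂ} (h1 : χ 1 ≠ 0) {a b : Param K} (ha : HasParam χ a)
    (hb : HasParam χ b) : a = b := by
  rw [hasParam_iff] at ha hb
  refine paramEquiv.injective (funext fun l => Units.ext (phi_mul_injective fun t => ?_))
  exact mul_left_cancel₀ h1 ((ha l t).symm.trans (hb l t))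

theorem exists_label {χ : XS K → ℂ} (hχ : χ ∈ F11 K) {a : Param K} (ha : HasParam χ a) :
    ∃ μ ν, χ = (rad a).charFn μ ν := by
  have hirr := ((mem_F11_iff χ).1 hχ).1
  refine (rad a).exists_eq_charFn hirr fun u => ?_
  obtain ⟨c, hc⟩ : ∃ c : AddChar (Fin 6 → K) ℂ, ∀ u, χ (ZS u) = χ 1 * c u :=
    dataXS.exists_centralChar hirr
  have h1 := IrrChar.one_ne_zero hirr
  rw [hasParam_iff] at ha
  have key : c u = lam a u := by
    induction u using ZS_induction with
    | h0 => rw [AddChar.map_zero_eq_one, AddChar.map_zero_eq_one]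
    | hadd u u' hu hu' => rw [AddChar.map_add_eq_mul, AddChar.map_add_eq_mul, hu, hu']
    | h1 l t =>
      rw [lam_single]
      exact mul_left_cancel₀ h1 ((hc _).symm.trans (ha l t))
  rw [← key]
  exact hc u

theorem exists_hasLabel {χ : XS K → ℂ} (hχ : χ ∈ F11 K) :
    ∃ (a : Param K) (μ : X' a →* ℂˣ) (ν : Y' a →* ℂˣ), HasLabel χ a μ ν := by
  have h1 := exists_hasParam hχ
  obtain ⟨a, ha⟩ := h1
  have h2 := exists_label hχ ha
  obtain ⟨μ, ν, h⟩ := h2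
  exact ⟨a, μ, ν, (hasLabel_iff χ a μ ν).2 h⟩

theorem hasLabel_unique {χ : XS K → ℂ} (hχ : χ ∈ F11 K) {a : Param K} {μ : X' a →* ℂˣ}
    {ν : Y' a →* ℂˣ} (h : HasLabel χ a μ ν) {b : Param K} {μ' : X' b →* ℂˣ}
    {ν' : Y' b →* ℂˣ} (h' : HasLabel χ b μ' ν') :
    (⟨b, (μ', ν')⟩ : (a : Param K) × ((X' a →* ℂˣ) × (Y' a →* ℂˣ))) = ⟨a, (μ, ν)⟩ := by
  replace h := (hasLabel_iff χ a μ ν).1 h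
  replace h' := (hasLabel_iff χ b μ' ν').1 h'
  have ha : HasParam χ a := h ▸ hasParam_charFn a μ ν
  have hb : HasParam χ b := h' ▸ hasParam_charFn b μ' ν'
  have hab := hasParam_unique (IrrChar.one_ne_zero ((mem_F11_iff χ).1 hχ).1) ha hb
  subst hab
  have h2 := (rad a).charFn_injective (h.symm.trans h')
  rw [h2.1, h2.2]

theorem existsUnique_label {χ : XS K → ℂ} (hχ : χ ∈ F11 K) :
    ∃! l : (a : Param K) × ((X' a →* ℂˣ) × (Y' a →* ℂˣ)), HasLabel χ l.1 l.2.1 l.2.2 := by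
  have h0 := exists_hasLabel hχ
  refine h0.elim fun a ha => ha.elim fun μ hμ => hμ.elim fun ν h => ?_
  refine ExistsUnique.intro (⟨a, (μ, ν)⟩ : (a : Param K) × ((X' a →* ℂˣ) × (Y' a →* ℂˣ))) h ?_
  intro l h'
  exact hasLabel_unique hχ h h'

end labels

end UF4

/-! ### Numbers of linear characters -/

theorem card_monoidHom_units_of_comm {G : Type*} [Group G] [Finite G]
    (h : ∀ a b : G, a * b = b * a) : Nat.card (G →* ℂˣ) = Nat.card G :=
  letI : CommGroup G := { ‹Group G› with mul_comm := h }
  CommGroup.card_monoidHom_of_hasEnoughRootsOfUnity G ℂ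

namespace HeisenbergData.Radicals

variable {V W U G : Type*} [AddCommGroup V] [AddCommGroup W] [AddCommGroup U] [Group G]
  {D : HeisenbergData V W U G} {ψ : AddChar U ℂ} (R : D.Radicals ψ)

theorem card_dual_X1 [Finite V] : Nat.card (R.X1 →* ℂˣ) = Nat.card R.X1 := by
  have : Finite R.X1 := Finite.of_equiv _ R.xEquiv
  refine card_monoidHom_units_of_comm fun a b => Subtype.ext ?_
  obtain ⟨v, hv⟩ := R.exists_X a a.2
  obtain ⟨w, hw⟩ := R.exists_X b b.2
  rw [Subgroup.coe_mul, Subgroup.coe_mul, hv, hw, ← D.X_add, ← D.X_add, add_comm]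

theorem card_dual_Y1 [Finite W] : Nat.card (R.Y1 →* ℂˣ) = Nat.card R.Y1 := by
  have : Finite R.Y1 := Finite.of_equiv _ R.yEquiv
  refine card_monoidHom_units_of_comm fun a b => Subtype.ext ?_
  obtain ⟨v, hv⟩ := R.exists_Y a a.2
  obtain ⟨w, hw⟩ := R.exists_Y b b.2
  rw [Subgroup.coe_mul, Subgroup.coe_mul, hv, hw, ← D.Y_add, ← D.Y_add, add_comm]

end HeisenbergData.Radicals

namespace UF4

/-! ### The sizes of the subfamilies -/

section families

variable {K : Type*} [Field K] [CharP K 2] [Finite K]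

/-- The two radicals have the same order, since `V` and `W` are both `K × K`. -/
theorem card_X'_eq_card_Y' (a : Param K) : Nat.card (X' a) = Nat.card (Y' a) := by
  have h := (rad a).card_mul_card
  rw [mul_comm] at h
  exact Nat.eq_of_mul_eq_mul_left Nat.card_pos h

instance (a : Param K) : Finite (X' a →* ℂˣ) :=
  Nat.finite_of_card_ne_zero ((rad a).card_dual_X1.trans_ne Nat.card_pos.ne')

instance (a : Param K) : Finite (Y' a →* ℂˣ) :=
  Nat.finite_of_card_ne_zero ((rad a).card_dual_Y1.trans_ne Nat.card_pos.ne')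

/-- The characters in a subfamily are parametrized by their labels. -/
theorem charFn_bijective (C : Param K → Prop) :
    Function.Bijective (fun p : (a : {a : Param K // C a}) × ((X' a.1 →* ℂˣ) × (Y' a.1 →* ℂˣ)) =>
      (⟨(rad p.1.1).charFn p.2.1 p.2.2, charFn_mem_F11 _ _ _, p.1.1, hasParam_charFn _ _ _, p.1.2⟩ :
        subfamily C)) := by
  constructor
  · rintro ⟨⟨a, ha⟩, μ, ν⟩ ⟨⟨b, hb⟩, μ', ν'⟩ h
    have h0 : (rad a).charFn μ ν = (rad b).charFn μ' ν' := congrArg Subtype.val h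
    have h1 := hasParam_charFn a μ ν
    have h2 : HasParam ((rad a).charFn μ ν) b := h0 ▸ hasParam_charFn b μ' ν'
    have h3 := IrrChar.one_ne_zero ((rad a).charFn_mem_irrChar μ ν)
    have hab := hasParam_unique h3 h1 h2
    subst hab
    have h4 := (rad a).charFn_injective h0
    rw [h4.1, h4.2]
  · rintro ⟨χ, hχ, a, ha, hC⟩
    refine (exists_label hχ ha).elim fun μ hμ => hμ.elim fun ν h => ?_
    exact ⟨⟨⟨a, hC⟩, (μ, ν)⟩, Subtype.ext h.symm⟩

theorem finite_F11 : (F11 K).Finite := by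
  have h : F11 K = subfamily (fun _ => True) := by
    ext χ
    exact ⟨fun h => ⟨h, (exists_hasParam h).elim fun a ha => ⟨a, ha, trivial⟩⟩, fun h => h.1⟩
  rw [h]
  have := Finite.of_surjective _ (charFn_bijective (K := K) (fun _ => True)).2
  exact Set.toFinite _

/-- A parameter contributes `|X'| |Y'| = k²` characters. -/
theorem ncard_subfamily (C : Param K → Prop) (k : ℕ) (hk : ∀ a, C a → Nat.card (Y' a) = k) :
    (subfamily C).ncard = Nat.card {a : Param K // C a} * k ^ 2 := by
  have := Fintype.ofFinite {a : Param K // C a}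
  rw [← Nat.card_coe_set_eq, ← Nat.card_eq_of_bijective _ (charFn_bijective C), Nat.card_sigma]
  have h : ∀ a : {a : Param K // C a},
      Nat.card ((X' a.1 →* ℂˣ) × (Y' a.1 →* ℂˣ)) = k ^ 2 := by
    intro a
    have h1 : Nat.card (X' a.1 →* ℂˣ) = _ := (rad a.1).card_dual_X1
    have h2 : Nat.card (Y' a.1 →* ℂˣ) = _ := (rad a.1).card_dual_Y1
    have h3 : Nat.card (Y' a.1) = k := hk a.1 a.2
    rw [Nat.card_prod, h1, h2]
    change Nat.card (X' a.1) * Nat.card (Y' a.1) = _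
    rw [card_X'_eq_card_Y', h3, sq]
  rw [Finset.sum_congr rfl fun a _ => h a, Finset.sum_const, Finset.card_univ, smul_eq_mul,
    Nat.card_eq_fintype_card]

/-- The degree of a character is `|V| / |X'|`, with `V = K × K`. -/
theorem apply_one_of_mem_subfamily {C : Param K → Prop} {k : ℕ}
    (hk : ∀ a, C a → Nat.card (Y' a) = k) {χ : XS K → ℂ} (hχ : χ ∈ subfamily C) :
    χ 1 = (Nat.card K : ℂ) ^ 2 / k := by
  obtain ⟨hF, a, ha, hC⟩ := hχ
  refine (exists_label hF ha).elim fun μ hμ => hμ.elim fun ν h => ?_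
  have h1 := (rad a).charFn_one μ ν
  rw [h, h1, Nat.card_prod, ← hk a hC, ← card_X'_eq_card_Y']
  push_cast
  rw [sq]
  rfl

theorem disjoint_subfamily {C C' : Param K → Prop} (h : ∀ a, C a → ¬ C' a) :
    Disjoint (subfamily C) (subfamily C') := by
  rw [Set.disjoint_left]
  rintro χ ⟨hF, a, ha, hC⟩ ⟨-, b, hb, hC'⟩
  have hab := hasParam_unique (IrrChar.one_ne_zero ((mem_F11_iff χ).1 hF).1) ha hb
  subst hab
  exact h a hC hC'

theorem F11_eq_iUnion {ι : Type*} {C : ι → Param K → Prop} (h : ∀ a, ∃ i, C i a) :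
    F11 K = ⋃ i, subfamily (C i) := by
  ext χ
  rw [Set.mem_iUnion]
  constructor
  · intro hχ
    obtain ⟨a, ha⟩ := exists_hasParam hχ
    obtain ⟨i, hi⟩ := h a
    exact ⟨i, hχ, a, ha, hi⟩
  · rintro ⟨i, hχ, -⟩
    exact hχ

end families

/-! ### The cubic equation that describes `Y'` -/

section cubic

variable {K : Type*} [Field K]

/-- The roots of the cubic `X³ + A X + B`. -/
def cubicRoots (A B : K) : Set K := {x | x ^ 3 + A * x + B = 0}

/-- The normalized linear coefficient `d / b³ + 1` of the cubic: the substitution `X = b Z`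
transforms `X³ + (d/b + b²) X + (d + c)` into `b³ (Z³ + (d/b³ + 1) Z + (c + d)/b³)`. -/
def Param.A (a : Param K) : K := a.d / a.b ^ 3 + 1

/-- The normalized constant coefficient of the cubic. -/
def Param.B (a : Param K) : K := (a.c + a.d) / a.b ^ 3

theorem Param.b_ne_zero (a : Param K) : a.b ≠ 0 :=
  div_ne_zero a.a6.ne_zero a.a9.ne_zero

theorem Param.c_ne_zero (a : Param K) : a.c ≠ 0 := by
  simp [Param.c]

theorem Param.d_ne_zero (a : Param K) : a.d ≠ 0 := by
  simp [Param.d]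

theorem Param.numRoots_eq (a : Param K) : a.numRoots = (cubicRoots a.A a.B).ncard := by
  have hb := a.b_ne_zero
  have h : {z : K | z ^ 3 + (a.d / a.b + a.b ^ 2) * z + (a.d + a.c) = 0} =
      (a.b * ·) '' cubicRoots a.A a.B := by
    have key : ∀ x, (a.b * x) ^ 3 + (a.d / a.b + a.b ^ 2) * (a.b * x) + (a.d + a.c) =
        a.b ^ 3 * (x ^ 3 + a.A * x + a.B) := by
      intro x
      rw [Param.A, Param.B]
      field_simp
      ring
    ext z
    simp only [Set.mem_setOf_eq, Set.mem_image, cubicRoots]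
    constructor
    · intro hz
      refine ⟨a.b⁻¹ * z, ?_, mul_inv_cancel_left₀ hb z⟩
      have h1 := key (a.b⁻¹ * z)
      rw [mul_inv_cancel_left₀ hb, hz, eq_comm, mul_eq_zero] at h1
      exact h1.resolve_left (pow_ne_zero _ hb)
    · rintro ⟨x, hx, rfl⟩
      rw [key, hx, mul_zero]
  rw [Param.numRoots, h, Set.ncard_image_of_injective _ (mul_right_injective₀ hb)]

variable [CharP K 2]

theorem Param.A_eq_zero_iff (a : Param K) : a.A = 0 ↔ a.d = a.b ^ 3 := by
  rw [Param.A, CharTwo.add_eq_zero, div_eq_one_iff_eq (pow_ne_zero _ a.b_ne_zero)]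

theorem Param.B_eq_zero_iff (a : Param K) : a.B = 0 ↔ a.c = a.d := by
  rw [Param.B, div_eq_zero_iff, CharTwo.add_eq_zero]
  simp [a.b_ne_zero]

theorem Param.A_ne_one (a : Param K) : a.A ≠ 1 := by
  rw [Param.A, Ne, add_eq_right]
  exact div_ne_zero a.d_ne_zero (pow_ne_zero _ a.b_ne_zero)

theorem Param.B_ne (a : Param K) : a.B ≠ a.A + 1 := by
  rw [Param.B, Param.A, add_assoc, CharTwo.add_self_eq_zero, add_zero, add_div, Ne, add_eq_right]
  exact div_ne_zero a.c_ne_zero (pow_ne_zero _ a.b_ne_zero)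

/-- The condition that `c + b³` is a cube, for the normalized cubic, which is `X³ + B` when
`d = b³`. -/
theorem Param.exists_cube_iff (a : Param K) (h : a.d = a.b ^ 3) :
    (∃ y : K, y ^ 3 = a.c + a.b ^ 3) ↔ (cubicRoots 0 a.B).Nonempty := by
  have hb := a.b_ne_zero
  have h1 : a.c + a.b ^ 3 = a.b ^ 3 * a.B := by
    rw [Param.B, h]
    field_simp
  rw [h1]
  constructor
  · rintro ⟨y, hy⟩
    refine ⟨y / a.b, ?_⟩
    rw [cubicRoots, Set.mem_setOf_eq, div_pow, hy, zero_mul, add_zero,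
      mul_div_cancel_left₀ _ (pow_ne_zero _ hb), CharTwo.add_self_eq_zero]
  · rintro ⟨x, hx⟩
    rw [cubicRoots, Set.mem_setOf_eq, zero_mul, add_zero, CharTwo.add_eq_zero] at hx
    exact ⟨a.b * x, by rw [mul_pow, hx]⟩

theorem exists_sq_eq [Finite K] (a : K) : ∃ s, s ^ 2 = a := by
  have := Fintype.ofFinite K
  obtain ⟨s, hs⟩ := FiniteField.isSquare_of_char_two
    (CharP.ringChar_of_prime_eq_zero Nat.prime_two (CharP.cast_eq_zero K 2)) a
  exact ⟨s, by rw [sq, hs]⟩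

section sizes

variable [Finite K]

/-- The elements of `Y'` correspond to the solutions of a quartic equation: the second coordinate
is determined by the first. -/
theorem card_Y' (a : Param K) :
    Nat.card (Y' a) = {x : K | x * (x ^ 3 + a.A * x + a.B) = 0}.ncard := by
  have hb := a.b_ne_zero
  -- membership in `Y'` amounts to two equations, the coefficients of `v.1` and `v.2` in `λ_a`
  have h1 : ∀ w : K × K, YY w ∈ Y' a ↔
      a.a9 * w.1 ^ 2 + a.a6 * w.1 + a.a10 * w.2 = 0 ∧
        a.a18 * w.2 ^ 2 + a.a12 * w.2 + a.a8 * w.1 = 0 := by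
    intro w
    have h2 : YY w ∈ Y' a ↔ ∀ v, lam a (bracket v w) = 1 := (rad a).Y_mem w
    have h3 : ∀ v : K × K, ∑ l, (a.vec l : K) * bracket v w l =
        (a.a9 * w.1 ^ 2 + a.a6 * w.1 + a.a10 * w.2) * v.1 +
          (a.a18 * w.2 ^ 2 + a.a12 * w.2 + a.a8 * w.1) * v.2 := by
      intro v
      simp [Fin.sum_univ_six, Param.vec, bracket, r2, r5]
      ring
    rw [h2]
    simp only [lam_apply, h3]
    constructor
    · intro h
      exact ⟨eq_zero_of_phi fun t => by simpa using h (t, 0),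
        eq_zero_of_phi fun t => by simpa using h (0, t)⟩
    · rintro ⟨h4, h5⟩ v
      rw [h4, h5, zero_mul, zero_mul, add_zero, phi_zero]
  -- the point of `Y'` that corresponds to a solution `x`
  let g : K → K × K := fun x => (a.b * x, a.a9 * a.b ^ 2 * (x ^ 2 + x) / a.a10)
  have hg : Function.Injective g := fun x y h => mul_left_cancel₀ hb (congrArg Prod.fst h)
  have h6 : ∀ w : K × K, YY w ∈ Y' a ↔ ∃ x : K, x * (x ^ 3 + a.A * x + a.B) = 0 ∧ g x = w := by
    have h9 : (a.a9 : K) ≠ 0 := a.a9.ne_zero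
    have h10 : (a.a10 : K) ≠ 0 := a.a10.ne_zero
    have h18 : (a.a18 : K) ≠ 0 := a.a18.ne_zero
    have h66 : (a.a6 : K) ≠ 0 := a.a6.ne_zero
    have ha6 : (a.a6 : K) = a.b * a.a9 := by rw [Param.b]; field_simp
    have ha8 : (a.a8 : K) = a.c * a.a9 ^ 2 * a.a18 / a.a10 ^ 2 := by rw [Param.c]; field_simp
    have ha12 : (a.a12 : K) = a.d * a.a9 * a.a18 / (a.a10 * a.b) := by
      rw [Param.d, Param.b]; field_simp
    have key : ∀ x, a.a18 * (g x).2 ^ 2 + a.a12 * (g x).2 + a.a8 * (g x).1 =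
        a.a9 ^ 2 * a.a18 * a.b ^ 4 / a.a10 ^ 2 * (x * (x ^ 3 + a.A * x + a.B)) := by
      intro x
      have h2 : (x ^ 2 + x) ^ 2 = x ^ 4 + x ^ 2 := by
        rw [CharTwo.add_sq]
        ring
      simp only [g, Param.A, Param.B, ha12, ha8, mul_pow, div_pow, h2]
      field_simp
      ring
    intro w
    rw [h1]
    constructor
    · rintro ⟨h2, h3⟩
      have h4 : g (w.1 / a.b) = w := by
        refine Prod.ext (mul_div_cancel₀ _ hb) ?_
        simp only [g]
        rw [ha6] at h2
        rw [CharTwo.add_eq_zero] at h2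
        rw [div_eq_iff h10, mul_comm w.2, ← h2]
        field_simp
      refine ⟨w.1 / a.b, ?_, h4⟩
      have h5 := key (w.1 / a.b)
      rw [h4, h3, eq_comm, mul_eq_zero] at h5
      refine h5.resolve_left ?_
      simp [hb]
    · rintro ⟨x, hx, rfl⟩
      refine ⟨?_, by rw [key, hx, mul_zero]⟩
      have : (a.a9 : K) * (g x).1 ^ 2 + a.a6 * (g x).1 + a.a10 * (g x).2 =
          2 * (a.a9 * a.b ^ 2 * (x ^ 2 + x)) := by
        simp only [g, ha6]
        field_simp
        ring
      rw [this, CharTwo.two_eq_zero, zero_mul]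
  have h7 : {w : K × K | YY w ∈ Y' a} = g '' {x : K | x * (x ^ 3 + a.A * x + a.B) = 0} := by
    ext w
    rw [Set.mem_setOf_eq, h6]
    rfl
  rw [← Set.ncard_image_of_injective _ hg, ← h7, ← Nat.card_coe_set_eq]
  exact (Nat.card_congr (rad a).yEquiv).symm

/-- For `B ≠ 0` the solutions of the quartic equation are `0` and the roots of the cubic. -/
theorem card_Y'_of_ne (a : Param K) (h : a.B ≠ 0) :
    Nat.card (Y' a) = (cubicRoots a.A a.B).ncard + 1 := by
  have h0 : (0 : K) ∉ cubicRoots a.A a.B := by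
    simpa [cubicRoots] using h
  rw [card_Y', ← Set.ncard_insert_of_notMem h0]
  congr 1
  ext x
  simp [cubicRoots, mul_eq_zero]

theorem card_Y'_eq_one (a : Param K) (hA : a.A = 0) (hB : a.B = 0) : Nat.card (Y' a) = 1 := by
  rw [card_Y', hA, hB, Set.ncard_eq_one]
  refine ⟨0, ?_⟩
  ext x
  simp

theorem card_Y'_eq_two (a : Param K) (hA : a.A ≠ 0) (hB : a.B = 0) : Nat.card (Y' a) = 2 := by
  obtain ⟨s, hs⟩ : ∃ s, s ^ 2 = a.A := exists_sq_eq _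
  have hs0 : s ≠ 0 := by
    rintro rfl
    exact hA (by rw [← hs]; ring)
  rw [card_Y', hB, Set.ncard_eq_two]
  refine ⟨0, s, hs0.symm, ?_⟩
  ext x
  have h : x * (x ^ 3 + a.A * x + 0) = x ^ 2 * (x + s) ^ 2 := by
    rw [← hs]
    have : (2 : K) = 0 := CharTwo.two_eq_zero
    linear_combination (- x ^ 3 * s) * this
  rw [Set.mem_setOf_eq, h]
  simp [CharTwo.add_eq_zero]

end sizes

section scaling

/-- The parameters correspond to four free units, namely `a₉`, `a₁₀`, `a₁₈` and `b`, and the pair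
`(A, B)` of normalized coefficients. The conditions `A ≠ 1` and `B ≠ A + 1` express that `d` and `c`
are not zero. -/
def scaleEquiv : Param K ≃ (Kˣ × Kˣ × Kˣ × Kˣ) × {p : K × K // p.1 ≠ 1 ∧ p.2 ≠ p.1 + 1} where
  toFun a := ((a.a9, a.a10, a.a18, a.a6 / a.a9), ⟨(a.A, a.B), a.A_ne_one, a.B_ne⟩)
  invFun p :=
    { a6 := p.1.2.2.2 * p.1.1
      a8 := Units.mk0 (p.2.1.1 + p.2.1.2 + 1) (by
          intro h
          refine p.2.2.2 (CharTwo.add_eq_zero.1 ?_)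
          rw [← h]; ring) *
        p.1.2.2.2 ^ 3 * p.1.1 ^ 2 * p.1.2.2.1 / p.1.2.1 ^ 2
      a9 := p.1.1
      a10 := p.1.2.1
      a12 := Units.mk0 (p.2.1.1 + 1) (fun h => p.2.2.1 (CharTwo.add_eq_zero.1 h)) *
        p.1.2.2.2 ^ 2 * p.1.1 * p.1.2.2.1 / p.1.2.1
      a18 := p.1.2.2.1 }
  left_inv a := by
    have h6 : (a.a6 : K) ≠ 0 := a.a6.ne_zero
    have h9 : (a.a9 : K) ≠ 0 := a.a9.ne_zero
    have h10 : (a.a10 : K) ≠ 0 := a.a10.ne_zero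
    have h18 : (a.a18 : K) ≠ 0 := a.a18.ne_zero
    have hA : a.A + 1 = a.d / a.b ^ 3 := by
      rw [Param.A, add_assoc, CharTwo.add_self_eq_zero, add_zero]
    have hB : a.A + a.B + 1 = a.c / a.b ^ 3 := by
      rw [add_right_comm, hA, Param.B, add_div, add_left_comm, CharTwo.add_self_eq_zero, add_zero]
    ext
    · simp
    · simp only [Units.val_mul, Units.val_div_eq_div_val, Units.val_mk0, hB,
        Units.val_pow_eq_pow_val]
      rw [Param.c, Param.b]
      field_simp
    · rfl
    · rfl
    · simp only [Units.val_mul, Units.val_div_eq_div_val, Units.val_mk0, hA,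
        Units.val_pow_eq_pow_val]
      rw [Param.d, Param.b]
      field_simp
    · rfl
  right_inv p := by
    obtain ⟨⟨a9, a10, a18, b⟩, ⟨⟨A, B⟩, h1, h2⟩⟩ := p
    have h9 : (a9 : K) ≠ 0 := a9.ne_zero
    have h10 : (a10 : K) ≠ 0 := a10.ne_zero
    have h18 : (a18 : K) ≠ 0 := a18.ne_zero
    have hb : (b : K) ≠ 0 := b.ne_zero
    have h0 : b * a9 / a9 = b := by simp
    refine Prod.ext (Prod.ext rfl (Prod.ext rfl (Prod.ext rfl h0))) (Subtype.ext ?_)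
    have h3 : (A + 1) + 1 = A := by rw [add_assoc, CharTwo.add_self_eq_zero, add_zero]
    have h4 : (A + B + 1) + (A + 1) = B := by
      have : (A + B + 1) + (A + 1) = B + 2 * (A + 1) := by ring
      rw [this, CharTwo.two_eq_zero, zero_mul, add_zero]
    refine Prod.ext (Eq.trans ?_ h3) (Eq.trans ?_ h4)
    · simp only [Param.A, Param.d, Param.b, Units.val_mul, Units.val_div_eq_div_val, Units.val_mk0,
        Units.val_pow_eq_pow_val]
      congr 1
      field_simp
    · simp only [Param.B, Param.c, Param.d, Param.b, Units.val_mul, Units.val_div_eq_div_val,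
        Units.val_mk0, Units.val_pow_eq_pow_val]
      field_simp

/-- The number of parameters with a given condition on the normalized coefficients `(A, B)`. -/
theorem card_param [Finite K] (Q : K → K → Prop) :
    Nat.card {a : Param K // Q a.A a.B} =
      (Nat.card K - 1) ^ 4 * {p : K × K | p.1 ≠ 1 ∧ p.2 ≠ p.1 + 1 ∧ Q p.1 p.2}.ncard := by
  have e : {a : Param K // Q a.A a.B} ≃ (Kˣ × Kˣ × Kˣ × Kˣ) ×
      {p : K × K | p.1 ≠ 1 ∧ p.2 ≠ p.1 + 1 ∧ Q p.1 p.2} :=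
    { toFun := fun a => ((scaleEquiv a.1).1, ⟨(scaleEquiv a.1).2.1, (scaleEquiv a.1).2.2.1,
        (scaleEquiv a.1).2.2.2, a.2⟩)
      invFun := fun p => ⟨scaleEquiv.symm (p.1, ⟨p.2.1, p.2.2.1, p.2.2.2.1⟩), by
        have h := scaleEquiv.apply_symm_apply (p.1, ⟨p.2.1, p.2.2.1, p.2.2.2.1⟩)
        have h2 := congrArg (fun x => x.2.1) h
        have h3 := p.2.2.2.2
        have h4 : ((scaleEquiv.symm (p.1, ⟨p.2.1, p.2.2.1, p.2.2.2.1⟩)).A,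
          (scaleEquiv.symm (p.1, ⟨p.2.1, p.2.2.1, p.2.2.2.1⟩)).B) = (p.2 : K × K) := h2
        rw [← h4] at h3
        exact h3⟩
      left_inv := fun a => Subtype.ext (scaleEquiv.symm_apply_apply a.1)
      right_inv := fun p => by
        have h := scaleEquiv.apply_symm_apply (p.1, ⟨p.2.1, p.2.2.1, p.2.2.2.1⟩)
        have h1 := congrArg Prod.fst h
        have h2 := congrArg (fun x => x.2.1) h
        exact Prod.ext h1 (Subtype.ext h2) }
  rw [Nat.card_congr e, Nat.card_prod, Nat.card_prod, Nat.card_prod, Nat.card_prod, Nat.card_units,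
    Nat.card_coe_set_eq]
  ring

end scaling

end cubic

/-! ### Counting cubics by their number of roots -/

section counting

open Finset

variable {K : Type*} [Field K] [CharP K 2]

/-- Two distinct roots determine the coefficients; the third root is `x + y`, as the cubic has no
quadratic term. -/
theorem cubic_of_two_roots {A B x y : K} (hx : x ^ 3 + A * x + B = 0) (hy : y ^ 3 + A * y + B = 0)
    (hxy : x ≠ y) : A = x ^ 2 + x * y + y ^ 2 ∧ B = x * y * (x + y) := by
  have h2 : (2 : K) = 0 := CharTwo.two_eq_zero
  have h3 : x + y ≠ 0 := fun h => hxy (CharTwo.add_eq_zero.1 h)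
  have hA : A = x ^ 2 + x * y + y ^ 2 := by
    refine mul_left_cancel₀ h3 ?_
    linear_combination hx + hy - (x ^ 3 + y ^ 3 + x ^ 2 * y + x * y ^ 2 + B) * h2
  refine ⟨hA, ?_⟩
  rw [hA] at hx
  linear_combination hx - (x ^ 3 + x ^ 2 * y + x * y ^ 2) * h2

variable [Fintype K] [DecidableEq K]

/-- The roots of `X³ + A X + B` as a finite set. -/
def rts (A B : K) : Finset K := univ.filter fun x => x ^ 3 + A * x + B = 0

omit [CharP K 2] in
theorem mem_rts {A B x : K} : x ∈ rts A B ↔ x ^ 3 + A * x + B = 0 := by simp [rts]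

omit [CharP K 2] in
theorem ncard_cubicRoots (A B : K) : (cubicRoots A B).ncard = (rts A B).card := by
  rw [← Set.ncard_coe_finset]
  congr 1
  ext x
  simp [mem_rts, cubicRoots]

/-- A cubic `X³ + A X + B` with `B ≠ 0` has `0`, `1` or `3` roots: the sum of two roots is a
root. -/
theorem card_rts (A : K) {B : K} (hB : B ≠ 0) :
    (rts A B).card = 0 ∨ (rts A B).card = 1 ∨ (rts A B).card = 3 := by
  have h2 : (2 : K) = 0 := CharTwo.two_eq_zero
  by_cases h : 1 < (rts A B).card
  · right; right
    obtain ⟨x, hx, y, hy, hxy⟩ := one_lt_card.1 h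
    rw [mem_rts] at hx hy
    obtain ⟨rfl, rfl⟩ := cubic_of_two_roots hx hy hxy
    have hx0 : x ≠ 0 := by rintro rfl; simp at hB
    have hy0 : y ≠ 0 := by rintro rfl; simp at hB
    refine card_eq_three.2 ⟨x, y, x + y, hxy, ?_, ?_, ?_⟩
    · intro h; exact hy0 (by simpa using h)
    · intro h; exact hx0 (by simpa using h)
    · ext z
      have h3 : z ^ 3 + (x ^ 2 + x * y + y ^ 2) * z + x * y * (x + y) =
          (z + x) * (z + y) * (z + (x + y)) := by
        linear_combination (- z ^ 2 * x - z ^ 2 * y - x * y * z) * h2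
      rw [mem_rts, h3]
      simp [CharTwo.add_eq_zero, or_assoc]
  · omega

/-- The pairs `(A, B)` that occur for parameters with `A ≠ 0` and `B ≠ 0`, that is, for `d ≠ b³` and
`c ≠ d`. -/
def generic (K : Type*) [Field K] [Fintype K] [DecidableEq K] : Finset (K × K) :=
  univ.filter fun p => p.1 ≠ 0 ∧ p.1 ≠ 1 ∧ p.2 ≠ 0 ∧ p.2 ≠ p.1 + 1

/-- The primitive cube roots of unity in `K`. -/
def cubeRts (K : Type*) [Field K] [Fintype K] [DecidableEq K] : Finset K :=
  univ.filter fun x => x ^ 2 + x + 1 = 0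

omit [CharP K 2] in
theorem mem_cubeRts {x : K} : x ∈ cubeRts K ↔ x ^ 2 + x + 1 = 0 := by simp [cubeRts]

omit [CharP K 2] in
/-- The complement of a set given by distinct elements. -/
theorem card_filter_notMem (s : Finset K) :
    ((univ.filter fun x => x ∉ s).card : ℤ) = Fintype.card K - s.card := by
  have h := card_compl s
  have h2 := card_le_univ s
  have h3 : (univ.filter fun x => x ∉ s) = sᶜ := by ext; simp
  rw [h3, h]
  push_cast [h2]
  rfl

/-- For given `A ≠ 0, 1`, the coefficient `B` avoids the distinct elements `0` and `A + 1`. -/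
theorem card_generic : ((generic K).card : ℤ) = (Fintype.card K - 2) ^ 2 := by
  have h : (generic K).card = ∑ A ∈ univ.filter (fun A : K => A ∉ ({0, 1} : Finset K)),
      (univ.filter fun B => B ∉ ({0, A + 1} : Finset K)).card := by
    rw [generic, card_eq_sum_card_fiberwise (f := Prod.fst)
      (t := univ.filter (fun A : K => A ∉ ({0, 1} : Finset K)))]
    · refine sum_congr rfl fun A hA => ?_
      refine card_bij' (fun p _ => p.2) (fun B _ => (A, B)) ?_ ?_ ?_ ?_
      · rintro ⟨A', B⟩ h
        simp only [mem_filter, mem_univ, true_and] at h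
        obtain ⟨h, rfl⟩ := h
        simpa using h.2.2
      · intro B hB
        simp at hA hB ⊢
        tauto
      · rintro ⟨A', B⟩ h
        simp only [mem_filter, mem_univ, true_and] at h
        rw [← h.2]
      · intros; rfl
    · rintro ⟨A, B⟩ h
      simp at h ⊢
      tauto
  have h1 : ∀ A ∈ univ.filter (fun A : K => A ∉ ({0, 1} : Finset K)),
      ((univ.filter fun B => B ∉ ({0, A + 1} : Finset K)).card : ℤ) = Fintype.card K - 2 := by
    intro A hA
    have hA1 : A ≠ 1 := by simp at hA; tauto
    rw [card_filter_notMem, card_pair]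
    · rfl
    · intro h0; exact hA1 (CharTwo.add_eq_zero.1 h0.symm)
  rw [h]
  push_cast
  rw [sum_congr rfl h1, sum_const, nsmul_eq_mul, card_filter_notMem, card_pair zero_ne_one]
  push_cast
  ring

/-- The total number of roots of the generic cubics. For given `x`, the coefficient `A` avoids
`0`, `1`, `x²` (where `B = 0`) and `x² + x + 1` (where `B = A + 1`). -/
theorem sum_card_rts : ∑ p ∈ generic K, ((rts p.1 p.2).card : ℤ) =
    (Fintype.card K - 2) * (Fintype.card K - 4) + (cubeRts K).card := by
  have h2 : (2 : K) = 0 := CharTwo.two_eq_zero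
  have hswap : ∑ p ∈ generic K, (rts p.1 p.2).card =
      ∑ x : K, ((generic K).filter fun p => x ^ 3 + p.1 * x + p.2 = 0).card := by
    simp only [card_eq_sum_ones, rts, sum_filter]
    exact sum_comm
  have hx : ∀ x : K, ((generic K).filter fun p => x ^ 3 + p.1 * x + p.2 = 0).card =
      if x ∉ ({0, 1} : Finset K) then
        (univ.filter fun A => A ∉ ({0, 1, x ^ 2, x ^ 2 + x + 1} : Finset K)).card else 0 := by
    intro x
    have hB : ∀ A B : K, x ^ 3 + A * x + B = 0 ↔ B = x * (A + x ^ 2) := by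
      intro A B
      rw [CharTwo.add_eq_zero]
      constructor
      · intro h; rw [← h]; ring
      · intro h; rw [h]; ring
    have hB1 : ∀ A : K, x * (A + x ^ 2) = A + 1 ↔ x = 1 ∨ A = x ^ 2 + x + 1 := by
      intro A
      have h3 : x * (A + x ^ 2) + (A + 1) = (x + 1) * (A + (x ^ 2 + x + 1)) := by
        linear_combination (- x ^ 2 - x) * h2
      rw [← CharTwo.add_eq_zero, h3, mul_eq_zero, CharTwo.add_eq_zero, CharTwo.add_eq_zero]
    by_cases h : x ∉ ({0, 1} : Finset K)
    · rw [if_pos h]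
      simp only [mem_insert, mem_singleton, not_or] at h
      refine card_bij' (fun p _ => p.1) (fun A _ => (A, x * (A + x ^ 2))) ?_ ?_ ?_ ?_
      · rintro ⟨A, B⟩ hp
        simp only [generic, mem_filter, mem_univ, true_and, hB] at hp
        obtain ⟨⟨h3, h4, h5, h6⟩, rfl⟩ := hp
        rw [Ne, hB1] at h6
        simp only [mul_eq_zero, h.1, false_or, CharTwo.add_eq_zero, ne_eq] at h5
        simp only [mem_filter, mem_univ, true_and, mem_insert, mem_singleton]
        tauto
      · intro A hA
        simp only [mem_filter, mem_univ, true_and, mem_insert, mem_singleton, not_or] at hA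
        simp only [generic, mem_filter, mem_univ, true_and, hB, and_true, ne_eq, hB1, mul_eq_zero,
          h.1, h.2, false_or, CharTwo.add_eq_zero]
        tauto
      · rintro ⟨A, B⟩ hp
        simp only [generic, mem_filter, mem_univ, true_and, hB] at hp
        rw [hp.2]
      · intros; rfl
    · rw [if_neg h, card_eq_zero, filter_eq_empty_iff]
      rintro ⟨A, B⟩ hp
      simp only [generic, mem_filter, mem_univ, true_and] at hp
      rw [hB]
      intro h0
      simp only at h0
      subst h0
      simp only [mem_insert, mem_singleton, not_not] at h
      rcases h with rfl | rfl
      · exact hp.2.2.1 (by ring)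
      · exact hp.2.2.2 ((hB1 A).2 (Or.inl rfl))
  have hc : ∀ x : K, (x ∉ ({0, 1} : Finset K)) →
      ((univ.filter fun A => A ∉ ({0, 1, x ^ 2, x ^ 2 + x + 1} : Finset K)).card : ℤ) =
        (Fintype.card K - 4) + if x ^ 2 + x + 1 = 0 then 1 else 0 := by
    intro x h
    simp only [mem_insert, mem_singleton, not_or] at h
    have hx2 : x ^ 2 ≠ 0 := pow_ne_zero _ h.1
    have hx21 : x ^ 2 ≠ 1 := by
      intro h3
      have : (x + 1) ^ 2 = 0 := by rw [CharTwo.add_sq, h3, one_pow, CharTwo.add_self_eq_zero]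
      exact h.2 (CharTwo.add_eq_zero.1 (pow_eq_zero_iff two_ne_zero |>.1 this))
    have h5 : x ^ 2 + x + 1 ≠ 1 := by
      rw [Ne, add_eq_right]
      intro h3
      have : x * (x + 1) = 0 := by rw [← h3]; ring
      rcases mul_eq_zero.1 this with h6 | h6
      · exact h.1 h6
      · exact h.2 (CharTwo.add_eq_zero.1 h6)
    have h6 : x ^ 2 ≠ x ^ 2 + x + 1 := by
      rw [add_assoc, Ne, eq_comm, add_eq_left]
      intro h3; exact h.2 (CharTwo.add_eq_zero.1 h3)
    rw [card_filter_notMem]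
    split_ifs with h7
    · rw [h7]
      have : ({0, 1, x ^ 2, 0} : Finset K) = {0, 1, x ^ 2} := by
        ext; simp; tauto
      rw [this, card_eq_three.2 ⟨0, 1, x ^ 2, zero_ne_one, hx2.symm, hx21.symm, rfl⟩]
      push_cast; ring
    · have : ({0, 1, x ^ 2, x ^ 2 + x + 1} : Finset K).card = 4 := by
        rw [card_insert_of_notMem,
          card_eq_three.2 ⟨1, x ^ 2, x ^ 2 + x + 1, hx21.symm, h5.symm, h6, rfl⟩]
        simp only [mem_insert, mem_singleton, not_or]
        exact ⟨zero_ne_one, hx2.symm, fun h => h7 h.symm⟩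
      rw [this]
      push_cast; ring
  have h := congrArg (Nat.cast : ℕ → ℤ) hswap
  push_cast at h
  rw [h]
  simp only [hx]
  push_cast
  rw [← sum_filter, sum_congr rfl fun x hx => hc x (by simpa using hx), sum_add_distrib, sum_const,
    nsmul_eq_mul, card_filter_notMem, card_pair zero_ne_one, sum_boole]
  congr 2
  rw [filter_filter]
  congr 1
  ext x
  simp only [mem_insert, mem_singleton, mem_filter, mem_univ, true_and, cubeRts, not_or,
    and_iff_right_iff_imp]
  intro hx
  constructor
  · rintro rfl; simp at hx
  · rintro rfl
    rw [one_pow, CharTwo.add_self_eq_zero, zero_add] at hx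
    exact one_ne_zero hx

/-- The number of `x` for which `(x, m x)` is a pair of roots of a generic cubic: the excluded
values are `0`, `1`, `m⁻¹`, `(1 + m)⁻¹` and `s⁻¹` with `s² = 1 + m + m²`. -/
theorem card_filter_avoiding {m : K} (hm0 : m ≠ 0) (hm1 : m ≠ 1) (hm2 : m ^ 2 + m + 1 ≠ 0) :
    ((univ.filter fun x : K => x ≠ 0 ∧ x ^ 2 * (1 + m + m ^ 2) ≠ 1 ∧ x ≠ 1 ∧ m * x ≠ 1 ∧
      (1 + m) * x ≠ 1).card : ℤ) = Fintype.card K - 5 := by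
  have hm3 : 1 + m ≠ 0 := fun h => hm1 (CharTwo.add_eq_zero.1 h).symm
  obtain ⟨s, hs⟩ : ∃ s, s ^ 2 = 1 + m + m ^ 2 := exists_sq_eq _
  have hs0 : s ≠ 0 := by
    rintro rfl
    refine hm2 ?_
    have : m ^ 2 + m + 1 = 1 + m + m ^ 2 := by ring
    rw [this, ← hs]
    ring
  have hsq : ∀ x : K, x ^ 2 * (1 + m + m ^ 2) = 1 ↔ x = s⁻¹ := by
    intro x
    have h1 : x ^ 2 * (1 + m + m ^ 2) + 1 = (x * s + 1) ^ 2 := by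
      rw [← hs, CharTwo.add_sq]
      ring
    rw [← CharTwo.add_eq_zero, h1, pow_eq_zero_iff two_ne_zero, CharTwo.add_eq_zero,
      mul_eq_one_iff_eq_inv₀ hs0]
  have hs1 : s ≠ 1 := by
    rintro rfl
    have : m * (1 + m) = 0 := by linear_combination -hs
    exact (mul_ne_zero hm0 hm3) this
  have hsm : s ≠ m := by
    rintro rfl
    exact hm3 (by linear_combination -hs)
  have hsm1 : s ≠ 1 + m := by
    rintro rfl
    exact hm0 (by linear_combination hs)
  have h5 : ({0, 1, m⁻¹, (1 + m)⁻¹, s⁻¹} : Finset K).card = 5 := by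
    rw [card_insert_of_notMem, card_insert_of_notMem, card_eq_three.2 ⟨m⁻¹, (1 + m)⁻¹, s⁻¹,
      ?_, ?_, ?_, rfl⟩]
    · intro h; have := inv_injective h; simp at this
    · intro h; exact hsm (inv_injective h).symm
    · intro h; exact hsm1 (inv_injective h).symm
    · simp only [mem_insert, mem_singleton, not_or, eq_comm (a := (1 : K)), inv_eq_one]
      exact ⟨hm1, by simpa using hm0, hs1⟩
    · simp only [mem_insert, mem_singleton, not_or, eq_comm (a := (0 : K)), inv_eq_zero]
      exact ⟨one_ne_zero, hm0, hm3, hs0⟩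
  have h6 : (univ.filter fun x =>
      x ≠ 0 ∧ x ^ 2 * (1 + m + m ^ 2) ≠ 1 ∧ x ≠ 1 ∧ m * x ≠ 1 ∧ (1 + m) * x ≠ 1) =
      univ.filter fun x => x ∉ ({0, 1, m⁻¹, (1 + m)⁻¹, s⁻¹} : Finset K) := by
    ext x
    have e1 : m * x = 1 ↔ x = m⁻¹ := by rw [mul_comm, mul_eq_one_iff_eq_inv₀ hm0]
    have e2 : (1 + m) * x = 1 ↔ x = (1 + m)⁻¹ := by rw [mul_comm, mul_eq_one_iff_eq_inv₀ hm3]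
    simp only [mem_filter, mem_univ, true_and, mem_insert, mem_singleton, ne_eq, hsq, e1, e2,
      not_or]
    exact ⟨fun ⟨h1, h2, h3, h4, h5⟩ => ⟨h1, h3, h4, h5, h2⟩,
      fun ⟨h1, h3, h4, h5, h2⟩ => ⟨h1, h2, h3, h4, h5⟩⟩
  rw [h6, card_filter_notMem, h5]
  rfl

/-- The number of ordered pairs of distinct roots of the generic cubics. Such a pair has the form
`(x, m x)` with `m ≠ 0, 1`; the conditions `A ≠ 0` and `A ≠ 1` mean that `1 + m + m² ≠ 0` and
`x² (1 + m + m²) ≠ 1`, and `B ≠ A + 1` means that `1` is none of the roots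
`x`, `m x`, `(1 + m) x`. -/
theorem sum_card_offDiag_rts : ∑ p ∈ generic K, ((rts p.1 p.2).offDiag.card : ℤ) =
    (Fintype.card K - 2 - (cubeRts K).card) * (Fintype.card K - 5) := by
  have h2 : (2 : K) = 0 := CharTwo.two_eq_zero
  let M : Finset K := univ.filter fun m => m ∉ ({0, 1} ∪ cubeRts K : Finset K)
  let T : K → Finset K := fun m => univ.filter fun x =>
    x ≠ 0 ∧ x ^ 2 * (1 + m + m ^ 2) ≠ 1 ∧ x ≠ 1 ∧ m * x ≠ 1 ∧ (1 + m) * x ≠ 1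
  have hroot : ∀ x y z : K, z ^ 3 + (x ^ 2 + x * y + y ^ 2) * z + x * y * (x + y) =
      (z + x) * (z + y) * (z + (x + y)) := by
    intro x y z
    linear_combination (- z ^ 2 * x - z ^ 2 * y - x * y * z) * h2
  let A : K → K → K := fun m x => x ^ 2 + x * (m * x) + (m * x) ^ 2
  let B : K → K → K := fun m x => x * (m * x) * (x + m * x)
  have hA : ∀ m x, A m x = x ^ 2 * (1 + m + m ^ 2) := fun m x => by simp only [A]; ring
  have hB : ∀ m x, B m x = x ^ 3 * m * (1 + m) := fun m x => by simp only [B]; ring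
  have hAB : ∀ m x : K, x ^ 3 * m * (1 + m) = x ^ 2 * (1 + m + m ^ 2) + 1 ↔
      x = 1 ∨ m * x = 1 ∨ (1 + m) * x = 1 := by
    intro m x
    rw [← hA, ← hB]
    have h1 : B m x + (A m x + 1) = (1 + x) * (1 + m * x) * (1 + (x + m * x)) := by
      rw [← hroot]; simp only [A, B]; ring
    have h3 : x + m * x = (1 + m) * x := by ring
    rw [← CharTwo.add_eq_zero, h1, h3]
    simp only [mul_eq_zero, CharTwo.add_eq_zero, eq_comm (a := (1 : K)), or_assoc]
  have hkey : ∀ m x, (A m x, B m x) ∈ generic K ∧ x ≠ m * x ↔ m ∈ M ∧ x ∈ T m := by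
    intro m x
    have h1 : x = m * x ↔ m = 1 ∨ x = 0 := by
      constructor
      · intro h
        have : (m - 1) * x = 0 := by rw [sub_mul, one_mul, ← h, sub_self]
        rcases mul_eq_zero.1 this with h | h
        · exact Or.inl (sub_eq_zero.1 h)
        · exact Or.inr h
      · rintro (rfl | rfl) <;> simp
    have h3 : (1 : K) + m = 0 ↔ m = 1 := by rw [CharTwo.add_eq_zero, eq_comm]
    have h4 : m ^ 2 + m + 1 = 1 + m + m ^ 2 := by ring
    simp only [generic, M, T, mem_filter, mem_univ, true_and, mem_union, mem_insert, mem_singleton,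
      mem_cubeRts, ne_eq, hA, hB, hAB, h1, mul_eq_zero, h3, h4, pow_eq_zero_iff, two_ne_zero,
      not_false_eq_true, three_ne_zero]
    tauto
  have hbij : ∑ p ∈ generic K, (rts p.1 p.2).offDiag.card = ∑ m ∈ M, (T m).card := by
    rw [← card_sigma, ← card_sigma]
    have hfwd : ∀ q ∈ (generic K).sigma fun p => (rts p.1 p.2).offDiag,
        ∃ m x, q = ⟨(A m x, B m x), (x, m * x)⟩ ∧ m ∈ M ∧ x ∈ T m := by
      rintro ⟨⟨A', B'⟩, ⟨x, y⟩⟩ hq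
      simp only [mem_sigma, mem_offDiag, mem_rts] at hq
      obtain ⟨hg, hx, hy, hxy⟩ := hq
      obtain ⟨rfl, rfl⟩ := cubic_of_two_roots hx hy hxy
      have hx0 : x ≠ 0 := by
        rintro rfl
        simp [generic] at hg
      have hmx : y / x * x = y := div_mul_cancel₀ y hx0
      have h1 : (A (y / x) x, B (y / x) x) = (x ^ 2 + x * y + y ^ 2, x * y * (x + y)) := by
        simp only [A, B, hmx]
      exact ⟨y / x, x, by rw [h1, hmx], (hkey _ _).1 ⟨by rw [h1]; exact hg, by rwa [hmx]⟩⟩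
    have hx0 : ∀ m, ∀ x ∈ T m, x ≠ 0 := fun m x hx => ((mem_filter.1 hx).2).1
    refine card_bij' (fun q _ => (⟨q.2.2 / q.2.1, q.2.1⟩ : (_ : K) × K))
      (fun q _ => ⟨(A q.1 q.2, B q.1 q.2), (q.2, q.1 * q.2)⟩) ?_ ?_ ?_ ?_
    · intro q hq
      obtain ⟨m, x, rfl, hm, hx⟩ := hfwd q hq
      simp only [mul_div_cancel_right₀ m (hx0 m x hx)]
      exact mem_sigma.2 ⟨hm, hx⟩
    · rintro ⟨m, x⟩ hq
      rw [mem_sigma] at hq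
      obtain ⟨hg, hne⟩ := (hkey m x).2 hq
      simp only [mem_sigma, mem_offDiag, mem_rts]
      refine ⟨hg, ?_, ?_, hne⟩
      · rw [hroot, CharTwo.add_self_eq_zero, zero_mul, zero_mul]
      · rw [hroot, CharTwo.add_self_eq_zero, mul_zero, zero_mul]
    · intro q hq
      obtain ⟨m, x, rfl, hm, hx⟩ := hfwd q hq
      simp only [mul_div_cancel_right₀ m (hx0 m x hx)]
    · rintro ⟨m, x⟩ hq
      rw [mem_sigma] at hq
      simp only [mul_div_cancel_right₀ m (hx0 m x hq.2)]
  have hM : (M.card : ℤ) = Fintype.card K - 2 - (cubeRts K).card := by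
    rw [card_filter_notMem, card_union_of_disjoint, card_pair zero_ne_one]
    · push_cast; ring
    · rw [disjoint_left]
      intro x hx hx'
      rw [mem_cubeRts] at hx'
      simp only [mem_insert, mem_singleton] at hx
      rcases hx with rfl | rfl
      · simp at hx'
      · rw [one_pow, CharTwo.add_self_eq_zero, zero_add] at hx'
        exact one_ne_zero hx'
  have hT : ∀ m ∈ M, ((T m).card : ℤ) = Fintype.card K - 5 := by
    intro m hm
    simp only [M, mem_filter, mem_univ, true_and, mem_union, mem_insert, mem_singleton,
      mem_cubeRts, not_or] at hm
    obtain ⟨⟨hm0, hm1⟩, hm2⟩ := hm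
    exact card_filter_avoiding hm0 hm1 hm2
  have h := congrArg (Nat.cast : ℕ → ℤ) hbij
  push_cast at h
  rw [h, sum_congr rfl hT, sum_const, nsmul_eq_mul, hM]

end counting

/-! ### Cubes and cube roots of unity -/

section counting

open Finset

variable {K : Type*} [Field K] [CharP K 2] [Fintype K] [DecidableEq K]

omit [Fintype K] [DecidableEq K] in
theorem cube_eq_one_iff (x : K) : x ^ 3 = 1 ↔ x = 1 ∨ x ^ 2 + x + 1 = 0 := by
  have h : x ^ 3 + 1 = (x + 1) * (x ^ 2 + x + 1) := by
    have h2 : (2 : K) = 0 := CharTwo.two_eq_zero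
    linear_combination (- x ^ 2 - x) * h2
  rw [← CharTwo.add_eq_zero, h, mul_eq_zero, CharTwo.add_eq_zero]

theorem card_cubeRts_of_odd {f : ℕ} (hK : Fintype.card K = 2 ^ f) (hf : Odd f) :
    (cubeRts K).card = 0 := by
  rw [card_eq_zero, eq_empty_iff_forall_notMem]
  intro x hx
  rw [mem_cubeRts] at hx
  have hx3 : x ^ 3 = 1 := (cube_eq_one_iff x).2 (Or.inr hx)
  have hx0 : x ≠ 0 := by rintro rfl; simp at hx
  have hx1 : x ≠ 1 := by
    rintro rfl
    rw [one_pow, CharTwo.add_self_eq_zero, zero_add] at hx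
    exact one_ne_zero hx
  have hu : orderOf (Units.mk0 x hx0) = 3 := by
    have : Fact (Nat.Prime 3) := ⟨Nat.prime_three⟩
    refine orderOf_eq_prime (Units.ext ?_) fun h => hx1 (congrArg Units.val h)
    simpa using hx3
  have hd := orderOf_dvd_natCard (Units.mk0 x hx0)
  rw [hu, Nat.card_units, Nat.card_eq_fintype_card, hK] at hd
  obtain ⟨k, rfl⟩ := hf
  have h4 : 4 ^ k % 3 = 1 := by
    rw [Nat.pow_mod]; simp
  have h5 : 2 ^ (2 * k + 1) = 2 * 4 ^ k := by
    rw [pow_succ, pow_mul]; ring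
  rw [h5] at hd
  omega

theorem card_cubeRts_of_even {f : ℕ} (hK : Fintype.card K = 2 ^ f) (hf : Even f) :
    (cubeRts K).card = 2 := by
  have hd : 3 ∣ Nat.card Kˣ := by
    rw [Nat.card_units, Nat.card_eq_fintype_card, hK]
    obtain ⟨k, rfl⟩ := hf
    have h4 : 4 ^ k % 3 = 1 := by
      rw [Nat.pow_mod]; simp
    have h5 : 2 ^ (k + k) = 4 ^ k := by
      rw [← two_mul, pow_mul]
      norm_num
    rw [h5]
    omega
  have : Fact (Nat.Prime 3) := ⟨Nat.prime_three⟩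
  obtain ⟨u, hu⟩ := exists_prime_orderOf_dvd_card' 3 hd
  have hu1 : (u : K) ^ 2 + u + 1 = 0 := by
    have h3 : (u : K) ^ 3 = 1 := by
      rw [← Units.val_pow_eq_pow_val, ← hu, pow_orderOf_eq_one, Units.val_one]
    refine ((cube_eq_one_iff _).1 h3).resolve_left fun h => ?_
    rw [Units.val_eq_one] at h
    rw [h, orderOf_one] at hu
    omega
  refine card_eq_two.2 ⟨u, u + 1, by simp, ?_⟩
  ext x
  have h : x ^ 2 + x + 1 = (x + u) * (x + (u + 1)) := by
    have h2 : (2 : K) = 0 := CharTwo.two_eq_zero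
    linear_combination hu1 + (- x * u - (u : K) ^ 2 - u) * h2
  rw [mem_cubeRts, h]
  simp [CharTwo.add_eq_zero]

/-- The cube roots of `B` differ by cube roots of unity. -/
theorem card_rts_zero {B : K} (hB : B ≠ 0) (h : (rts 0 B).Nonempty) :
    (rts 0 B).card = 1 + (cubeRts K).card := by
  obtain ⟨x, hx⟩ := h
  have hmem : ∀ y : K, y ∈ rts 0 B ↔ y ^ 3 = B := fun y => by
    rw [mem_rts, zero_mul, add_zero, CharTwo.add_eq_zero]
  rw [hmem] at hx
  have hx0 : x ≠ 0 := by rintro rfl; exact hB (by rw [← hx]; ring)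
  have h1 : (1 : K) ∉ cubeRts K := by
    rw [mem_cubeRts, one_pow, CharTwo.add_self_eq_zero, zero_add]
    exact one_ne_zero
  have h2 : rts 0 B = (insert 1 (cubeRts K)).image (x * ·) := by
    ext y
    rw [hmem, mem_image]
    constructor
    · intro hy
      refine ⟨y / x, ?_, mul_div_cancel₀ y hx0⟩
      have : (y / x) ^ 3 = 1 := by rw [div_pow, hy, hx, div_self hB]
      rw [mem_insert, mem_cubeRts]
      exact (cube_eq_one_iff _).1 this
    · rintro ⟨u, hu, rfl⟩
      rw [mem_insert, mem_cubeRts, ← cube_eq_one_iff] at hu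
      rw [mul_pow, hu, mul_one, hx]
  rw [h2, card_image_of_injective _ (mul_right_injective₀ hx0), card_insert_of_notMem h1, add_comm]

/-- The number of nonzero cubes. -/
theorem card_cubes : (univ.filter fun B : K => B ≠ 0 ∧ (rts 0 B).Nonempty).card *
    (1 + (cubeRts K).card) = Fintype.card K - 1 := by
  have h1 : (univ.filter fun x : K => x ≠ 0).card = Fintype.card K - 1 := by
    rw [filter_ne', card_erase_of_mem (mem_univ _), card_univ]
  have hmem : ∀ y B : K, y ∈ rts 0 B ↔ y ^ 3 = B := fun y B => by
    rw [mem_rts, zero_mul, add_zero, CharTwo.add_eq_zero]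
  rw [← h1, card_eq_sum_card_fiberwise (s := univ.filter fun x : K => x ≠ 0)
    (f := fun x : K => x ^ 3) (t := univ.filter fun B : K => B ≠ 0 ∧ (rts 0 B).Nonempty),
    ← smul_eq_mul, ← sum_const]
  · symm
    refine sum_congr rfl fun B hB => ?_
    simp only [mem_filter, mem_univ, true_and] at hB
    rw [← card_rts_zero hB.1 hB.2]
    congr 1
    ext x
    simp only [mem_filter, mem_univ, true_and, hmem]
    refine ⟨fun h => h.2, fun h => ⟨?_, h⟩⟩
    rintro rfl
    exact hB.1 (by rw [← h]; ring)
  · intro x hx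
    simp only [coe_filter, mem_univ, true_and, Set.mem_setOf_eq] at hx ⊢
    exact ⟨pow_ne_zero _ hx, x, (hmem _ _).2 rfl⟩

end counting

/-! ### Numbers of pairs of normalized coefficients -/

section pairs

variable {K : Type*} [Field K] [CharP K 2] [Fintype K]

theorem ncard_pairs_zero_zero :
    {p : K × K | p.1 ≠ 1 ∧ p.2 ≠ p.1 + 1 ∧ (p.1 = 0 ∧ p.2 = 0)}.ncard = 1 := by
  rw [Set.ncard_eq_one]
  refine ⟨0, ?_⟩
  ext ⟨A, B⟩
  simp only [Set.mem_setOf_eq, Set.mem_singleton_iff, Prod.mk_eq_zero]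
  constructor
  · exact fun h => h.2.2
  · rintro ⟨rfl, rfl⟩
    simp

theorem ncard_pairs_zero (Q : K → Prop) :
    {p : K × K | p.1 ≠ 1 ∧ p.2 ≠ p.1 + 1 ∧ (p.1 = 0 ∧ p.2 ≠ 0 ∧ Q p.2)}.ncard =
      {B : K | B ≠ 0 ∧ B ≠ 1 ∧ Q B}.ncard := by
  rw [← Set.ncard_image_of_injective {B : K | B ≠ 0 ∧ B ≠ 1 ∧ Q B}
    (Prod.mk_right_injective (0 : K))]
  refine congrArg _ ?_
  refine Set.ext fun ⟨A, B⟩ => ?_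
  simp only [Set.mem_setOf_eq, Set.mem_image, Prod.mk.injEq]
  constructor
  · rintro ⟨h1, h2, rfl, h3, h4⟩
    exact ⟨B, ⟨h3, by simpa using h2, h4⟩, rfl, rfl⟩
  · rintro ⟨B', ⟨h3, h4, h5⟩, rfl, rfl⟩
    exact ⟨zero_ne_one, by simpa using h4, rfl, h3, h5⟩

theorem ncard_ne_zero_one : ({B : K | B ≠ 0 ∧ B ≠ 1}.ncard : ℤ) = Fintype.card K - 2 := by
  classical
  have h := card_filter_notMem ({0, 1} : Finset K)
  rw [Finset.card_pair zero_ne_one, Nat.cast_two] at h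
  rw [← h, ← Set.ncard_coe_finset]
  congr 2
  ext
  simp

theorem ncard_pairs_ne_zero_zero :
    ({p : K × K | p.1 ≠ 1 ∧ p.2 ≠ p.1 + 1 ∧ (p.1 ≠ 0 ∧ p.2 = 0)}.ncard : ℤ) =
      Fintype.card K - 2 := by
  rw [← ncard_ne_zero_one, ← Set.ncard_image_of_injective {B : K | B ≠ 0 ∧ B ≠ 1}
    (Prod.mk_left_injective (0 : K))]
  refine congrArg _ (congrArg _ ?_)
  refine Set.ext fun ⟨A, B⟩ => ?_
  simp only [Set.mem_setOf_eq, Set.mem_image, Prod.mk.injEq]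
  constructor
  · rintro ⟨h1, h2, h3, rfl⟩
    exact ⟨A, ⟨h3, h1⟩, rfl, rfl⟩
  · rintro ⟨A', ⟨h3, h4⟩, rfl, rfl⟩
    exact ⟨h4, fun h => h4 (CharTwo.add_eq_zero.1 h.symm), h3, rfl⟩

/-- The number of admissible nonzero cubes different from `1`. -/
theorem ncard_cubes [DecidableEq K] :
    (({B : K | B ≠ 0 ∧ B ≠ 1 ∧ (cubicRoots 0 B).Nonempty}.ncard : ℤ) + 1) *
      (1 + (cubeRts K).card) = Fintype.card K - 1 := by
  classical
  have h := card_cubes (K := K)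
  have h1 : (insert (1 : K) {B : K | B ≠ 0 ∧ B ≠ 1 ∧ (cubicRoots 0 B).Nonempty}) =
      ((Finset.univ.filter fun B : K => B ≠ 0 ∧ (rts 0 B).Nonempty : Finset K) : Set K) := by
    ext B
    have hr : (rts 0 B).Nonempty ↔ (cubicRoots 0 B).Nonempty := by
      constructor
      · rintro ⟨x, hx⟩; exact ⟨x, mem_rts.1 hx⟩
      · rintro ⟨x, hx⟩; exact ⟨x, mem_rts.2 hx⟩
    simp only [Set.mem_insert_iff, Set.mem_setOf_eq, Finset.coe_filter, Finset.mem_univ, true_and,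
      hr]
    constructor
    · rintro (rfl | h)
      · refine ⟨one_ne_zero, 1, ?_⟩
        simp [cubicRoots, CharTwo.add_self_eq_zero]
      · exact ⟨h.1, h.2.2⟩
    · rintro ⟨h, h'⟩
      by_cases hB : B = 1
      · exact Or.inl hB
      · exact Or.inr ⟨h, hB, h'⟩
  have h2 := congrArg Set.ncard h1
  rw [Set.ncard_insert_of_notMem (by simp), Set.ncard_coe_finset] at h2
  rw [← h2] at h
  have h3 := Fintype.card_pos (α := K)
  zify [h3] at h
  exact_mod_cast h

theorem ncard_noncubes :
    ({B : K | B ≠ 0 ∧ B ≠ 1 ∧ (cubicRoots 0 B).Nonempty}.ncard : ℤ) +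
      {B : K | B ≠ 0 ∧ B ≠ 1 ∧ ¬ (cubicRoots 0 B).Nonempty}.ncard = Fintype.card K - 2 := by
  rw [← ncard_ne_zero_one, ← Nat.cast_add, ← Set.ncard_union_eq]
  · congr 2
    ext B
    simp only [Set.mem_union, Set.mem_setOf_eq]
    tauto
  · rw [Set.disjoint_left]
    exact fun B h h' => h'.2.2 h.2.2

/-- The number of generic pairs whose cubic has `r` roots. -/
def numGeneric (K : Type*) [Field K] (r : ℕ) : ℕ :=
  {p : K × K | p.1 ≠ 1 ∧ p.2 ≠ p.1 + 1 ∧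
    (p.1 ≠ 0 ∧ p.2 ≠ 0 ∧ (cubicRoots p.1 p.2).ncard = r)}.ncard

theorem numGeneric_eq [DecidableEq K] (r : ℕ) :
    numGeneric K r = ((generic K).filter fun p => (rts p.1 p.2).card = r).card := by
  rw [numGeneric, ← Set.ncard_coe_finset]
  congr 1
  ext p
  simp only [generic, ncard_cubicRoots, Set.mem_setOf_eq, Finset.coe_filter, Finset.mem_filter,
    Finset.mem_univ, true_and]
  tauto

/-- Three linear equations for the numbers of generic cubics with `0`, `1` and `3` roots: the number
of all generic cubics, the total number of their roots, and the number of ordered pairs of distinct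
roots. -/
theorem numGeneric_equations [DecidableEq K] :
    (numGeneric K 0 + numGeneric K 1 + numGeneric K 3 : ℤ) = (Fintype.card K - 2) ^ 2 ∧
    (numGeneric K 1 + 3 * numGeneric K 3 : ℤ) =
      (Fintype.card K - 2) * (Fintype.card K - 4) + (cubeRts K).card ∧
    (6 * numGeneric K 3 : ℤ) =
      (Fintype.card K - 2 - (cubeRts K).card) * (Fintype.card K - 5) := by
  have h0 : ∀ p ∈ generic K, (rts p.1 p.2).card = 0 ∨ (rts p.1 p.2).card = 1 ∨
      (rts p.1 p.2).card = 3 := fun p hp => card_rts _ (by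
    simp only [generic, Finset.mem_filter] at hp
    exact hp.2.2.2.1)
  have key : ∀ g : ℕ → ℤ, ∑ p ∈ generic K, g (rts p.1 p.2).card =
      g 0 * numGeneric K 0 + g 1 * numGeneric K 1 + g 3 * numGeneric K 3 := by
    intro g
    simp only [numGeneric_eq, Finset.card_filter, Nat.cast_sum, Finset.mul_sum,
      ← Finset.sum_add_distrib]
    refine Finset.sum_congr rfl fun p hp => ?_
    rcases h0 p hp with h | h | h <;> simp [h]
  refine ⟨?_, ?_, ?_⟩
  · rw [← card_generic, Finset.card_eq_sum_ones]
    have := key fun _ => 1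
    push_cast
    rw [this]
    ring
  · rw [← sum_card_rts]
    have := key fun n => n
    rw [this]
    push_cast
    ring
  · rw [← sum_card_offDiag_rts]
    have := key fun n => ((n * n - n : ℕ) : ℤ)
    simp only [Finset.offDiag_card]
    rw [this]
    push_cast
    ring

end pairs

/-! ### Induction from `X_P` to `U` -/

section inductionToU

variable {K : Type*} [Field K] [CharP K 2]

theorem x_commute_of_commList {i j : Fin 24} (hij : i < j) (h : commList i j = []) (s t : K) :
    x i s * x j t = x j t * x i s := by
  rw [x_mul_of_lt hij, h, List.map_nil, List.prod_nil, mul_one]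

/-- The conjugate of `x₁₁(s)` by `x₁(a) x₄(b)` has the component `x₁₈(b² s)`, although `α₁₁` lies in
`N`. -/
theorem conj_x11 (a b s : K) :
    (x (α 1) a * x (α 4) b)⁻¹ * x (α 11) s * (x (α 1) a * x (α 4) b) =
      x (α 11) s * (x (α 15) (b * s) * x (α 18) (b ^ 2 * s)) := by
  have h1 := x_commute_of_commList (K := K) (i := α 1) (j := α 11) (by decide)
    (by decide +kernel) a s
  have h2 := x_mul_of_lt (K := K) (i := α 4) (j := α 11) (by decide) b s
  have h3 := x_commute_of_commList (K := K) (i := α 4) (j := α 15) (by decide)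
    (by decide +kernel) b (b * s)
  have h4 := x_commute_of_commList (K := K) (i := α 4) (j := α 18) (by decide)
    (by decide +kernel) b (b ^ 2 * s)
  rw [show commList (α 4) (α 11) = [(α 15, 1, 1), (α 18, 2, 1)] by decide +kernel] at h2
  simp only [List.map_cons, List.map_nil, List.prod_cons, List.prod_nil, mul_one, pow_one] at h2
  have h5 : ∀ (i : Fin 24) (c : K), x i c * x i c = 1 := fun i c => by
    rw [x_mul_x, CharTwo.add_self_eq_zero, x_zero]
  calc (x (α 1) a * x (α 4) b)⁻¹ * x (α 11) s * (x (α 1) a * x (α 4) b)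
      = x (α 4) b * (x (α 1) a * x (α 11) s) * x (α 1) a * x (α 4) b := by
        rw [mul_inv_rev, x_inv, x_inv]; group
    _ = x (α 4) b * x (α 11) s * (x (α 1) a * x (α 1) a) * x (α 4) b := by rw [h1]; group
    _ = x (α 11) s * (x (α 4) b * (x (α 15) (b * s) * x (α 18) (b ^ 2 * s))) * x (α 4) b := by
        rw [h5, mul_one, h2]
    _ = x (α 11) s * ((x (α 4) b * x (α 15) (b * s)) * x (α 18) (b ^ 2 * s) * x (α 4) b) := by
        group
    _ = x (α 11) s * (x (α 15) (b * s) * (x (α 4) b * x (α 18) (b ^ 2 * s)) * x (α 4) b) := by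
        rw [h3]; group
    _ = x (α 11) s * (x (α 15) (b * s) * x (α 18) (b ^ 2 * s)) * (x (α 4) b * x (α 4) b) := by
        rw [h4]; group
    _ = _ := by rw [h5, mul_one]

/-- The conjugate of `x₁₆(s)` by `x₁(a)` has the component `x₁₈(a s)`, although `α₁₆` lies in
`N`. -/
theorem conj_x16 (a s : K) :
    (x (α 1) a)⁻¹ * x (α 16) s * x (α 1) a = x (α 16) s * x (α 18) (a * s) := by
  have h2 := x_mul_of_lt (K := K) (i := α 1) (j := α 16) (by decide) a s
  have h4 := x_commute_of_commList (K := K) (i := α 1) (j := α 18) (by decide)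
    (by decide +kernel) a (a * s)
  rw [show commList (α 1) (α 16) = [(α 18, 1, 1)] by decide +kernel] at h2
  simp only [List.map_cons, List.map_nil, List.prod_cons, List.prod_nil, mul_one, pow_one] at h2
  rw [x_inv, h2, mul_assoc, h4, mul_assoc, x_mul_x, CharTwo.add_self_eq_zero, x_zero, mul_one]

/-- The inflation of a function on `X_S` to `X_P`. -/
def infl (χ : XS K → ℂ) : X K coreP → ℂ := fun h => χ (proj K h)

theorem infl_mem_irrChar {χ : XS K → ℂ} (h : χ ∈ IrrChar (XS K)) :
    infl χ ∈ IrrChar (X K coreP) :=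
  IrrChar.comp_surjective h proj_surjective

theorem infl_injective : Function.Injective (infl (K := K)) := fun χ ψ h => by
  funext g
  obtain ⟨g, rfl⟩ := proj_surjective g
  exact congrFun h g

theorem toU_eq (χ : XS K → ℂ) : Quattern.toU χ = induce (X K coreP) (infl χ) := rfl

/-- The elements `x₁(a) x₄(b)` represent all cosets of `X_P`. -/
theorem exists_eq_x1_mul_x4_mul (g : U K) :
    ∃ (a b : K), ∃ p ∈ X K coreP, g = x (α 1) a * x (α 4) b * p := by
  have hx : ∀ (i : Fin 24) (t a b : K), ∀ p ∈ X K coreP, ∃ (a' b' : K), ∃ p' ∈ X K coreP,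
      x i t * (x (α 1) a * x (α 4) b * p) = x (α 1) a' * x (α 4) b' * p' := by
    intro i t a b p hp
    by_cases h1 : i = α 1
    · subst h1
      exact ⟨t + a, b, p, hp, by rw [← x_mul_x]; group⟩
    by_cases h4 : i = α 4
    · subst h4
      have h := x_commute_of_commList (K := K) (i := α 1) (j := α 4) (by decide)
        (by decide +kernel) a t
      refine ⟨a, t + b, p, hp, ?_⟩
      rw [← x_mul_x, ← mul_assoc, ← mul_assoc, ← h]
      group
    · have hi : i ∈ coreP := by
        simp only [coreP, coreA, Finset.mem_sdiff, Finset.mem_univ, true_and, Finset.mem_insert,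
          Finset.mem_singleton, not_or]
        exact ⟨h1, h4⟩
      have := normal_coreP.conj_mem _ (x_mem (K := K) hi t) (x (α 1) a * x (α 4) b)⁻¹
      exact ⟨a, b, _, mul_mem this hp, by group⟩
  obtain ⟨g, hg⟩ := g
  induction hg using Subgroup.closure_induction_left with
  | one => exact ⟨0, 0, 1, one_mem _, by rw [x_zero, x_zero, one_mul, one_mul]; rfl⟩
  | mul_left y hy z hz ih =>
    obtain ⟨i, t, rfl⟩ := hy
    obtain ⟨a, b, p, hp, h⟩ := ih
    obtain ⟨a', b', p', hp', h'⟩ := hx i t a b p hp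
    refine ⟨a', b', p', hp', ?_⟩
    rw [← h', ← h]
    rfl
  | inv_mul_cancel y hy z hz ih =>
    obtain ⟨i, t, rfl⟩ := hy
    obtain ⟨a, b, p, hp, h⟩ := ih
    obtain ⟨a', b', p', hp', h'⟩ := hx i t a b p hp
    refine ⟨a', b', p', hp', ?_⟩
    rw [← h', ← h, ← x_inv]
    rfl

variable [Finite K]

/-- A character in `F₁₁`, inflated to `X_P`, is conjugate under `x₁(a) x₄(b)` to the inflation of
another character of `X_S` only if `a = b = 0`: the conjugate of `x₁₁(s)` and of `x₁₆(s)`, which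
lie in the kernel, involves `x₁₈`. -/
theorem eq_zero_of_conjFun_eq {χ ψ : XS K → ℂ} (hχ : χ ∈ F11 K) {a b : K}
    (h : conjFun normal_coreP (infl χ) (x (α 1) a * x (α 4) b) = infl ψ) : a = 0 ∧ b = 0 := by
  obtain ⟨c, hc⟩ := exists_hasParam hχ
  have hχ1 := IrrChar.one_ne_zero ((mem_F11_iff χ).1 hχ).1
  have h1 : ψ 1 = χ 1 := by
    have h2 := congrFun h 1
    simp only [infl, conjFun, map_one] at h2
    rw [← h2]
    congr 1
    rw [← map_one (proj K)]
    congr 1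
    exact Subtype.ext (by simp)
  have h18 : ∀ t : K, χ (Qx (α 18) t) = χ 1 * phi (c.a18 * t) := fun t => (hc t).2.2.2.2.2
  -- elements of `X_N` whose conjugate is congruent to an element of `X₁₈`
  have key : ∀ n ∈ coreN, ∀ (s t : K) (y : X K coreP),
      (x (α 1) a * x (α 4) b)⁻¹ * x n s * (x (α 1) a * x (α 4) b) = y →
      proj K y = Qx (α 18) t → phi ((c.a18 : K) * t) = 1 := by
    intro n hn s t y hy hp
    have h2 := congrFun h ⟨x n s, x_mem (Finset.sdiff_subset hn) s⟩
    have h3 : conjFun normal_coreP (infl χ) (x (α 1) a * x (α 4) b)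
        ⟨x n s, x_mem (Finset.sdiff_subset hn) s⟩ = infl χ y := by
      simp only [conjFun]
      congr 1
      exact Subtype.ext hy
    rw [h3] at h2
    simp only [infl] at h2
    rw [← Qx_eq (Finset.sdiff_subset hn), Qx_of_mem_coreN hn, h1, hp, h18] at h2
    exact mul_left_cancel₀ hχ1 (h2.trans (mul_one _).symm)
  have hb : b = 0 := by
    have h2 : (c.a18 : K) * b ^ 2 = 0 := eq_zero_of_phi fun s => by
      rw [mul_assoc]
      refine key (α 11) (by decide) s _ (⟨x (α 11) s, x_mem (by decide) _⟩ *
        (⟨x (α 15) (b * s), x_mem (by decide) _⟩ * ⟨x (α 18) (b ^ 2 * s), x_mem (by decide) _⟩))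
        (conj_x11 a b s) ?_
      rw [map_mul, map_mul, ← Qx_eq (by decide), ← Qx_eq (by decide), ← Qx_eq (by decide),
        Qx_of_mem_coreN (by decide),
        Qx_of_mem_coreN (by decide), one_mul, one_mul]
    exact pow_eq_zero_iff two_ne_zero |>.1 ((mul_eq_zero.1 h2).resolve_left c.a18.ne_zero)
  refine ⟨?_, hb⟩
  subst hb
  have h2 : (c.a18 : K) * a = 0 := eq_zero_of_phi fun s => by
    rw [mul_assoc]
    refine key (α 16) (by decide) s _ (⟨x (α 16) s, x_mem (by decide) _⟩ *
      ⟨x (α 18) (a * s), x_mem (by decide) _⟩) ?_ ?_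
    · rw [x_zero, mul_one, conj_x16]
      rfl
    · rw [map_mul, ← Qx_eq (by decide), ← Qx_eq (by decide), Qx_of_mem_coreN (by decide),
        one_mul]
  exact (mul_eq_zero.1 h2).resolve_left c.a18.ne_zero

/-- The conjugates of the inflated characters under elements outside `X_P` are not inflated. -/
theorem conjFun_infl_ne {χ ψ : XS K → ℂ} (hχ : χ ∈ F11 K) :
    ∀ g ∉ X K coreP, conjFun normal_coreP (infl χ) g ≠ infl ψ := by
  intro g hg h
  obtain ⟨a, b, p, hp, rfl⟩ := exists_eq_x1_mul_x4_mul g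
  rw [← conjFun_conjFun, conjFun_of_mem normal_coreP
    (infl_mem_irrChar ((mem_F11_iff χ).1 hχ).1) hp] at h
  obtain ⟨rfl, rfl⟩ := eq_zero_of_conjFun_eq hχ h
  refine hg ?_
  rwa [x_zero, x_zero, one_mul, one_mul]

/-- The elements `x₁(a) x₄(b)` lie in different cosets of `X_P`, since `X_P` fixes the inflation of
a character in `F₁₁` while `x₁(a) x₄(b)` does not, unless `a = b = 0`. -/
theorem index_coreP : (X K coreP).index = Nat.card K ^ 2 := by
  obtain ⟨χ, hχ⟩ : ∃ χ, χ ∈ F11 K := ⟨_, charFn_mem_F11 ⟨1, 1, 1, 1, 1, 1⟩ 1 1⟩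
  let g : K × K → U K ⧸ X K coreP := fun p => QuotientGroup.mk (x (α 1) p.1 * x (α 4) p.2)
  have hg : Function.Bijective g := by
    constructor
    · rintro ⟨a, b⟩ ⟨a', b'⟩ h
      have h1 := QuotientGroup.eq.1 h
      have hc := x_commute_of_commList (K := K) (i := α 1) (j := α 4) (by decide)
        (by decide +kernel)
      have h2 : (x (α 1) a * x (α 4) b)⁻¹ * (x (α 1) a' * x (α 4) b') =
          x (α 1) (a + a') * x (α 4) (b + b') := by
        rw [mul_inv_rev, x_inv, x_inv, ← hc, ← x_mul_x, ← x_mul_x]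
        calc x (α 1) a * x (α 4) b * (x (α 1) a' * x (α 4) b')
            = x (α 1) a * (x (α 4) b * x (α 1) a') * x (α 4) b' := by group
          _ = _ := by rw [← hc]; group
      simp only at h1
      rw [h2] at h1
      have h3 := eq_zero_of_conjFun_eq (ψ := χ) hχ (conjFun_of_mem normal_coreP
        (infl_mem_irrChar ((mem_F11_iff χ).1 hχ).1) h1)
      exact Prod.ext (CharTwo.add_eq_zero.1 h3.1) (CharTwo.add_eq_zero.1 h3.2)
    · intro y
      obtain ⟨y, rfl⟩ := QuotientGroup.mk_surjective y
      obtain ⟨a, b, p, hp, rfl⟩ := exists_eq_x1_mul_x4_mul y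
      exact ⟨(a, b), (QuotientGroup.mk_mul_of_mem _ hp).symm⟩
  rw [Subgroup.index, ← Nat.card_eq_of_bijective g hg, Nat.card_prod, sq]

theorem toU_mem_irrChar {χ : XS K → ℂ} (hχ : χ ∈ F11 K) : Quattern.toU χ ∈ IrrChar (U K) :=
  induce_mem_irrChar normal_coreP (infl_mem_irrChar ((mem_F11_iff χ).1 hχ).1) (conjFun_infl_ne hχ)

theorem toU_one (χ : XS K → ℂ) : Quattern.toU χ 1 = (Nat.card K : ℂ) ^ 2 * χ 1 := by
  rw [toU_eq, induce_one_of_normal normal_coreP, index_coreP, infl, map_one]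
  push_cast
  rfl

theorem toU_injOn : Set.InjOn Quattern.toU (F11 K) := by
  intro χ hχ ψ hψ h
  refine infl_injective ?_
  exact induce_injective normal_coreP (infl_mem_irrChar ((mem_F11_iff χ).1 hχ).1)
    (infl_mem_irrChar ((mem_F11_iff ψ).1 hψ).1) (conjFun_infl_ne hχ) (conjFun_infl_ne hψ) h

end inductionToU

/-! ### The pairs of noncommuting root subgroups -/

section noncommuting

variable {K : Type*} [Field K] [CharP K 2]

/-- Elements do not commute if their commutator has nonzero coordinates. -/
theorem HasCoord.mul_ne_mul {g g' : XS K} {v w v' w' : K × K} {u u' : Fin 6 → K}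
    (h : HasCoord g v w u) (h' : HasCoord g' v' w' u') (hne : bracket v' w ≠ bracket v w') :
    g * g' ≠ g' * g := fun he => hne <| by
  have h1 := ((he ▸ h.mul h').unique (h'.mul h)).2.2
  rw [add_comm u' u] at h1
  exact add_left_cancel h1

theorem xS_noncommuting_iff :
    ∀ i ∈ ({2, 3, 5, 6, 7, 8, 9, 10, 12, 18} : Finset ℕ),
      ∀ j ∈ ({2, 3, 5, 6, 7, 8, 9, 10, 12, 18} : Finset ℕ), i < j →
        ((∃ s t : K, xS i s * xS j t ≠ xS j t * xS i s) ↔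
          (i, j) ∈ ({(2, 3), (2, 7), (3, 5), (5, 7)} : Finset (ℕ × ℕ))) := by
  have hS : ∀ i ∈ ({2, 3, 5, 6, 7, 8, 9, 10, 12, 18} : Finset ℕ), α i ∈ coreP := by decide
  have hN : ∀ i ∈ ({2, 3, 5, 6, 7, 8, 9, 10, 12, 18} : Finset ℕ),
      ∀ j ∈ ({2, 3, 5, 6, 7, 8, 9, 10, 12, 18} : Finset ℕ), i < j →
        (i, j) ∉ ({(2, 3), (2, 7), (3, 5), (5, 7)} : Finset (ℕ × ℕ)) →
          ∀ k ∈ commRoots (α i) (α j), k ∈ coreN := by decide +kernel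
  intro i hi j hj hij
  constructor
  · rintro ⟨s, t, hst⟩
    by_contra h
    exact hst (Qx_commute (hS i hi) (hS j hj) (hN i hi j hj hij h) s t)
  · intro h
    refine ⟨1, 1, ?_⟩
    have hb : ∀ v w : K × K, bracket v w ≠ 0 → bracket 0 0 ≠ bracket v w := fun v w h => by
      rw [bracket_zero_left]
      exact h.symm
    -- `l` is a coordinate at which the commutator of the root elements does not vanish
    have h0 : ∀ (l : Fin 6) {u : Fin 6 → K}, u l ≠ 0 → u ≠ 0 := fun l u h h' => h (by rw [h']; rfl)
    simp only [Finset.mem_insert, Finset.mem_singleton, Prod.mk.injEq] at h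
    rcases h with ⟨rfl, rfl⟩ | ⟨rfl, rfl⟩ | ⟨rfl, rfl⟩ | ⟨rfl, rfl⟩
    · exact (hasCoord_xS2 1).mul_ne_mul (hasCoord_xS3 1)
        (hb _ _ (h0 0 (by simp [bracket, r2, r5])))
    · exact (hasCoord_xS2 1).mul_ne_mul (hasCoord_xS7 1)
        (hb _ _ (h0 3 (by simp [bracket, r2, r5])))
    · exact (hasCoord_xS3 1).mul_ne_mul (hasCoord_xS5 1)
        (hb _ _ (h0 1 (by simp [bracket, r2, r5]))).symm
    · exact (hasCoord_xS5 1).mul_ne_mul (hasCoord_xS7 1)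
        (hb _ _ (h0 4 (by simp [bracket, r2, r5])))

end noncommuting

/-! ### The subfamilies -/

section subfamilies

variable {K : Type*} [Field K] [CharP K 2]

/-- The conditions `evenCond`, in terms of the coefficients of the normalized cubic. -/
def evenNorm : Fin 7 → K → K → Prop :=
  ![fun A B => A = 0 ∧ B = 0,
    fun A B => A ≠ 0 ∧ B = 0,
    fun A B => A = 0 ∧ B ≠ 0 ∧ ¬ (cubicRoots 0 B).Nonempty,
    fun A B => A = 0 ∧ B ≠ 0 ∧ (cubicRoots 0 B).Nonempty,
    fun A B => A ≠ 0 ∧ B ≠ 0 ∧ (cubicRoots A B).ncard = 0,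
    fun A B => A ≠ 0 ∧ B ≠ 0 ∧ (cubicRoots A B).ncard = 1,
    fun A B => A ≠ 0 ∧ B ≠ 0 ∧ (cubicRoots A B).ncard = 3]

/-- The conditions `oddCond`, in terms of the coefficients of the normalized cubic. -/
def oddNorm : Fin 6 → K → K → Prop :=
  ![fun A B => A = 0 ∧ B = 0,
    fun A B => A ≠ 0 ∧ B = 0,
    fun A B => A = 0 ∧ B ≠ 0,
    fun A B => A ≠ 0 ∧ B ≠ 0 ∧ (cubicRoots A B).ncard = 0,
    fun A B => A ≠ 0 ∧ B ≠ 0 ∧ (cubicRoots A B).ncard = 1,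
    fun A B => A ≠ 0 ∧ B ≠ 0 ∧ (cubicRoots A B).ncard = 3]

theorem evenCond_iff (i : Fin 7) (a : Param K) : evenCond i a ↔ evenNorm i a.A a.B := by
  have h3 : a.d = a.b ^ 3 → ((∃ y : K, y ^ 3 = a.c + a.b ^ 3) ↔ (cubicRoots 0 a.B).Nonempty) :=
    a.exists_cube_iff
  fin_cases i <;> simp [evenCond, evenNorm, a.A_eq_zero_iff, a.B_eq_zero_iff, a.numRoots_eq,
    -not_exists] <;> intro h <;> simp [h3 h]

theorem oddCond_iff (j : Fin 6) (a : Param K) : oddCond j a ↔ oddNorm j a.A a.B := by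
  fin_cases j <;> simp [oddCond, oddNorm, a.A_eq_zero_iff, a.B_eq_zero_iff, a.numRoots_eq]

/-- At most one condition holds: the index is determined by which coefficients vanish and by the
roots of the cubic. -/
theorem evenNorm_unique {A B : K} {i j : Fin 7} (hi : evenNorm i A B) (hj : evenNorm j A B) :
    i = j := by
  classical
  have key : ∀ i, evenNorm i A B → i =
      if A = 0 then if B = 0 then 0 else if (cubicRoots 0 B).Nonempty then 3 else 2
      else if B = 0 then 1 else if (cubicRoots A B).ncard = 0 then 4
      else if (cubicRoots A B).ncard = 1 then 5 else 6 := by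
    intro i h
    fin_cases i
    · rw [if_pos h.1, if_pos h.2]; rfl
    · rw [if_neg h.1, if_pos h.2]; rfl
    · rw [if_pos h.1, if_neg h.2.1, if_neg h.2.2]; rfl
    · rw [if_pos h.1, if_neg h.2.1, if_pos h.2.2]; rfl
    · rw [if_neg h.1, if_neg h.2.1, if_pos h.2.2]; rfl
    · rw [if_neg h.1, if_neg h.2.1, h.2.2]; rfl
    · rw [if_neg h.1, if_neg h.2.1, h.2.2]; rfl
  rw [key i hi, key j hj]

theorem oddNorm_unique {A B : K} {i j : Fin 6} (hi : oddNorm i A B) (hj : oddNorm j A B) :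
    i = j := by
  classical
  have key : ∀ i, oddNorm i A B → i =
      if A = 0 then if B = 0 then 0 else 2
      else if B = 0 then 1 else if (cubicRoots A B).ncard = 0 then 3
      else if (cubicRoots A B).ncard = 1 then 4 else 5 := by
    intro i h
    fin_cases i
    · rw [if_pos h.1, if_pos h.2]; rfl
    · rw [if_neg h.1, if_pos h.2]; rfl
    · rw [if_pos h.1, if_neg h.2]; rfl
    · rw [if_neg h.1, if_neg h.2.1, if_pos h.2.2]; rfl
    · rw [if_neg h.1, if_neg h.2.1, h.2.2]; rfl
    · rw [if_neg h.1, if_neg h.2.1, h.2.2]; rfl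
  rw [key i hi, key j hj]

variable [Fintype K]

theorem ncard_cubicRoots_of_ne (A : K) {B : K} (hB : B ≠ 0) :
    (cubicRoots A B).ncard = 0 ∨ (cubicRoots A B).ncard = 1 ∨ (cubicRoots A B).ncard = 3 := by
  classical
  simpa only [ncard_cubicRoots, Finset.mem_insert, Finset.mem_singleton] using card_rts A hB

theorem exists_evenNorm (A B : K) : ∃ i, evenNorm i A B := by
  by_cases hA : A = 0 <;> by_cases hB : B = 0
  · exact ⟨0, hA, hB⟩
  · by_cases h : (cubicRoots 0 B).Nonempty
    · exact ⟨3, hA, hB, h⟩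
    · exact ⟨2, hA, hB, h⟩
  · exact ⟨1, hA, hB⟩
  · rcases ncard_cubicRoots_of_ne A hB with h | h | h
    · exact ⟨4, hA, hB, h⟩
    · exact ⟨5, hA, hB, h⟩
    · exact ⟨6, hA, hB, h⟩

theorem exists_oddNorm (A B : K) : ∃ j, oddNorm j A B := by
  by_cases hA : A = 0 <;> by_cases hB : B = 0
  · exact ⟨0, hA, hB⟩
  · exact ⟨2, hA, hB⟩
  · exact ⟨1, hA, hB⟩
  · rcases ncard_cubicRoots_of_ne A hB with h | h | h
    · exact ⟨3, hA, hB, h⟩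
    · exact ⟨4, hA, hB, h⟩
    · exact ⟨5, hA, hB, h⟩

/-- For even `f` a nonzero cube has three cube roots. -/
theorem ncard_cubicRoots_zero_of_even {f : ℕ} (hK : Fintype.card K = 2 ^ f) (hf : Even f) {B : K}
    (hB : B ≠ 0) (h : (cubicRoots 0 B).Nonempty) : (cubicRoots 0 B).ncard = 3 := by
  classical
  have h' : (rts 0 B).Nonempty := by
    rw [← Finset.card_pos, ← ncard_cubicRoots, Set.ncard_pos]
    exact h
  rw [ncard_cubicRoots, card_rts_zero hB h', card_cubeRts_of_even hK hf]

/-- For odd `f` every element of `K` is a cube, and its cube root is unique. -/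
theorem ncard_cubicRoots_zero_of_odd {f : ℕ} (hK : Fintype.card K = 2 ^ f) (hf : Odd f) {B : K}
    (hB : B ≠ 0) : (cubicRoots 0 B).ncard = 1 := by
  classical
  have h1 := ncard_cubes (K := K)
  have h2 := ncard_noncubes (K := K)
  rw [card_cubeRts_of_odd hK hf] at h1
  have h3 : {B : K | B ≠ 0 ∧ B ≠ 1 ∧ ¬ (cubicRoots 0 B).Nonempty}.ncard = 0 := by
    push_cast at h1
    omega
  rw [Set.ncard_eq_zero] at h3
  have h : (cubicRoots 0 B).Nonempty := by
    by_cases hB1 : B = 1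
    · refine ⟨1, ?_⟩
      simp [cubicRoots, hB1, CharTwo.add_self_eq_zero]
    · by_contra hne
      exact Set.eq_empty_iff_forall_notMem.1 h3 B ⟨hB, hB1, hne⟩
  have h' : (rts 0 B).Nonempty := by
    rw [← Finset.card_pos, ← ncard_cubicRoots, Set.ncard_pos]
    exact h
  rw [ncard_cubicRoots, card_rts_zero hB h', card_cubeRts_of_odd hK hf]

/-- The order of `Y'` is `1` plus the number of nonzero solutions of the quartic equation
`X (X³ + A X + B) = 0`. -/
theorem card_Y'_of_evenCond {f : ℕ} (hK : Fintype.card K = 2 ^ f) (hf : Even f) (i : Fin 7)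
    (a : Param K) (h : evenCond i a) :
    Nat.card (Y' a) = (![1, 2, 1, 4, 1, 2, 4] : Fin 7 → ℕ) i := by
  rw [evenCond_iff] at h
  fin_cases i
  · exact card_Y'_eq_one a h.1 h.2
  · exact card_Y'_eq_two a h.1 h.2
  · obtain ⟨hA, hB, hn⟩ := h
    rw [card_Y'_of_ne a hB, hA, Set.not_nonempty_iff_eq_empty.1 hn, Set.ncard_empty]
    rfl
  · obtain ⟨hA, hB, hn⟩ := h
    rw [card_Y'_of_ne a hB, hA, ncard_cubicRoots_zero_of_even hK hf hB hn]
    rfl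
  all_goals
    obtain ⟨hA, hB, hn⟩ := h
    rw [card_Y'_of_ne a hB, hn]
    rfl

theorem card_Y'_of_oddCond {f : ℕ} (hK : Fintype.card K = 2 ^ f) (hf : Odd f) (j : Fin 6)
    (a : Param K) (h : oddCond j a) :
    Nat.card (Y' a) = (![1, 2, 2, 1, 2, 4] : Fin 6 → ℕ) j := by
  rw [oddCond_iff] at h
  fin_cases j
  · exact card_Y'_eq_one a h.1 h.2
  · exact card_Y'_eq_two a h.1 h.2
  · obtain ⟨hA, hB⟩ := h
    rw [card_Y'_of_ne a hB, hA, ncard_cubicRoots_zero_of_odd hK hf hB]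
    rfl
  all_goals
    obtain ⟨hA, hB, hn⟩ := h
    rw [card_Y'_of_ne a hB, hn]
    rfl

/-- The size of a subfamily: each pair `(A, B)` comes from `(q - 1)⁴` parameters, and each parameter
contributes `k²` characters. -/
theorem ncard_subfamily_of_norm {C : Param K → Prop} {Q : K → K → Prop}
    (hQ : ∀ a, C a ↔ Q a.A a.B) {k : ℕ} (hk : ∀ a, C a → Nat.card (Y' a) = k) :
    ((subfamily C).ncard : ℚ) = ((Fintype.card K : ℚ) - 1) ^ 4 *
      {p : K × K | p.1 ≠ 1 ∧ p.2 ≠ p.1 + 1 ∧ Q p.1 p.2}.ncard * (k : ℚ) ^ 2 := by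
  have h : Nat.card {a // C a} = Nat.card {a : Param K // Q a.A a.B} :=
    Nat.card_congr (Equiv.subtypeEquivRight hQ)
  rw [ncard_subfamily C k hk, h, card_param, Nat.card_eq_fintype_card]
  push_cast [Nat.cast_sub (Fintype.card_pos (α := K))]
  rfl

/-- The numbers of pairs `(A, B)` that satisfy the conditions, for even `f`. In the generic cases
they solve the linear equations of `numGeneric_equations`, with two primitive cube roots of unity.
-/
theorem ncard_evenNorm {f : ℕ} (hK : Fintype.card K = 2 ^ f) (hf : Even f) {q : ℚ}
    (hq : q = Fintype.card K) (i : Fin 7) :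
    ({p : K × K | p.1 ≠ 1 ∧ p.2 ≠ p.1 + 1 ∧ evenNorm i p.1 p.2}.ncard : ℚ) =
      (![1, q - 2, 2 * (q - 1) / 3, (q - 4) / 3, (q - 1) * (q - 2) / 3, q * (q - 3) / 2,
        (q - 4) * (q - 5) / 6] : Fin 7 → ℚ) i := by
  classical
  have hρ := card_cubeRts_of_even hK hf
  have h0 := ncard_pairs_zero_zero (K := K)
  have h1 := ncard_pairs_ne_zero_zero (K := K)
  have h2 := ncard_cubes (K := K)
  have h3 := ncard_noncubes (K := K)
  have h4 := numGeneric_equations (K := K)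
  rw [hρ] at h2 h4
  rw [← ncard_pairs_zero] at h2
  rw [← ncard_pairs_zero, ← ncard_pairs_zero] at h3
  qify at h0 h1 h2 h3 h4
  rw [← hq] at h1 h2 h3 h4
  obtain ⟨h4, h5, h6⟩ := h4
  fin_cases i
  · exact h0
  · exact h1
  · change (Set.ncard {p : K × K | p.1 ≠ 1 ∧ p.2 ≠ p.1 + 1 ∧
      (p.1 = 0 ∧ p.2 ≠ 0 ∧ ¬ (cubicRoots 0 p.2).Nonempty)} : ℚ) = 2 * (q - 1) / 3
    linarith
  · change (Set.ncard {p : K × K | p.1 ≠ 1 ∧ p.2 ≠ p.1 + 1 ∧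
      (p.1 = 0 ∧ p.2 ≠ 0 ∧ (cubicRoots 0 p.2).Nonempty)} : ℚ) = (q - 4) / 3
    linarith
  · change (numGeneric K 0 : ℚ) = (q - 1) * (q - 2) / 3
    linarith
  · change (numGeneric K 1 : ℚ) = q * (q - 3) / 2
    linarith
  · change (numGeneric K 3 : ℚ) = (q - 4) * (q - 5) / 6
    linarith

theorem ncard_F11even {f : ℕ} (hK : Fintype.card K = 2 ^ f) (hf : Even f) {q : ℚ}
    (hq : q = Fintype.card K) (i : Fin 7) :
    ((F11even K i).ncard : ℚ) =
      (![(q - 1) ^ 4,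
        4 * (q - 1) ^ 4 * (q - 2),
        2 * (q - 1) ^ 5 / 3,
        16 * (q - 1) ^ 4 * (q - 4) / 3,
        (q - 1) ^ 5 * (q - 2) / 3,
        2 * q * (q - 1) ^ 4 * (q - 3),
        8 * (q - 1) ^ 4 * (q - 4) * (q - 5) / 3] : Fin 7 → ℚ) i := by
  rw [F11even, ncard_subfamily_of_norm (evenCond_iff i) (card_Y'_of_evenCond hK hf i),
    ncard_evenNorm hK hf hq, ← hq]
  fin_cases i <;> simp <;> ring

/-- The numbers of pairs `(A, B)` that satisfy the conditions, for odd `f`. In the generic cases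
they solve the linear equations of `numGeneric_equations`, without primitive cube roots of unity. -/
theorem ncard_oddNorm {f : ℕ} (hK : Fintype.card K = 2 ^ f) (hf : Odd f) {q : ℚ}
    (hq : q = Fintype.card K) (j : Fin 6) :
    ({p : K × K | p.1 ≠ 1 ∧ p.2 ≠ p.1 + 1 ∧ oddNorm j p.1 p.2}.ncard : ℚ) =
      (![1, q - 2, q - 2, (q - 2) * (q + 1) / 3, (q - 2) * (q - 3) / 2,
        (q - 2) * (q - 5) / 6] : Fin 6 → ℚ) j := by
  classical
  have hρ := card_cubeRts_of_odd hK hf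
  have h0 := ncard_pairs_zero_zero (K := K)
  have h1 := ncard_pairs_ne_zero_zero (K := K)
  have h2 := ncard_ne_zero_one (K := K)
  have h3 := ncard_pairs_zero (K := K) fun _ => True
  have h4 := numGeneric_equations (K := K)
  simp only [and_true] at h3
  rw [← h3] at h2
  rw [hρ] at h4
  qify at h0 h1 h2 h4
  rw [← hq] at h1 h2 h4
  obtain ⟨h4, h5, h6⟩ := h4
  fin_cases j
  · exact h0
  · exact h1
  · exact h2
  · change (numGeneric K 0 : ℚ) = (q - 2) * (q + 1) / 3
    linarith
  · change (numGeneric K 1 : ℚ) = (q - 2) * (q - 3) / 2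
    linarith
  · change (numGeneric K 3 : ℚ) = (q - 2) * (q - 5) / 6
    linarith

theorem ncard_F11odd {f : ℕ} (hK : Fintype.card K = 2 ^ f) (hf : Odd f) {q : ℚ}
    (hq : q = Fintype.card K) (j : Fin 6) :
    ((F11odd K j).ncard : ℚ) =
      (![(q - 1) ^ 4,
        4 * (q - 1) ^ 4 * (q - 2),
        4 * (q - 1) ^ 4 * (q - 2),
        (q - 1) ^ 4 * (q - 2) * (q + 1) / 3,
        2 * (q - 1) ^ 4 * (q - 2) * (q - 3),
        8 * (q - 1) ^ 4 * (q - 2) * (q - 5) / 3] : Fin 6 → ℚ) j := by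
  rw [F11odd, ncard_subfamily_of_norm (oddCond_iff j) (card_Y'_of_oddCond hK hf j),
    ncard_oddNorm hK hf hq, ← hq]
  fin_cases j <;> simp <;> ring

theorem F11_eq_iUnion_even : F11 K = ⋃ i, F11even K i :=
  F11_eq_iUnion fun a => (exists_evenNorm a.A a.B).imp fun i h => (evenCond_iff i a).2 h

theorem F11_eq_iUnion_odd : F11 K = ⋃ j, F11odd K j :=
  F11_eq_iUnion fun a => (exists_oddNorm a.A a.B).imp fun j h => (oddCond_iff j a).2 h

theorem pairwise_disjoint_F11even :
    Pairwise fun i j => Disjoint (F11even K i) (F11even K j) := fun i j hij =>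
  disjoint_subfamily fun a hi hj =>
    hij (evenNorm_unique ((evenCond_iff i a).1 hi) ((evenCond_iff j a).1 hj))

theorem pairwise_disjoint_F11odd :
    Pairwise fun i j => Disjoint (F11odd K i) (F11odd K j) := fun i j hij =>
  disjoint_subfamily fun a hi hj =>
    hij (oddNorm_unique ((oddCond_iff i a).1 hi) ((oddCond_iff j a).1 hj))

end subfamilies

end UF4

end

theorem mainTheorem4 (K : Type*) [Field K] [Fintype K] [CharP K 2] (f : ℕ)
    (hK : Fintype.card K = 2 ^ f) (q : ℕ) (hq : q = 2 ^ f) :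
    -- the quattern group `X_S = X_P / X_N` is well defined, and `F₁₁` is a finite set
    ((UF4.X K UF4.coreN).subgroupOf (UF4.X K UF4.coreP)).Normal ∧
    (UF4.F11 K).Finite ∧
    -- the core has the form `[6, 10, 4]`: the four pairs of noncommuting root subgroups of `X_S`
    (∀ i ∈ ({2, 3, 5, 6, 7, 8, 9, 10, 12, 18} : Finset ℕ),
      ∀ j ∈ ({2, 3, 5, 6, 7, 8, 9, 10, 12, 18} : Finset ℕ), i < j →
        ((∃ s t : K, UF4.xS i s * UF4.xS j t ≠ UF4.xS j t * UF4.xS i s) ↔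
          (i, j) ∈ ({(2, 3), (2, 7), (3, 5), (5, 7)} : Finset (ℕ × ℕ)))) ∧
    -- inflation and induction identify `F₁₁` with a set of irreducible characters of `U`
    (∀ χ ∈ UF4.F11 K, UF4.Quattern.toU χ ∈ IrrChar (UF4.U K) ∧
      UF4.Quattern.toU χ 1 = (q : ℂ) ^ 2 * χ 1) ∧
    Set.InjOn UF4.Quattern.toU (UF4.F11 K) ∧
    -- the parametrization of `F₁₁` by labels `(a, μ, ν)`
    (∀ (a : UF4.Param K) (μ : UF4.X' a →* ℂˣ) (ν : UF4.Y' a →* ℂˣ),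
      ∃! χ : UF4.XS K → ℂ, UF4.HasLabel χ a μ ν) ∧
    (∀ (a : UF4.Param K) (μ : UF4.X' a →* ℂˣ) (ν : UF4.Y' a →* ℂˣ) (χ : UF4.XS K → ℂ),
      UF4.HasLabel χ a μ ν → χ ∈ UF4.F11 K ∧ UF4.HasParam χ a) ∧
    (∀ χ ∈ UF4.F11 K,
      ∃! l : (a : UF4.Param K) × ((UF4.X' a →* ℂˣ) × (UF4.Y' a →* ℂˣ)),
        UF4.HasLabel χ l.1 l.2.1 l.2.2) ∧
    -- the subfamilies for even `f`
    (Even f →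
      UF4.F11 K = (⋃ i, UF4.F11even K i) ∧
      Pairwise (fun i j => Disjoint (UF4.F11even K i) (UF4.F11even K j)) ∧
      (∀ i, ((UF4.F11even K i).ncard : ℚ) =
        (![((q : ℚ) - 1) ^ 4,
          4 * ((q : ℚ) - 1) ^ 4 * ((q : ℚ) - 2),
          2 * ((q : ℚ) - 1) ^ 5 / 3,
          16 * ((q : ℚ) - 1) ^ 4 * ((q : ℚ) - 4) / 3,
          ((q : ℚ) - 1) ^ 5 * ((q : ℚ) - 2) / 3,
          2 * (q : ℚ) * ((q : ℚ) - 1) ^ 4 * ((q : ℚ) - 3),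
          8 * ((q : ℚ) - 1) ^ 4 * ((q : ℚ) - 4) * ((q : ℚ) - 5) / 3] : Fin 7 → ℚ) i) ∧
      (∀ i, ∀ χ ∈ UF4.F11even K i, χ 1 =
        (![(q : ℂ) ^ 2, (q : ℂ) ^ 2 / 2, (q : ℂ) ^ 2, (q : ℂ) ^ 2 / 4,
          (q : ℂ) ^ 2, (q : ℂ) ^ 2 / 2, (q : ℂ) ^ 2 / 4] : Fin 7 → ℂ) i) ∧
      (∀ i, ∀ a : UF4.Param K, UF4.evenCond i a →
        Nat.card (UF4.X' a) = (![1, 2, 1, 4, 1, 2, 4] : Fin 7 → ℕ) i ∧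
        Nat.card (UF4.Y' a) = (![1, 2, 1, 4, 1, 2, 4] : Fin 7 → ℕ) i)) ∧
    -- the subfamilies for odd `f`
    (Odd f →
      UF4.F11 K = (⋃ j, UF4.F11odd K j) ∧
      Pairwise (fun i j => Disjoint (UF4.F11odd K i) (UF4.F11odd K j)) ∧
      (∀ j, ((UF4.F11odd K j).ncard : ℚ) =
        (![((q : ℚ) - 1) ^ 4,
          4 * ((q : ℚ) - 1) ^ 4 * ((q : ℚ) - 2),
          4 * ((q : ℚ) - 1) ^ 4 * ((q : ℚ) - 2),
          ((q : ℚ) - 1) ^ 4 * ((q : ℚ) - 2) * ((q : ℚ) + 1) / 3,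
          2 * ((q : ℚ) - 1) ^ 4 * ((q : ℚ) - 2) * ((q : ℚ) - 3),
          8 * ((q : ℚ) - 1) ^ 4 * ((q : ℚ) - 2) * ((q : ℚ) - 5) / 3] : Fin 6 → ℚ) j) ∧
      (∀ j, ∀ χ ∈ UF4.F11odd K j, χ 1 =
        (![(q : ℂ) ^ 2, (q : ℂ) ^ 2 / 2, (q : ℂ) ^ 2 / 2,
          (q : ℂ) ^ 2, (q : ℂ) ^ 2 / 2, (q : ℂ) ^ 2 / 4] : Fin 6 → ℂ) j) ∧
      (∀ j, ∀ a : UF4.Param K, UF4.oddCond j a →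
        Nat.card (UF4.X' a) = (![1, 2, 2, 1, 2, 4] : Fin 6 → ℕ) j ∧
        Nat.card (UF4.Y' a) = (![1, 2, 2, 1, 2, 4] : Fin 6 → ℕ) j)) := by
  have hqK : q = Fintype.card K := hq.trans hK.symm
  have hqN : Nat.card K = q := Nat.card_eq_fintype_card.trans hqK.symm
  refine ⟨UF4.normal_coreN, UF4.finite_F11, UF4.xS_noncommuting_iff,
    fun χ hχ => ⟨UF4.toU_mem_irrChar hχ, by rw [UF4.toU_one, hqN]⟩, UF4.toU_injOn,
    fun a μ ν => ?_, fun a μ ν χ h => ?_, fun χ hχ => UF4.existsUnique_label hχ,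
    fun hf => ⟨UF4.F11_eq_iUnion_even, UF4.pairwise_disjoint_F11even,
      UF4.ncard_F11even hK hf (by rw [hqK]), fun i χ hχ => ?_, fun i a h => ?_⟩,
    fun hf => ⟨UF4.F11_eq_iUnion_odd, UF4.pairwise_disjoint_F11odd,
      UF4.ncard_F11odd hK hf (by rw [hqK]), fun j χ hχ => ?_, fun j a h => ?_⟩⟩
  · exact ⟨_, (UF4.hasLabel_iff _ a μ ν).2 rfl, fun χ h => (UF4.hasLabel_iff χ a μ ν).1 h⟩
  · rw [UF4.hasLabel_iff] at h
    subst h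
    exact ⟨UF4.charFn_mem_F11 a μ ν, UF4.hasParam_charFn a μ ν⟩
  · rw [UF4.apply_one_of_mem_subfamily (UF4.card_Y'_of_evenCond hK hf i) hχ, hqN]
    fin_cases i <;> simp
  · rw [UF4.card_X'_eq_card_Y']
    exact ⟨UF4.card_Y'_of_evenCond hK hf i a h, UF4.card_Y'_of_evenCond hK hf i a h⟩
  · rw [UF4.apply_one_of_mem_subfamily (UF4.card_Y'_of_oddCond hK hf j) hχ, hqN]
    fin_cases j <;> simp
  · rw [UF4.card_X'_eq_card_Y']
    exact ⟨UF4.card_Y'_of_oddCond hK hf j a h, UF4.card_Y'_of_oddCond hK hf j a h⟩
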